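/- Let $d\ge 1$, $0<t_0<T$, and let $\sigma\in\mathbb{R}^{d\times d}$ be invertible. Let $W=(W^1,\dots,W^d)$ be independent Brownian sheets on $\mathbb{R}_+\times[0,1]$ defined on a probability space $(\Omega,\mathcal F,\mathrm P)$, and let $G_t(x,y)=1+2\sum_{k\ge1}e^{-\pi^2k^2t}\cos(k\pi x)\cos(k\pi y)$ be the Neumann heat kernel on $[0,1]$. Let $u=(u(t,x))_{t\in[0,T],\,x\in[0,1]}$ be the (continuous version of the) solution of $\partial_t u=\partial_x^2u+\sigma\dot W$ with zero initial condition and Neumann boundary conditions, that is, $$u_i(t,x)=\sum_{j=1}^d\sigma_{i,j}\int_0^t\!\!\int_0^1G_{t-r}(x,v)\,W^j(dr\,dv)\quad\text{a.s.},\qquad 1\le i\le d.$$ Put $I=[t_0,T]$, $J=[0,1]$, $\Delta((t,x);(s,y))=|t-s|^{1/2}+|x-y|$. *Notation.* For $N_0>0$ let $K_\beta(r)=r^{-\beta}$ if $\beta>0$, $K_0(r)=\log(N_0/r)$, and $K_\beta(r)=1$ if $\beta<0$. For a metric $\rho$ and a set $F$ let $\mathrm{Cap}^\rho_\beta(F)=\big[\inf_\mu\iint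 K_\beta(\rho(x,y))\,\mu(dx)\mu(dy)\big]^{-1}$, the infimum being over the probability measures $\mu$ with compact support in $F$ (with $1/\infty=0$). For $\beta\ge0$ let $\mathcal H^\rho_\beta(F)=\lim_{\epsilon\to0^+}\inf\sum_i(2r_i)^\beta$, the infimum being over the finite or countable covers of $F$ by open $\rho$-balls of radii $r_i\in\,]0,\epsilon]$, and let $\mathcal H^\rho_\beta(F)=\infty$ if $\beta<0$. The superscript is omitted when $\rho$ is the Euclidean metric. Let $B(z,r)$ be the open Euclidean ball. For $z\in\mathbb{R}^d$ let $\mathcal L(z)=\{(t,x)\in I\times J:u(t,x)=z\}$, let $\mathcal T(z)$ and $\mathcal X(z)$ be its projections on $I$ and $J$, and let $\mathcal L_x(z)=\{t\in I:u(t,x)=z\}$, $\mathcal L^t(z)=\{x\in J:u(t,x)=z\}$. For integers $n\ge1$, $k$, $\ell$ let $R^n_{k,\ell}=[k2^{-4n},(k+1)2^{-4n}]\times[\ell2^{-2n},(\ell+1)2^{-2n}]$. *Claim.* All constants below depend only on $d,T,t_0,\sigma$ and on $M$ (and, in (D) and (E), on $N_0$). (A) For $(t,x)\in I\times J$, $u(t,x)$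 has a continuous density $p_{t,x}$, and for $(t,x)\neq(s,y)$ in $I\times J$, $(u(t,x),u(s,y))$ has a continuous joint density $p_{t,x;s,y}$. For every $M>0$ there is $C>0$ such that $p_{t,x}(z)\ge C$ for all $(t,x)\in I\times J$ and $z\in[-M,M]^d$ (A1), and there is $c>0$ such that for all $(t,x)\ne(s,y)$ in $I\times J$ and $z_1,z_2\in[-M,M]^d$ (A2 with $\beta=d$) $$p_{t,x;s,y}(z_1,z_2)\le\frac{c}{\Delta((t,x);(s,y))^{d/2}}\exp\Big(-\frac{\|z_1-z_2\|^2}{c\,\Delta((t,x);(s,y))}\Big).$$ (B) (Small-ball condition with $\beta=d$, and hitting upper bounds.) For every $M>0$ there is $c\in\,]0,\infty[$ such that $\mathrm P\{u(R^n_{k,\ell})\cap B(z,\epsilon)\ne\varnothing\}\le c\,\epsilon^d$ for all $z\in[-M,M]^d$, all $n\ge1$, all $\epsilon>2^{-n-1}$ and all $R^n_{k,\ell}\subseteq I\times J$; and such that for all Borel $A\subseteq[-M,M]^d$, $t\in I$, $x\in J$: $\mathrm P\{u(I\times J)\cap A\neq\varnothing\}\le c\,\mathcal H_{d-6}(A)$,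 $\mathrm P\{u(\{t\}\times J)\cap A\neq\varnothing\}\le c\,\mathcal H_{d-2}(A)$, and $\mathrm P\{u(I\times\{x\})\cap A\neq\varnothing\}\le c\,\mathcal H_{d-4}(A)$. (C) (Level-set upper bounds.) For every $M>0$ there is $c\in\,]0,\infty[$ such that for all $z\in[-M,M]^d$, all compact $E\subseteq I\times J$, $F\subseteq I$, $G\subseteq J$, and all $x\in J$, $t\in I$: $\mathrm P\{\mathcal L(z)\cap E\ne\varnothing\}\le c\,\mathcal H^\Delta_{d/2}(E)$; $\mathrm P\{\mathcal T(z)\cap F\ne\varnothing\}\le c\,\mathcal H_{(d-2)/4}(F)$; $\mathrm P\{\mathcal X(z)\cap G\ne\varnothing\}\le c\,\mathcal H_{(d-4)/2}(G)$; $\mathrm P\{\mathcal L_x(z)\cap F\ne\varnothing\}\le c\,\mathcal H_{d/4}(F)$; $\mathrm P\{\mathcal L^t(z)\cap G\ne\varnothing\}\le c\,\mathcal H_{d/2}(G)$. (D) (Hitting lower bounds.) For every $M>0$ and every $N_0>\max(2M\sqrt d,\,T-t_0,\,1)$ there is $a\in\,]0,\infty[$ such that for all compact $A\subseteq[-M,M]^d$,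 $t\in I$, $x\in J$: $\mathrm P\{u(I\times J)\cap A\neq\varnothing\}\ge a\,\mathrm{Cap}_{d-6}(A)$, $\mathrm P\{u(\{t\}\times J)\cap A\neq\varnothing\}\ge a\,\mathrm{Cap}_{d-2}(A)$, and $\mathrm P\{u(I\times\{x\})\cap A\neq\varnothing\}\ge a\,\mathrm{Cap}_{d-4}(A)$. (E) (Level-set lower bounds.) For every $M>0$ and every $N_0$ as in (D) there is $a\in\,]0,\infty[$ such that for all $z\in B(0,M)$, all compact $E\subseteq I\times J$, $F\subseteq I$, $G\subseteq J$, and all $x\in J$, $t\in I$: $\mathrm P\{\mathcal L(z)\cap E\ne\varnothing\}\ge a\,\mathrm{Cap}^\Delta_{d/2}(E)$; $\mathrm P\{\mathcal T(z)\cap F\ne\varnothing\}\ge a\,\mathrm{Cap}_{(d-2)/4}(F)$; $\mathrm P\{\mathcal X(z)\cap G\ne\varnothing\}\ge a\,\mathrm{Cap}_{(d-4)/2}(G)$; $\mathrm P\{\mathcal L_x(z)\cap F\ne\varnothing\}\ge a\,\mathrm{Cap}_{d/4}(F)$; $\mathrm P\{\mathcal L^t(z)\cap G\ne\varnothing\}\ge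 a\,\mathrm{Cap}_{d/2}(G)$. (Probabilities of events that are not measurable are read as outer probabilities.) -/

import Mathlib

open MeasureTheory ProbabilityTheory Filter Topology
open scoped NNReal ENNReal

universe u

noncomputable section

namespace HeatHitting

/-- The state space `ℝ^d` with its Euclidean norm. -/
abbrev E (d : ℕ) : Type := EuclideanSpace ℝ (Fin d)

/-- The cube `[-M, M]^d`. -/
def cube (d : ℕ) (M : ℝ) : Set (E d) := {z | ∀ i, z i ∈ Set.Icc (-M) M}

/-! ### Space-time white noise and the Wiener integral -/

/-- `W = (W¹, …, W^d)` is a vector of independent Brownian sheets indexed by `ℝ₊ × [0, 1]`: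
the `W^j` are independent centred Gaussian processes, each with covariance
`E[W^j(s, x) W^j(t, y)] = min(s, t) min(x, y)`.
(Continuity of the sheets is not required; the noise only enters through its law.) -/
structure IsBrownianSheets {d : ℕ} {Ω : Type*} [MeasurableSpace Ω] (P : Measure Ω)
    (W : Fin d → ℝ≥0 × unitInterval → Ω → ℝ) : Prop where
  measurable : ∀ j p, Measurable (W j p)
  gaussian : ∀ j, IsGaussianProcess (W j) P
  mean : ∀ j p, ∫ ω, W j p ω ∂P = 0
  cov : ∀ j p q, ∫ ω, W j p ω * W j q ω ∂P =
    min (p.1 : ℝ) (q.1 : ℝ) * min (p.2 : ℝ) (q.2 : ℝ)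
  indep : iIndepFun (fun j ω p => W j p ω) P

/-- Lebesgue measure on `ℝ₊ × [0, 1]`, as a measure on `ℝ × ℝ`. -/
def stripMeasure : Measure (ℝ × ℝ) :=
  volume.restrict (Set.Ici 0 ×ˢ Set.Icc 0 1)

/-- A step function on `ℝ₊ × [0, 1]`: a finite linear combination of indicators of the
rectangles `]s₁, s₂] × ]x₁, x₂]`, where `lo = (s₁, x₁)` and `hi = (s₂, x₂)`. -/
structure StepFn where
  n : ℕ
  coef : Fin n → ℝ
  lo : Fin n → ℝ≥0 × unitInterval
  hi : Fin n → ℝ≥0 × unitInterval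
  le : ∀ k, lo k ≤ hi k

/-- The function given by a step function. -/
def StepFn.eval (f : StepFn) (p : ℝ × ℝ) : ℝ :=
  ∑ k, f.coef k * Set.indicator
    (Set.Ioc ((f.lo k).1 : ℝ) ((f.hi k).1 : ℝ) ×ˢ Set.Ioc ((f.lo k).2 : ℝ) ((f.hi k).2 : ℝ))
    (fun _ => (1 : ℝ)) p

/-- The integral of a step function against a sheet `w`: each rectangle is given the
rectangular increment of `w`. -/
def StepFn.integral {Ω : Type*} (f : StepFn) (w : ℝ≥0 × unitInterval → Ω → ℝ) (ω : Ω) : ℝ :=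
  ∑ k, f.coef k *
    (w (f.hi k) ω - w ((f.lo k).1, (f.hi k).2) ω - w ((f.hi k).1, (f.lo k).2) ω + w (f.lo k) ω)

/-- `X` is (a version of) the Wiener integral `∫∫ g(r, v) w(dr dv)` of the deterministic
square-integrable `g`: the `L²(P)`-limit of the integrals of step functions that tend to `g`
in `L²(ℝ₊ × [0, 1])`. -/
def IsWienerIntegral {Ω : Type*} [MeasurableSpace Ω] (P : Measure Ω) (w : ℝ≥0 × unitInterval → Ω → ℝ)
    (g : ℝ × ℝ → ℝ) (X : Ω → ℝ) : Prop :=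
  MemLp g 2 stripMeasure ∧ MemLp X 2 P ∧ ∃ f : ℕ → StepFn,
    Tendsto (fun n => eLpNorm (fun p => (f n).eval p - g p) 2 stripMeasure) atTop (𝓝 0) ∧
    Tendsto (fun n => eLpNorm (fun ω => (f n).integral w ω - X ω) 2 P) atTop (𝓝 0)

/-! ### The linear stochastic heat equation -/

/-- The Green kernel `G_t(x, y)` of the heat equation `∂_t = ∂_x²` on `[0, 1]` with Neumann
boundary conditions, for `t > 0`. -/
def neumannGreen (t x y : ℝ) : ℝ :=
  1 + ∑' k : ℕ, 2 * Real.exp (-(Real.pi ^ 2 * ((k : ℝ) + 1) ^ 2 * t)) *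
    Real.cos (((k : ℝ) + 1) * Real.pi * x) * Real.cos (((k : ℝ) + 1) * Real.pi * y)

/-- The integrand `(r, v) ↦ 1_{r < t} G_{t-r}(x, v)` at the point `p = (t, x)`. -/
def mildKernel (p : ℝ × ℝ) (q : ℝ × ℝ) : ℝ :=
  if q.1 < p.1 then neumannGreen (p.1 - q.1) p.2 q.2 else 0

/-- `u` is a continuous version on `[0, T] × [0, 1]` of the solution of
`∂_t u = ∂_x² u + σ Ẇ` with zero initial condition and Neumann boundary conditions:
`u_i(t, x) = ∑_j σ_{i j} ∫_0^t ∫_0^1 G_{t-r}(x, v) W^j(dr dv)` a.s., where `W` is a vector of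
independent Brownian sheets. -/
structure IsLinearSolution {d : ℕ} {Ω : Type*} [MeasurableSpace Ω] (P : Measure Ω) (T : ℝ)
    (σ : Matrix (Fin d) (Fin d) ℝ) (W : Fin d → ℝ≥0 × unitInterval → Ω → ℝ)
    (u : ℝ × ℝ → Ω → E d) : Prop where
  noise : IsBrownianSheets P W
  mild : ∀ p ∈ Set.Icc 0 T ×ˢ Set.Icc (0 : ℝ) 1, ∃ X : Fin d → Ω → ℝ,
    (∀ j, IsWienerIntegral P (W j) (mildKernel p) (X j)) ∧
    ∀ᵐ ω ∂P, ∀ i, u p ω i = ∑ j, σ i j * X j ω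
  continuous : ∀ᵐ ω ∂P, ContinuousOn (fun p => u p ω) (Set.Icc 0 T ×ˢ Set.Icc 0 1)

/-! ### Capacities and Hausdorff measures -/

/-- The parabolic metric `Δ((t, x); (s, y)) = |t - s|^{1/2} + |x - y|`. -/
def parabolicDist (p q : ℝ × ℝ) : ℝ := Real.sqrt |p.1 - q.1| + |p.2 - q.2|

/-- The kernel `K_β(r)`, `r ≥ 0`: `r^{-β}` if `β > 0`, `log(N₀ / r)` if `β = 0`, and `1` if
`β < 0`. It equals `∞` at `r = 0` when `β ≥ 0`. (It is only used for `r < N₀` when `β = 0`.) -/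
def rieszKernel (N₀ β r : ℝ) : ℝ≥0∞ :=
  if 0 < β then ENNReal.ofReal r ^ (-β)
  else if β = 0 then (if r = 0 then ⊤ else ENNReal.ofReal (Real.log (N₀ / r)))
  else 1

/-- The `β`-dimensional energy of `μ` with respect to the metric `ρ`. -/
def energy {X : Type*} [MeasurableSpace X] (ρ : X → X → ℝ) (N₀ β : ℝ) (μ : Measure X) : ℝ≥0∞ :=
  ∫⁻ x, ∫⁻ y, rieszKernel N₀ β (ρ x y) ∂μ ∂μ

/-- The Borel probability measures with compact support in `F`. -/
def probsOn {X : Type*} [TopologicalSpace X] [MeasurableSpace X] (F : Set X) :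
    Set (Measure X) :=
  {μ | IsProbabilityMeasure μ ∧ ∃ K, IsCompact K ∧ K ⊆ F ∧ μ Kᶜ = 0}

/-- The `β`-dimensional capacity with respect to the metric `ρ`, where `1 / ∞ = 0`. -/
def cap {X : Type*} [TopologicalSpace X] [MeasurableSpace X] (ρ : X → X → ℝ) (N₀ β : ℝ)
    (F : Set X) : ℝ≥0∞ :=
  (⨅ μ ∈ probsOn F, energy ρ N₀ β μ)⁻¹

/-- The infimum of `∑ (2 r_i)^β` over all (finite or infinite) countable covers of `F` by
open `ρ`-balls with radii `r_i ∈ ]0, ε]`. -/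
def ballContent {X : Type*} (ρ : X → X → ℝ) (β ε : ℝ) (F : Set X) : ℝ≥0∞ :=
  ⨅ (S : Set ℕ) (x : ℕ → X) (r : ℕ → ℝ) (_ : ∀ i ∈ S, 0 < r i ∧ r i ≤ ε)
    (_ : F ⊆ ⋃ i ∈ S, {y | ρ y (x i) < r i}), ∑' i : S, ENNReal.ofReal (2 * r i) ^ β

/-- The `β`-dimensional (spherical) Hausdorff measure with respect to the metric `ρ`, which
is infinite by convention if `β < 0`. The contents increase as `ε` decreases to `0`, so that
their limit is a supremum. -/
def hausdorff {X : Type*} (ρ : X → X → ℝ) (β : ℝ) (F : Set X) : ℝ≥0∞ :=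
  if β < 0 then ⊤ else ⨆ (ε : ℝ) (_ : 0 < ε), ballContent ρ β ε F

/-! ### Densities and hypotheses A1, A2 -/

/-- The random vector `X` has the continuous probability density function `p`. -/
structure HasContinuousDensity {Ω V : Type*} [MeasurableSpace Ω] [TopologicalSpace V]
    [MeasureSpace V] (P : Measure Ω) (X : Ω → V) (p : V → ℝ) : Prop where
  aemeasurable : AEMeasurable X P
  continuous : Continuous p
  nonneg : ∀ z, 0 ≤ p z
  map_eq : P.map X = volume.withDensity (fun z => ENNReal.ofReal (p z))

/-- Hypothesis A1 for the one-point densities `p₁ (t, x)`, `(t, x) ∈ I × J`. -/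
def HypA1 {d : ℕ} (A B : Set ℝ) (p₁ : ℝ × ℝ → E d → ℝ) : Prop :=
  ∀ M > 0, ∃ C > 0, ∀ p ∈ A ×ˢ B, ∀ z ∈ cube d M, C ≤ p₁ p z

/-- Hypothesis A2 with exponent `β` for the two-point densities `p₂ (t, x) (s, y)`. -/
def HypA2 {d : ℕ} (A B : Set ℝ) (β : ℝ) (p₂ : ℝ × ℝ → ℝ × ℝ → E d × E d → ℝ) : Prop :=
  ∀ M > 0, ∃ c > 0, ∀ p ∈ A ×ˢ B, ∀ q ∈ A ×ˢ B, p ≠ q →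
    ∀ z₁ ∈ cube d M, ∀ z₂ ∈ cube d M,
      p₂ p q (z₁, z₂) ≤ c / parabolicDist p q ^ (β / 2) *
        Real.exp (-(‖z₁ - z₂‖ ^ 2 / (c * parabolicDist p q)))

/-! ### Hitting probabilities

In this section `A` and `B` are the time and space intervals, `v` is a random field on
`A × B`, and `a` is a constant. -/

section Hitting

variable {d : ℕ} {Ω : Type*} [MeasurableSpace Ω]

/-- The probability that `v(S)` meets `K`. -/
def hitProb (P : Measure Ω) (v : ℝ × ℝ → Ω → E d) (S : Set (ℝ × ℝ)) (K : Set (E d)) : ℝ≥0∞ :=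
  P {ω | (((fun p => v p ω) '' S) ∩ K).Nonempty}

/-- The rectangle `R^n_{k,ℓ} = [k 2^{-4n}, (k+1) 2^{-4n}] × [ℓ 2^{-2n}, (ℓ+1) 2^{-2n}]`. -/
def dyadicRect (n : ℕ) (k l : ℤ) : Set (ℝ × ℝ) :=
  Set.Icc ((k : ℝ) / 2 ^ (4 * n)) (((k : ℝ) + 1) / 2 ^ (4 * n)) ×ˢ
    Set.Icc ((l : ℝ) / 2 ^ (2 * n)) (((l : ℝ) + 1) / 2 ^ (2 * n))

/-- The small-ball condition `P{v(R^n_{k,ℓ}) ∩ B(z, ε) ≠ ∅} ≤ c ε^β` at all scales `ε` that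
the rectangles of generation `n` resolve. -/
def SmallBall (P : Measure Ω) (v : ℝ × ℝ → Ω → E d) (A B : Set ℝ) (β M c : ℝ) : Prop :=
  ∀ z ∈ cube d M, ∀ n : ℕ, 1 ≤ n → ∀ ε : ℝ, (1 / 2 : ℝ) ^ (n + 1) < ε →
    ∀ k l : ℤ, dyadicRect n k l ⊆ A ×ˢ B →
      hitProb P v (dyadicRect n k l) (Metric.ball z ε) ≤ ENNReal.ofReal (c * ε ^ β)

/-- The level set `𝓛(z; v)`. -/
def levelSet (v : ℝ × ℝ → Ω → E d) (A B : Set ℝ) (z : E d) (ω : Ω) : Set (ℝ × ℝ) :=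
  {p | p ∈ A ×ˢ B ∧ v p ω = z}

/-- The projection `𝓣(z; v)` of the level set on the time axis. -/
def levelTimes (v : ℝ × ℝ → Ω → E d) (A B : Set ℝ) (z : E d) (ω : Ω) : Set ℝ :=
  {t | t ∈ A ∧ ∃ x ∈ B, v (t, x) ω = z}

/-- The projection `𝓧(z; v)` of the level set on the space axis. -/
def levelPlaces (v : ℝ × ℝ → Ω → E d) (A B : Set ℝ) (z : E d) (ω : Ω) : Set ℝ :=
  {x | x ∈ B ∧ ∃ t ∈ A, v (t, x) ω = z}

/-- The `x`-section `𝓛_x(z; v)` of the level set. -/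
def levelTimesAt (v : ℝ × ℝ → Ω → E d) (A : Set ℝ) (x : ℝ) (z : E d) (ω : Ω) : Set ℝ :=
  {t | t ∈ A ∧ v (t, x) ω = z}

/-- The `t`-section `𝓛^t(z; v)` of the level set. -/
def levelPlacesAt (v : ℝ × ℝ → Ω → E d) (B : Set ℝ) (t : ℝ) (z : E d) (ω : Ω) : Set ℝ :=
  {x | x ∈ B ∧ v (t, x) ω = z}

/-- Lower bounds for the hitting probabilities of compact sets `K ⊆ [-M, M]^d`. -/
structure HitLowerBounds (P : Measure Ω) (v : ℝ × ℝ → Ω → E d) (A B : Set ℝ)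
    (N₀ β M a : ℝ) : Prop where
  spaceTime : ∀ K ⊆ cube d M, IsCompact K →
    ENNReal.ofReal a * cap dist N₀ (β - 6) K ≤ hitProb P v (A ×ˢ B) K
  fixedTime : ∀ t ∈ A, ∀ K ⊆ cube d M, IsCompact K →
    ENNReal.ofReal a * cap dist N₀ (β - 2) K ≤ hitProb P v ({t} ×ˢ B) K
  fixedPlace : ∀ x ∈ B, ∀ K ⊆ cube d M, IsCompact K →
    ENNReal.ofReal a * cap dist N₀ (β - 4) K ≤ hitProb P v (A ×ˢ {x}) K

/-- Lower bounds for the level sets at levels `z ∈ B(0, R)`. -/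
structure LevelLowerBounds (P : Measure Ω) (v : ℝ × ℝ → Ω → E d) (A B : Set ℝ)
    (N₀ β R a : ℝ) : Prop where
  level : ∀ z ∈ Metric.ball (0 : E d) R, ∀ H ⊆ A ×ˢ B, IsCompact H →
    ENNReal.ofReal a * cap parabolicDist N₀ (β / 2) H ≤
      P {ω | (levelSet v A B z ω ∩ H).Nonempty}
  times : ∀ z ∈ Metric.ball (0 : E d) R, ∀ F ⊆ A, IsCompact F →
    ENNReal.ofReal a * cap dist N₀ ((β - 2) / 4) F ≤
      P {ω | (levelTimes v A B z ω ∩ F).Nonempty}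
  places : ∀ z ∈ Metric.ball (0 : E d) R, ∀ G ⊆ B, IsCompact G →
    ENNReal.ofReal a * cap dist N₀ ((β - 4) / 2) G ≤
      P {ω | (levelPlaces v A B z ω ∩ G).Nonempty}
  timesAt : ∀ z ∈ Metric.ball (0 : E d) R, ∀ F ⊆ A, IsCompact F → ∀ x ∈ B,
    ENNReal.ofReal a * cap dist N₀ (β / 4) F ≤
      P {ω | (levelTimesAt v A x z ω ∩ F).Nonempty}
  placesAt : ∀ z ∈ Metric.ball (0 : E d) R, ∀ G ⊆ B, IsCompact G → ∀ t ∈ A,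
    ENNReal.ofReal a * cap dist N₀ (β / 2) G ≤
      P {ω | (levelPlacesAt v B t z ω ∩ G).Nonempty}

/-- Upper bounds for the hitting probabilities of Borel sets `K ⊆ [-M, M]^d`. -/
structure HitUpperBounds (P : Measure Ω) (v : ℝ × ℝ → Ω → E d) (A B : Set ℝ)
    (β M a : ℝ) : Prop where
  spaceTime : ∀ K ⊆ cube d M, MeasurableSet K →
    hitProb P v (A ×ˢ B) K ≤ ENNReal.ofReal a * hausdorff dist (β - 6) K
  fixedTime : ∀ t ∈ A, ∀ K ⊆ cube d M, MeasurableSet K →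
    hitProb P v ({t} ×ˢ B) K ≤ ENNReal.ofReal a * hausdorff dist (β - 2) K
  fixedPlace : ∀ x ∈ B, ∀ K ⊆ cube d M, MeasurableSet K →
    hitProb P v (A ×ˢ {x}) K ≤ ENNReal.ofReal a * hausdorff dist (β - 4) K

/-- Upper bounds for the level sets at levels `z ∈ [-M, M]^d`. -/
structure LevelUpperBounds (P : Measure Ω) (v : ℝ × ℝ → Ω → E d) (A B : Set ℝ)
    (β M a : ℝ) : Prop where
  level : ∀ z ∈ cube d M, ∀ H ⊆ A ×ˢ B, IsCompact H →
    P {ω | (levelSet v A B z ω ∩ H).Nonempty} ≤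
      ENNReal.ofReal a * hausdorff parabolicDist (β / 2) H
  times : ∀ z ∈ cube d M, ∀ F ⊆ A, IsCompact F →
    P {ω | (levelTimes v A B z ω ∩ F).Nonempty} ≤
      ENNReal.ofReal a * hausdorff dist ((β - 2) / 4) F
  places : ∀ z ∈ cube d M, ∀ G ⊆ B, IsCompact G →
    P {ω | (levelPlaces v A B z ω ∩ G).Nonempty} ≤
      ENNReal.ofReal a * hausdorff dist ((β - 4) / 2) G
  timesAt : ∀ z ∈ cube d M, ∀ F ⊆ A, IsCompact F → ∀ x ∈ B,
    P {ω | (levelTimesAt v A x z ω ∩ F).Nonempty} ≤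
      ENNReal.ofReal a * hausdorff dist (β / 4) F
  placesAt : ∀ z ∈ cube d M, ∀ G ⊆ B, IsCompact G → ∀ t ∈ A,
    P {ω | (levelPlacesAt v B t z ω ∩ G).Nonempty} ≤
      ENNReal.ofReal a * hausdorff dist (β / 2) G

end Hitting

end HeatHitting

end

/-! The components of `σ⁻¹ u` are independent centred Gaussian fields with covariance `heatCov`, and
all the bounds follow from two estimates of this covariance and from path continuity. In the cosine
basis the constant mode is a Brownian motion and the other modes are Ornstein–Uhlenbeck processes
started at zero, so Var(X(p) - l X(q)) is an explicit sum of nonnegative terms (`hasSum_quadForm`).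
Comparison with ∑ min(h, k⁻²), which is of order √h, and with the closed form of the Neumann Green
function shows that increments have variance at most CΔ (`exists_incr_le`) and that two-point
covariance determinants are at least cΔ (`exists_le_det`). Hence X(p) = l X(q) + R with R
independent of X(q), Var R of order Δ and (l - 1)² = O(Δ). The densities are then explicit, and A1
and A2 can be read off.

All upper bounds rest on one estimate: over a parameter rectangle with sides of order δ⁴ and δ², the
field meets a given δ-ball with probability O(δ^d) (`exists_hitProb_small_le`). A path that meets
the ball is followed from fine to coarse grids. Either it is still near the ball at a corner, or it
makes a large increment at some grid point where it is near the ball. Because R is independent of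
X(q), the second event has probability δ^d times a Gaussian tail, and the tails are summable over
the grids. A box with sides l, w is cut into at most a multiple of (1 + l/δ⁴)(1 + w/δ²) such
rectangles, and a covering argument yields the Hausdorff measures (`measure_le_mul_hausdorff`).

The lower bounds come from a second moment argument on pairs (parameter, level)
(`exists_le_prob_graph`). For a probability measure on such pairs, the mass of the pairs that the
graph approaches within ε has mean at least cε^d and second moment at most Cε^{2d} times the energy
for the kernel max(√Δ, ‖z - w‖)^{-d}. Cauchy–Schwarz gives a bound uniform in ε, and compactness
turns near hits into hits. The measure used is the image of a product m × μ, where μ is a competitor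
in the capacity and m is uniform on the remaining parameters. Integration over m lowers the exponent
d by the dimension b of m at the scale of the field: 4 for time, 2 for space
(`lintegral_inv_max_pow_le`, `exists_dyadic_sum_le`). `exists_mul_cap_le` covers all eight lower
bounds. -/

namespace HeatHitting

/-! ### The covariance of the solution -/

/-- The eigenvalue `π² (k + 1)²` of the Neumann Laplacian. -/
noncomputable def freq (k : ℕ) : ℝ := Real.pi ^ 2 * ((k : ℝ) + 1) ^ 2

/-- The eigenfunction `cos ((k + 1) π x)` of the Neumann Laplacian. -/
noncomputable def cosMode (k : ℕ) (x : ℝ) : ℝ := Real.cos (((k : ℝ) + 1) * Real.pi * x)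

/-- The covariance function of each component of the solution with `σ = 1`. -/
noncomputable def heatCov (p q : ℝ × ℝ) : ℝ :=
  min p.1 q.1 + ∑' k : ℕ, cosMode k p.2 * cosMode k q.2 *
    (Real.exp (-(freq k * |p.1 - q.1|)) - Real.exp (-(freq k * (p.1 + q.1)))) / freq k

lemma freq_pos (k : ℕ) : 0 < freq k := by
  unfold freq; positivity

lemma sq_le_freq (k : ℕ) : ((k : ℝ) + 1) ^ 2 ≤ freq k := by
  unfold freq
  have : 1 ≤ Real.pi ^ 2 := by nlinarith [Real.pi_gt_three]
  nlinarith [sq_nonneg ((k : ℝ) + 1)]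

lemma freq_le (k : ℕ) : freq k ≤ 10 * ((k : ℝ) + 1) ^ 2 := by
  unfold freq
  have : Real.pi ^ 2 ≤ 10 := by nlinarith [Real.pi_lt_d2, Real.pi_gt_three]
  nlinarith [sq_nonneg ((k : ℝ) + 1)]

lemma freq_mono (k : ℕ) : freq 0 ≤ freq k := by
  unfold freq
  have : (0 : ℝ) ≤ k := k.cast_nonneg
  gcongr
  simp

lemma abs_cosMode_le (k : ℕ) (x : ℝ) : |cosMode k x| ≤ 1 := Real.abs_cos_le_one _

lemma cosMode_sq_le (k : ℕ) (x : ℝ) : cosMode k x ^ 2 ≤ 1 := by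
  rw [sq_le_one_iff_abs_le_one]; exact abs_cosMode_le k x

lemma summable_inv_freq : Summable fun k => 1 / freq k := by
  have h : Summable fun k : ℕ => 1 / ((k : ℝ) + 1) ^ 2 := by
    have := (summable_nat_add_iff 1).2 (Real.summable_one_div_nat_pow (p := 2).2 one_lt_two)
    simpa using this
  refine Summable.of_nonneg_of_le (fun k => by have := freq_pos k; positivity) (fun k => ?_) h
  exact one_div_le_one_div_of_le (by positivity) (sq_le_freq k)

lemma summable_div_freq {b : ℕ → ℝ} {C : ℝ} (hb : ∀ k, |b k| ≤ C) :
    Summable fun k => b k / freq k := by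
  refine Summable.of_norm_bounded (summable_inv_freq.mul_left C) (fun k => ?_)
  have := freq_pos k
  rw [Real.norm_eq_abs, abs_div, abs_of_pos this, mul_one_div]
  gcongr
  exact hb k

lemma abs_exp_sub_exp_le {a b : ℝ} (ha : 0 ≤ a) (hb : 0 ≤ b) :
    |Real.exp (-a) - Real.exp (-b)| ≤ 1 := by
  have h1 : Real.exp (-a) ≤ 1 := Real.exp_le_one_iff.2 (by linarith)
  have h2 : Real.exp (-b) ≤ 1 := Real.exp_le_one_iff.2 (by linarith)
  have := Real.exp_pos (-a)
  have := Real.exp_pos (-b)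
  rw [abs_le]; constructor <;> linarith

lemma hasSum_heatCov {p q : ℝ × ℝ} (hp : 0 ≤ p.1) (hq : 0 ≤ q.1) :
    HasSum (fun k => cosMode k p.2 * cosMode k q.2 *
      (Real.exp (-(freq k * |p.1 - q.1|)) - Real.exp (-(freq k * (p.1 + q.1)))) / freq k)
      (heatCov p q - min p.1 q.1) := by
  rw [heatCov, add_sub_cancel_left]
  refine (summable_div_freq (C := 1) fun k => ?_).hasSum
  have h := freq_pos k
  rw [abs_mul, abs_mul]
  have h1 := abs_cosMode_le k p.2
  have h2 := abs_cosMode_le k q.2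
  have h3 := abs_exp_sub_exp_le (a := freq k * |p.1 - q.1|) (b := freq k * (p.1 + q.1))
    (by positivity) (by positivity)
  calc _ ≤ (1 : ℝ) * 1 * 1 := by gcongr
    _ = 1 := by norm_num

lemma heatCov_comm (p q : ℝ × ℝ) : heatCov p q = heatCov q p := by
  unfold heatCov
  rw [min_comm, abs_sub_comm, add_comm p.1 q.1]
  simp only [mul_comm (cosMode _ p.2)]

/-- The variance of `X(p) - λ X(q)` as a sum of nonnegative terms. -/
lemma hasSum_quadForm {t s : ℝ} (hs : 0 ≤ s) (hst : s ≤ t) (x y l : ℝ) :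
    HasSum (fun k => (cosMode k x ^ 2 * (1 - Real.exp (-(freq k * (t - s))) ^ 2) +
      (cosMode k x * Real.exp (-(freq k * (t - s))) - l * cosMode k y) ^ 2 *
        (1 - Real.exp (-(freq k * s)) ^ 2)) / freq k)
      (heatCov (t, x) (t, x) - 2 * l * heatCov (t, x) (s, y) + l ^ 2 * heatCov (s, y) (s, y)
        - (t - s) - s * (1 - l) ^ 2) := by
  have ht : 0 ≤ t := hs.trans hst
  have h1 := hasSum_heatCov (p := (t, x)) (q := (t, x)) ht ht
  have h2 := (hasSum_heatCov (p := (t, x)) (q := (s, y)) ht hs).mul_left (2 * l)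
  have h3 := (hasSum_heatCov (p := (s, y)) (q := (s, y)) hs hs).mul_left (l ^ 2)
  have h := (h1.sub h2).add h3
  simp only [min_self, min_eq_right hst, sub_self, abs_zero, mul_zero, neg_zero,
    Real.exp_zero, abs_of_nonneg (sub_nonneg.2 hst)] at h
  convert! h using 1
  · ext k
    -- Every exponential is a monomial in exp(-f(t - s)) and exp(-f s); the termwise identity is
    -- then algebra.
    have e1 : Real.exp (-(freq k * (t + t))) =
        Real.exp (-(freq k * (t - s))) ^ 2 * Real.exp (-(freq k * s)) ^ 2 := by
      rw [← Real.exp_nat_mul, ← Real.exp_nat_mul, ← Real.exp_add]; congr 1; push_cast; ring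
    have e2 : Real.exp (-(freq k * (t + s))) =
        Real.exp (-(freq k * (t - s))) * Real.exp (-(freq k * s)) ^ 2 := by
      rw [← Real.exp_nat_mul, ← Real.exp_add]; congr 1; push_cast; ring
    have e3 : Real.exp (-(freq k * (s + s))) = Real.exp (-(freq k * s)) ^ 2 := by
      rw [← Real.exp_nat_mul]; congr 1; push_cast; ring
    rw [e1, e2, e3]
    ring
  · ring

/-! ### Elementary series -/

/-- A discrete substitute for ∫₀^∞ r²/(1 + xr)² dx = r. With r = √h the increments of this sequence
have the size of min(h, k⁻²), which gives both bounds of order √h below. -/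
lemma tendsto_telescope {r : ℝ} (hr : 0 < r) :
    Tendsto (fun n : ℕ => r ^ 2 * n / (1 + n * r)) atTop (𝓝 r) := by
  have h : Tendsto (fun n : ℕ => r - r / (1 + n * r)) atTop (𝓝 (r - 0)) := by
    refine tendsto_const_nhds.sub (Tendsto.const_div_atTop ?_ _)
    exact tendsto_atTop_add_const_left _ _
      ((tendsto_natCast_atTop_atTop).atTop_mul_const hr)
  rw [sub_zero] at h
  refine h.congr fun n => ?_
  have : (0 : ℝ) < 1 + n * r := by positivity
  field_simp
  ring

lemma telescope_sub {r : ℝ} (hr : 0 < r) (n : ℕ) :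
    r ^ 2 * ((n + 1 : ℕ) : ℝ) / (1 + ((n + 1 : ℕ) : ℝ) * r) - r ^ 2 * n / (1 + n * r) =
      r ^ 2 / ((1 + ((n : ℝ) + 1) * r) * (1 + n * r)) := by
  have h1 : (0 : ℝ) < 1 + n * r := by positivity
  have h2 : (0 : ℝ) < 1 + ((n : ℝ) + 1) * r := by positivity
  push_cast
  field_simp
  ring

lemma summable_one_sub_exp {h : ℝ} (hh : 0 ≤ h) :
    Summable fun k => (1 - Real.exp (-(freq k * h))) / freq k := by
  refine summable_div_freq (C := 1) fun k => ?_
  have := abs_exp_sub_exp_le (a := 0) (b := freq k * h) le_rfl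
    (mul_nonneg (freq_pos k).le hh)
  simpa using this

lemma one_sub_exp_div_le (h : ℝ) (k : ℕ) :
    (1 - Real.exp (-(freq k * h))) / freq k ≤ h := by
  have := freq_pos k
  rw [div_le_iff₀ this]
  nlinarith [Real.add_one_le_exp (-(freq k * h))]

lemma one_sub_exp_div_le' (h : ℝ) (k : ℕ) :
    (1 - Real.exp (-(freq k * h))) / freq k ≤ 1 / ((k : ℝ) + 1) ^ 2 := by
  have := freq_pos k
  calc _ ≤ 1 / freq k := by
        gcongr; linarith [Real.exp_pos (-(freq k * h))]
    _ ≤ _ := one_div_le_one_div_of_le (by positivity) (sq_le_freq k)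

lemma tsum_one_sub_exp_le {h : ℝ} (hh : 0 ≤ h) :
    ∑' k, (1 - Real.exp (-(freq k * h))) / freq k ≤ 4 * √h := by
  rcases hh.eq_or_lt with rfl | hpos
  · simp
  set r := √h with hr
  have hr0 : 0 < r := Real.sqrt_pos.2 hpos
  have hrh : r ^ 2 = h := Real.sq_sqrt hh
  refine (summable_one_sub_exp hh).tsum_le_of_sum_range_le fun n => ?_
  -- The term is at most min(h, (k+1)⁻²), hence at most 4r²/(1 + (k+1)r)², according to whether
  -- (k+1)r is below or above 1.
  have key : ∀ k : ℕ, (1 - Real.exp (-(freq k * h))) / freq k ≤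
      4 * (r ^ 2 * ((k + 1 : ℕ) : ℝ) / (1 + ((k + 1 : ℕ) : ℝ) * r) - r ^ 2 * k / (1 + k * r)) := by
    intro k
    rw [telescope_sub hr0]
    have h1 : (0 : ℝ) < 1 + k * r := by positivity
    have h2 : (0 : ℝ) < 1 + ((k : ℝ) + 1) * r := by positivity
    have h3 : r ^ 2 / (1 + ((k : ℝ) + 1) * r) ^ 2 ≤
        r ^ 2 / ((1 + ((k : ℝ) + 1) * r) * (1 + k * r)) := by
      apply div_le_div_of_nonneg_left (by positivity) (by positivity)
      rw [sq]; gcongr; linarith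
    refine le_trans ?_ (mul_le_mul_of_nonneg_left h3 (by norm_num))
    rcases le_total (((k : ℝ) + 1) * r) 1 with hc | hc
    · refine (one_sub_exp_div_le h k).trans ?_
      rw [← mul_div_assoc, le_div_iff₀ (by positivity), ← hrh]
      have : (1 + ((k : ℝ) + 1) * r) ^ 2 ≤ 4 := by nlinarith
      nlinarith [sq_nonneg r]
    · refine (one_sub_exp_div_le' h k).trans ?_
      rw [← mul_div_assoc, div_le_div_iff₀ (by positivity) (by positivity)]
      nlinarith
  calc _ ≤ ∑ k ∈ Finset.range n, 4 * (r ^ 2 * ((k + 1 : ℕ) : ℝ) / (1 + ((k + 1 : ℕ) : ℝ) * r)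
        - r ^ 2 * k / (1 + k * r)) := Finset.sum_le_sum fun k _ => key k
    _ = 4 * (r ^ 2 * n / (1 + n * r)) := by
        rw [← Finset.mul_sum, Finset.sum_range_sub (fun k : ℕ => r ^ 2 * (k : ℝ) / (1 + k * r))]
        simp
    _ ≤ 4 * r := by
        gcongr
        rw [div_le_iff₀ (by positivity)]
        nlinarith

/-- A single mode may vanish at x, but a mode and the mode of twice its frequency cannot vanish
together. With c = cos² θ the sum is 4c² - 3c + 1, minimal at c = 3/8. -/
lemma cos_sq_add_cos_two_mul_sq (θ : ℝ) : 7 / 16 ≤ Real.cos θ ^ 2 + Real.cos (2 * θ) ^ 2 := by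
  rw [Real.cos_two_mul]
  nlinarith [sq_nonneg (Real.cos θ ^ 2 - 3 / 8)]

lemma le_one_sub_exp {y : ℝ} (hy : 0 ≤ y) : y / (1 + y) ≤ 1 - Real.exp (-y) := by
  have h1 := Real.add_one_le_exp y
  have h2 : Real.exp (-y) ≤ 1 / (1 + y) := by
    rw [Real.exp_neg, ← one_div]
    exact one_div_le_one_div_of_le (by positivity) (by linarith)
  have : y / (1 + y) = 1 - 1 / (1 + y) := by field_simp; ring
  linarith

/-- Lower bound for the variance that is produced during a time interval of length `h`. -/
lemma le_tsum_cos_sq {h : ℝ} (hh : 0 ≤ h) (x : ℝ) :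
    √h / (1 + √h) / 200 ≤
      ∑' k, cosMode k x ^ 2 * (1 - Real.exp (-(freq k * h)) ^ 2) / freq k := by
  rcases hh.eq_or_lt with rfl | hpos
  · simp
  set r := √h with hr
  have hr0 : 0 < r := Real.sqrt_pos.2 hpos
  have hrh : r ^ 2 = h := Real.sq_sqrt hh
  set F : ℕ → ℝ := fun k => cosMode k x ^ 2 * (1 - Real.exp (-(freq k * h)) ^ 2) / freq k
  have hE : ∀ k, Real.exp (-(freq k * h)) ^ 2 = Real.exp (-(2 * (freq k * h))) := fun k => by
    rw [← Real.exp_nat_mul]; congr 1; push_cast; ring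
  have hF0 : ∀ k, 0 ≤ F k := fun k => by
    have := freq_pos k
    have : Real.exp (-(freq k * h)) ^ 2 ≤ 1 := by
      rw [hE]; exact Real.exp_le_one_iff.2 (by have := freq_pos k; simp; positivity)
    have : 0 ≤ 1 - Real.exp (-(freq k * h)) ^ 2 := by linarith
    positivity
  have hFs : Summable F := by
    refine summable_div_freq (C := 1) fun k => ?_
    rw [abs_mul, abs_of_nonneg (sq_nonneg _), hE]
    have := abs_exp_sub_exp_le (a := 0) (b := 2 * (freq k * h)) le_rfl
      (by have := freq_pos k; positivity)
    rw [neg_zero, Real.exp_zero] at this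
    nlinarith [cosMode_sq_le k x, abs_nonneg (1 - Real.exp (-(2 * (freq k * h)))),
      sq_nonneg (cosMode k x)]
  -- Index 2k+1 carries the frequency 2(k+1). Summing `F k + F (2k+1)` over k counts each term at
  -- most twice, which turns 1/100 into 1/200.
  have hinj : Function.Injective fun k : ℕ => 2 * k + 1 := fun a b h => by simpa using h
  have hFs2 : Summable fun k => F (2 * k + 1) := hFs.comp_injective hinj
  have h2 : ∑' k, F (2 * k + 1) ≤ ∑' k, F k := by
    refine Summable.tsum_le_tsum_of_inj (fun k : ℕ => 2 * k + 1) hinj (fun c _ => hF0 c)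
      (fun k => le_rfl) hFs2 hFs
  have hlow : ∀ k : ℕ, cosMode k x ^ 2 * (2 * h / (1 + 2 * (10 * ((k : ℝ) + 1) ^ 2) * h)) ≤ F k := by
    intro k
    have hf := freq_pos k
    have h1 := le_one_sub_exp (y := 2 * (freq k * h)) (by positivity)
    simp only [F, hE, mul_div_assoc]
    gcongr
    rw [le_div_iff₀ hf]
    refine le_trans ?_ h1
    rw [← mul_div_assoc, div_mul_eq_mul_div, div_le_div_iff₀ (by positivity) (by positivity)]
    have := freq_le k
    have e : 2 * h * freq k * (1 + 2 * (freq k * h)) ≤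
        2 * h * freq k * (1 + 2 * (10 * ((k : ℝ) + 1) ^ 2) * h) := by
      gcongr 2 * h * freq k * (1 + ?_)
      nlinarith
    linarith
  -- With θ = (k+1)r, both modes contribute at least their squared cosine times 2h/(1 + 80θ²), where
  -- 80 = 2·10·2² comes from the doubled frequency. The constant 1/100 is allowed because (7/8)/80 >
  -- 1/100. The telescoping starts at index 1, so its total is r - r²/(1+r) = r/(1+r).
  have key : ∀ k : ℕ, (1 / 100) * (r ^ 2 * ((k + 1 + 1 : ℕ) : ℝ) / (1 + ((k + 1 + 1 : ℕ) : ℝ) * r)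
      - r ^ 2 * ((k + 1 : ℕ) : ℝ) / (1 + ((k + 1 : ℕ) : ℝ) * r)) ≤ F k + F (2 * k + 1) := by
    intro k
    rw [telescope_sub hr0]
    have hcos := cos_sq_add_cos_two_mul_sq (((k : ℝ) + 1) * Real.pi * x)
    have hm : cosMode (2 * k + 1) x = Real.cos (2 * (((k : ℝ) + 1) * Real.pi * x)) := by
      unfold cosMode; congr 1; push_cast; ring
    have hm' : cosMode k x = Real.cos (((k : ℝ) + 1) * Real.pi * x) := rfl
    have l1 := hlow k
    have l2 := hlow (2 * k + 1)
    rw [← hm, ← hm'] at hcos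
    set θ := ((k : ℝ) + 1) * r with hθ
    have hθ0 : 0 < θ := by positivity
    have e1 : 2 * h / (1 + 80 * θ ^ 2) ≤ 2 * h / (1 + 2 * (10 * ((k : ℝ) + 1) ^ 2) * h) := by
      apply div_le_div_of_nonneg_left (by positivity) (by positivity)
      rw [hθ, mul_pow, hrh]
      nlinarith [mul_nonneg (sq_nonneg ((k : ℝ) + 1)) hh]
    have e2 : 2 * h / (1 + 80 * θ ^ 2) ≤
        2 * h / (1 + 2 * (10 * (((2 * k + 1 : ℕ) : ℝ) + 1) ^ 2) * h) := by
      apply le_of_eq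
      rw [hθ, mul_pow, hrh]; push_cast; ring
    have e3 : (7 / 16) * (2 * h / (1 + 80 * θ ^ 2)) ≤ F k + F (2 * k + 1) := by
      have := mul_le_mul_of_nonneg_left e1 (sq_nonneg (cosMode k x))
      have := mul_le_mul_of_nonneg_left e2 (sq_nonneg (cosMode (2 * k + 1) x))
      have : 0 ≤ 2 * h / (1 + 80 * θ ^ 2) := by positivity
      nlinarith
    refine le_trans ?_ e3
    rw [hrh]
    have hk1 : (((k + 1 : ℕ) : ℝ)) = (k : ℝ) + 1 := by push_cast; ring
    rw [hk1, ← hθ, ← mul_div_assoc, ← mul_div_assoc]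
    have : θ ≤ ((k : ℝ) + 1 + 1) * r := by rw [hθ]; gcongr; linarith
    rw [div_le_div_iff₀ (by positivity) (by positivity)]
    have : 1 + 80 * θ ^ 2 ≤ 80 * ((1 + ((k : ℝ) + 1 + 1) * r) * (1 + θ)) := by nlinarith
    nlinarith
  have hlim : r / (1 + r) / 100 ≤ ∑' k, (F k + F (2 * k + 1)) := by
    have hT := (((tendsto_telescope hr0).comp (tendsto_add_atTop_nat 1)).sub_const
      (r ^ 2 / (1 + r))).const_mul (1 / 100 : ℝ)
    have e : (1 / 100 : ℝ) * (r - r ^ 2 / (1 + r)) = r / (1 + r) / 100 := by field_simp; ring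
    rw [e] at hT
    refine le_of_tendsto hT (Eventually.of_forall fun n => ?_)
    refine le_trans ?_ ((hFs.add hFs2).sum_le_tsum (Finset.range n)
      (fun k _ => add_nonneg (hF0 _) (hF0 _)))
    refine le_trans (le_of_eq ?_) (Finset.sum_le_sum fun k _ => key k)
    rw [← Finset.mul_sum, Finset.sum_range_sub
      (fun k : ℕ => r ^ 2 * ((k + 1 : ℕ) : ℝ) / (1 + ((k + 1 : ℕ) : ℝ) * r))]
    simp
  rw [hFs.tsum_add hFs2] at hlim
  have : r / (1 + r) / 200 = r / (1 + r) / 100 / 2 := by ring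
  linarith

/-! ### The Green function of the Neumann Laplacian -/

/-- Fourier series of the second Bernoulli polynomial, evaluated at θ/2. -/
lemma hasSum_cos_div_freq {θ : ℝ} (h0 : 0 ≤ θ) (h2 : θ ≤ 2) :
    HasSum (fun k : ℕ => Real.cos (((k : ℝ) + 1) * Real.pi * θ) / freq k)
      (θ ^ 2 / 4 - θ / 2 + 1 / 6) := by
  have h := hasSum_one_div_nat_pow_mul_cos (k := 1) one_ne_zero (x := θ / 2)
    ⟨by linarith, by linarith⟩
  have hB := bernoulliFun_two (θ / 2)
  rw [bernoulliFun] at hB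
  rw [mul_one, hB] at h
  have h' := (hasSum_nat_add_iff' 1).2 h
  have h'' := h'.mul_left (1 / Real.pi ^ 2)
  convert! h'' using 1
  · ext k
    unfold freq
    push_cast
    have : 2 * Real.pi * ((k : ℝ) + 1) * (θ / 2) = ((k : ℝ) + 1) * Real.pi * θ := by ring
    rw [this]
    field_simp
  · simp [Nat.factorial]
    field_simp
    ring

/-- By the product formula the sum splits into cosine series at x - y and x + y, which both lie in
[0, 2] once y ≤ x. -/
lemma hasSum_cosMode_mul {x y : ℝ} (hx : x ∈ Set.Icc (0 : ℝ) 1) (hy : y ∈ Set.Icc (0 : ℝ) 1) :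
    HasSum (fun k => cosMode k x * cosMode k y / freq k)
      ((1 / 3 - max x y + (x ^ 2 + y ^ 2) / 2) / 2) := by
  wlog hxy : y ≤ x generalizing x y
  · have := this hy hx (le_of_not_ge hxy)
    rw [max_comm, add_comm (x ^ 2)]
    simpa only [mul_comm (cosMode _ y)] using this
  have h1 := hasSum_cos_div_freq (θ := x - y) (by linarith) (by linarith [hx.2, hy.1])
  have h2 := hasSum_cos_div_freq (θ := x + y) (by linarith [hx.1, hy.1]) (by linarith [hx.2, hy.2])
  have h := (h1.add h2).mul_left (1 / 2)
  convert! h using 1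
  · ext k
    have e1 : ((k : ℝ) + 1) * Real.pi * (x - y) =
      ((k : ℝ) + 1) * Real.pi * x - ((k : ℝ) + 1) * Real.pi * y := by ring
    have e2 : ((k : ℝ) + 1) * Real.pi * (x + y) =
      ((k : ℝ) + 1) * Real.pi * x + ((k : ℝ) + 1) * Real.pi * y := by ring
    rw [e1, e2, Real.cos_sub, Real.cos_add]
    unfold cosMode
    ring
  · rw [max_eq_left hxy]; ring

/-- The quadratic form of the Neumann Green function. -/
lemma hasSum_cosMode_sub_sq {x y : ℝ} (hx : x ∈ Set.Icc (0 : ℝ) 1) (hy : y ∈ Set.Icc (0 : ℝ) 1)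
    (l : ℝ) :
    HasSum (fun k => (cosMode k x - l * cosMode k y) ^ 2 / freq k)
      (((1 / 3 - x + x ^ 2) - 2 * l * (1 / 3 - max x y + (x ^ 2 + y ^ 2) / 2)
        + l ^ 2 * (1 / 3 - y + y ^ 2)) / 2) := by
  have h := ((hasSum_cosMode_mul hx hx).sub ((hasSum_cosMode_mul hx hy).mul_left (2 * l))).add
    ((hasSum_cosMode_mul hy hy).mul_left (l ^ 2))
  convert! h using 1
  · ext k; ring
  · simp only [max_self]; ring

lemma hasSum_cosMode_sub_sq_one {x y : ℝ} (hx : x ∈ Set.Icc (0 : ℝ) 1)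
    (hy : y ∈ Set.Icc (0 : ℝ) 1) :
    HasSum (fun k => (cosMode k x - cosMode k y) ^ 2 / freq k) (|x - y| / 2) := by
  have h := hasSum_cosMode_sub_sq hx hy 1
  convert! h using 1
  · simp
  · rcases le_total x y with hxy | hxy
    · rw [max_eq_right hxy, abs_of_nonpos (by linarith)]; ring
    · rw [max_eq_left hxy, abs_of_nonneg (by linarith)]; ring

/-- With the constant mode included, the right side is half of A - 2lB + l²D, where A, B, D are
values of one plus a Green function. Completing the square, D times this form is (AD - B²) + (lD -
B)², so l drops out. The identities A + D - 2B = |x - y| and A - D = (x - y)(x + y - 1), together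
with A, D ≥ 1, bound the determinant AD - B² below by |x - y|/2. -/
lemma le_tsum_cosMode_sub_sq {x y : ℝ} (hx : x ∈ Set.Icc (0 : ℝ) 1) (hy : y ∈ Set.Icc (0 : ℝ) 1)
    (l : ℝ) :
    |x - y| / 8 ≤ (1 - l) ^ 2 / 2 + ∑' k, (cosMode k x - l * cosMode k y) ^ 2 / freq k := by
  rw [(hasSum_cosMode_sub_sq hx hy l).tsum_eq]
  obtain ⟨hx0, hx1⟩ := hx
  obtain ⟨hy0, hy1⟩ := hy
  set A := 1 + (1 / 3 - x + x ^ 2) with hA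
  set B := 1 + (1 / 3 - max x y + (x ^ 2 + y ^ 2) / 2) with hB
  set D := 1 + (1 / 3 - y + y ^ 2) with hD
  have hD0 : 1 ≤ D := by nlinarith [sq_nonneg (y - 1 / 2)]
  have hD2 : D ≤ 2 := by nlinarith
  have hdet : |x - y| / 2 ≤ A * D - B ^ 2 := by
    have e : A + D - 2 * B = |x - y| := by
      rcases le_total x y with hxy | hxy
      · rw [hA, hB, hD, max_eq_right hxy, abs_of_nonpos (by linarith)]; ring
      · rw [hA, hB, hD, max_eq_left hxy, abs_of_nonneg (by linarith)]; ring
    have e2 : (A - D) ^ 2 = |x - y| ^ 2 * (x + y - 1) ^ 2 := by rw [sq_abs]; ring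
    set δ := |x - y| with hδ
    have hδ0 : 0 ≤ δ := abs_nonneg _
    have hδ1 : δ ≤ 1 := by rw [hδ, abs_le]; constructor <;> linarith
    have hBe : B = (A + D - δ) / 2 := by linarith
    have hAD : A * D - B ^ 2 = δ / 4 * (2 * (A + D) - δ - δ * (x + y - 1) ^ 2) := by
      rw [hBe]; linear_combination (-1 / 4) * e2
    rw [hAD]
    have hA0 : 1 ≤ A := by nlinarith [sq_nonneg (x - 1 / 2)]
    have h1 : (x + y - 1) ^ 2 ≤ 1 := by
      rw [sq_le_one_iff_abs_le_one, abs_le]; constructor <;> linarith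
    have h2 : δ * (x + y - 1) ^ 2 ≤ 1 := mul_le_one₀ hδ1 (sq_nonneg _) h1
    have h3 : 2 ≤ 2 * (A + D) - δ - δ * (x + y - 1) ^ 2 := by linarith
    calc δ / 2 = δ / 4 * 2 := by ring
      _ ≤ _ := by gcongr
  have hq : A * D - B ^ 2 ≤ D * (A - 2 * l * B + l ^ 2 * D) := by
    linarith [sq_nonneg (l * D - B), show D * (A - 2 * l * B + l ^ 2 * D) - (A * D - B ^ 2) =
      (l * D - B) ^ 2 by ring]
  have hQ : |x - y| / 4 ≤ A - 2 * l * B + l ^ 2 * D := by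
    have h0 : 0 ≤ |x - y| := abs_nonneg _
    have h1 : |x - y| / 2 ≤ D * (A - 2 * l * B + l ^ 2 * D) := hdet.trans hq
    have h2 : 0 ≤ A - 2 * l * B + l ^ 2 * D :=
      nonneg_of_mul_nonneg_right (by linarith) (by linarith : 0 < D)
    have h3 := mul_le_mul_of_nonneg_right hD2 h2
    linarith
  have : (1 - l) ^ 2 / 2 + ((1 / 3 - x + x ^ 2) - 2 * l * (1 / 3 - max x y + (x ^ 2 + y ^ 2) / 2)
        + l ^ 2 * (1 / 3 - y + y ^ 2)) / 2 = (A - 2 * l * B + l ^ 2 * D) / 2 := by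
    rw [hA, hB, hD]; ring
  rw [this]
  linarith

/-! ### Bounds for the covariance -/

lemma le_heatCov_self {p : ℝ × ℝ} (hp : 0 ≤ p.1) : p.1 ≤ heatCov p p := by
  have h := hasSum_heatCov hp hp
  have h0 := h.nonneg fun k => by
    have hf := freq_pos k
    have : Real.exp (-(freq k * (p.1 + p.1))) ≤ Real.exp (-(freq k * |p.1 - p.1|)) := by
      simp; positivity
    rw [← sq]
    have := sub_nonneg.2 this
    positivity
  simp at h0
  linarith

lemma heatCov_self_le {p : ℝ × ℝ} (hp : 0 ≤ p.1) : heatCov p p ≤ p.1 + 1 := by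
  have h := hasSum_heatCov hp hp
  have h1 := hasSum_cos_div_freq (θ := 0) le_rfl (by norm_num)
  have := hasSum_le (fun k => ?_) h h1
  · simp at this; linarith
  · have hf := freq_pos k
    gcongr
    simp only [sub_self, abs_zero, mul_zero, neg_zero, Real.exp_zero, Real.cos_zero]
    rw [← sq]
    have h1 := cosMode_sq_le k p.2
    have h2 : Real.exp (-(freq k * (p.1 + p.1))) ≤ 1 := Real.exp_le_one_iff.2 (by simp; positivity)
    have h3 := Real.exp_pos (-(freq k * (p.1 + p.1)))
    exact mul_le_one₀ h1 (by linarith) (by linarith)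

lemma parabolicDist_comm (p q : ℝ × ℝ) : parabolicDist p q = parabolicDist q p := by
  unfold parabolicDist; rw [abs_sub_comm, abs_sub_comm p.2]

lemma parabolicDist_nonneg (p q : ℝ × ℝ) : 0 ≤ parabolicDist p q := by
  unfold parabolicDist; positivity

lemma parabolicDist_pos {p q : ℝ × ℝ} (h : p ≠ q) : 0 < parabolicDist p q := by
  unfold parabolicDist
  by_cases h1 : p.1 = q.1
  · have : p.2 ≠ q.2 := fun h2 => h (Prod.ext h1 h2)
    have : 0 < |p.2 - q.2| := abs_pos.2 (sub_ne_zero.2 this)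
    positivity
  · have : 0 < √|p.1 - q.1| := Real.sqrt_pos.2 (abs_pos.2 (sub_ne_zero.2 h1))
    positivity

/-- The variance of the increments is at most a multiple of the parabolic distance. -/
lemma exists_incr_le (T : ℝ) : ∃ C > 0, ∀ p ∈ Set.Icc 0 T ×ˢ Set.Icc (0 : ℝ) 1,
    ∀ q ∈ Set.Icc 0 T ×ˢ Set.Icc (0 : ℝ) 1,
      heatCov p p - 2 * heatCov p q + heatCov q q ≤ C * parabolicDist p q := by
  -- The constant mode contributes t - s ≤ √T √(t - s), four times the series of
  -- `tsum_one_sub_exp_le` contributes 16√(t - s), and the spatial series contributes |x - y|.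
  refine ⟨√T + 17, by positivity, ?_⟩
  rintro ⟨t, x⟩ ⟨⟨ht0, htT⟩, hx⟩ ⟨s, y⟩ ⟨⟨hs0, hsT⟩, hy⟩
  simp only at ht0 htT hx hs0 hsT hy
  wlog hst : s ≤ t generalizing s t x y
  · have := this s y hy hs0 hsT t x hx ht0 htT (le_of_not_ge hst)
    rw [parabolicDist_comm, heatCov_comm (t, x) (s, y)]
    linarith
  have hh : 0 ≤ t - s := sub_nonneg.2 hst
  have hq := hasSum_quadForm hs0 hst x y 1
  have hb := ((summable_one_sub_exp hh).hasSum.mul_left 4).add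
    ((hasSum_cosMode_sub_sq_one hx hy).mul_left 2)
  have hle := hasSum_le (fun k => ?_) hq hb
  · have h1 := tsum_one_sub_exp_le hh
    have h2 : t - s ≤ √T * √(t - s) := by
      calc t - s = √(t - s) * √(t - s) := (Real.mul_self_sqrt hh).symm
        _ ≤ √T * √(t - s) := by gcongr; linarith
    unfold parabolicDist
    simp only [abs_of_nonneg hh]
    have := abs_nonneg (x - y)
    have := mul_nonneg (Real.sqrt_nonneg T) this
    have := Real.sqrt_nonneg (t - s)
    nlinarith
  · have hf := freq_pos k
    set E := Real.exp (-(freq k * (t - s)))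
    set E' := Real.exp (-(freq k * s))
    have hE0 : 0 < E := Real.exp_pos _
    have hE1 : E ≤ 1 := Real.exp_le_one_iff.2 (by simp; positivity)
    have hE0' : 0 < E' := Real.exp_pos _
    have hE1' : E' ≤ 1 := Real.exp_le_one_iff.2 (by simp; positivity)
    rw [← mul_div_assoc, ← mul_div_assoc, ← add_div]
    refine div_le_div_of_nonneg_right ?_ hf.le
    set a := cosMode k x
    set b := cosMode k y
    have ha : a ^ 2 ≤ 1 := cosMode_sq_le k x
    have h1 : a ^ 2 * (1 - E ^ 2) ≤ 2 * (1 - E) := by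
      have : 1 - E ^ 2 ≤ 2 * (1 - E) := by nlinarith
      have h0 : 0 ≤ 1 - E ^ 2 := by nlinarith
      nlinarith
    have h2 : (a * E - 1 * b) ^ 2 * (1 - E' ^ 2) ≤ (a * E - 1 * b) ^ 2 :=
      mul_le_of_le_one_right (sq_nonneg _) (by nlinarith [sq_nonneg E'])
    have h3 : (a * E - 1 * b) ^ 2 ≤ 2 * (a - b) ^ 2 + 2 * (a ^ 2 * (1 - E) ^ 2) := by
      nlinarith [sq_nonneg ((a - b) + a * (1 - E))]
    have h4 : a ^ 2 * (1 - E) ^ 2 ≤ 1 - E := by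
      have : (1 - E) ^ 2 ≤ 1 - E := by nlinarith
      nlinarith [sq_nonneg (1 - E)]
    linarith

/-- Since aE - b = (a - b) - a(1 - E), removing the time decay E costs half of the square and an
error of at most 1 - E. Divided by the eigenvalue, the errors sum to O(√(t - s)). -/
lemma heat_term_lower {a b E κ w : ℝ} (hE : 0 < E) (hE1 : E ≤ 1) (hκ : 0 ≤ κ) (hκ1 : κ ≤ 1)
    (hw : κ ≤ w) (ha : a ^ 2 ≤ 1) :
    κ / 2 * (a - b) ^ 2 - (1 - E) ≤ a ^ 2 * (1 - E ^ 2) + (a * E - b) ^ 2 * w := by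
  have e1 : (a - b) ^ 2 / 2 - a ^ 2 * (1 - E) ^ 2 ≤ (a * E - b) ^ 2 := by
    linarith [sq_nonneg ((a - b) - 2 * (a * (1 - E))), show (a * E - b) ^ 2 -
      ((a - b) ^ 2 / 2 - a ^ 2 * (1 - E) ^ 2) = ((a - b) - 2 * (a * (1 - E))) ^ 2 / 2 by ring]
  have e2 : a ^ 2 * (1 - E) ^ 2 ≤ 1 - E := by
    have h : (1 - E) ^ 2 ≤ 1 - E := by nlinarith
    calc a ^ 2 * (1 - E) ^ 2 ≤ 1 * (1 - E) ^ 2 := by gcongr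
      _ ≤ 1 - E := by linarith
  have e3 : κ * (a * E - b) ^ 2 ≤ (a * E - b) ^ 2 * w := by
    rw [mul_comm]; gcongr
  have e4 : κ * ((a - b) ^ 2 / 2 - (1 - E)) ≤ κ * (a * E - b) ^ 2 := by
    gcongr; linarith
  have e5 : κ * (1 - E) ≤ 1 - E := mul_le_of_le_one_left (by linarith) hκ1
  have e6 : 0 ≤ a ^ 2 * (1 - E ^ 2) := mul_nonneg (sq_nonneg _) (by nlinarith)
  linarith

/-- The covariance matrix of the values at two points is nondegenerate. -/
lemma exists_le_det {t₀ : ℝ} (ht₀ : 0 < t₀) (T : ℝ) :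
    ∃ c > 0, ∀ p ∈ Set.Icc t₀ T ×ˢ Set.Icc (0 : ℝ) 1,
      ∀ q ∈ Set.Icc t₀ T ×ˢ Set.Icc (0 : ℝ) 1,
      c * parabolicDist p q ≤ heatCov p p * heatCov q q - heatCov p q ^ 2 := by
  -- By time t₀ every mode has acquired at least the fraction κ of its stationary variance; the
  -- slowest mode is the worst.
  set κ := 1 - Real.exp (-(freq 0 * t₀)) ^ 2 with hκ
  have hf0 := freq_pos 0
  have hκ0 : 0 < κ := by
    have : Real.exp (-(freq 0 * t₀)) < 1 := Real.exp_lt_one_iff.2 (by simp; positivity)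
    have := Real.exp_pos (-(freq 0 * t₀))
    rw [hκ]; nlinarith
  have hκ1 : κ ≤ 1 := by rw [hκ]; nlinarith [sq_nonneg (Real.exp (-(freq 0 * t₀)))]
  set m := min t₀ (κ / 2) with hm
  have hm0 : 0 < m := by rw [hm]; positivity
  set c₁ := 1 / (1 + √T) / 200 with hc₁
  have hc₁0 : 0 < c₁ := by rw [hc₁]; positivity
  set c₂ := m / 8 / (1 + 4 / c₁) with hc₂
  have hc₂0 : 0 < c₂ := by rw [hc₂]; positivity
  set c := min c₁ c₂ / 2
  have hc0 : 0 < c := by positivity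
  refine ⟨c * t₀, by positivity, ?_⟩
  rintro ⟨t, x⟩ ⟨⟨ht0, htT⟩, hx⟩ ⟨s, y⟩ ⟨⟨hs0, hsT⟩, hy⟩
  simp only at ht0 htT hx hs0 hsT hy
  wlog hst : s ≤ t generalizing s t x y
  · have := this s y hy hs0 hsT t x hx ht0 htT (le_of_not_ge hst)
    rw [parabolicDist_comm, heatCov_comm (t, x) (s, y)]
    linarith
  have hh : 0 ≤ t - s := sub_nonneg.2 hst
  have hs00 : 0 ≤ s := by linarith
  have hqq : t₀ ≤ heatCov (s, y) (s, y) := hs0.trans (le_heatCov_self (p := (s, y)) hs00)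
  -- For the regression coefficient l, the determinant is Var X(q) times the residual variance Q,
  -- and Var X(q) ≥ t₀. It remains to bound Q below by a multiple of Δ.
  set l := heatCov (t, x) (s, y) / heatCov (s, y) (s, y) with hl
  have hq := hasSum_quadForm hs00 hst x y l
  set Q := heatCov (t, x) (t, x) - 2 * l * heatCov (t, x) (s, y)
    + l ^ 2 * heatCov (s, y) (s, y) with hQ
  have hdet : heatCov (t, x) (t, x) * heatCov (s, y) (s, y) - heatCov (t, x) (s, y) ^ 2 =
      heatCov (s, y) (s, y) * Q := by
    have : heatCov (s, y) (s, y) ≠ 0 := by linarith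
    rw [hQ, hl]; field_simp; ring
  have hE : ∀ k, 0 < Real.exp (-(freq k * (t - s))) ∧ Real.exp (-(freq k * (t - s))) ≤ 1 := fun k =>
    ⟨Real.exp_pos _, Real.exp_le_one_iff.2 (by have := freq_pos k; simp; positivity)⟩
  have hE' : ∀ k, κ ≤ 1 - Real.exp (-(freq k * s)) ^ 2 := fun k => by
    have h1 := freq_mono k
    have h2 : freq 0 * t₀ ≤ freq k * s := by
      have := freq_pos k
      gcongr
    have h3 := Real.exp_le_exp.2 (neg_le_neg h2)
    have h4 := pow_le_pow_left₀ (Real.exp_pos _).le h3 2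
    rw [hκ]
    linarith
  -- Only the noise that enters after time s is kept; no choice of l can cancel it.
  have b1 : c₁ * √(t - s) ≤ Q := by
    have h1 := le_tsum_cos_sq hh x
    have hsum : Summable fun k => cosMode k x ^ 2 *
        (1 - Real.exp (-(freq k * (t - s))) ^ 2) / freq k := by
      refine summable_div_freq (C := 1) fun k => ?_
      have := hE k
      have h0 : 0 ≤ 1 - Real.exp (-(freq k * (t - s))) ^ 2 := by nlinarith
      rw [abs_of_nonneg (by positivity)]
      exact mul_le_one₀ (cosMode_sq_le k x) h0 (by nlinarith)
    have h2 := hasSum_le (fun k => ?_) hsum.hasSum hq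
    · have h3 : c₁ * √(t - s) ≤ √(t - s) / (1 + √(t - s)) / 200 := by
        have e : c₁ * √(t - s) = √(t - s) / (1 + √T) / 200 := by rw [hc₁]; ring
        rw [e]
        gcongr
        linarith
      nlinarith [mul_nonneg hs00 (sq_nonneg (1 - l))]
    · have := freq_pos k
      gcongr
      have h3 := hE' k
      have : 0 ≤ 1 - Real.exp (-(freq k * s)) ^ 2 := by linarith
      linarith [mul_nonneg (sq_nonneg (cosMode k x * Real.exp (-(freq k * (t - s)))
        - l * cosMode k y)) this]
  -- The field at time s alone already distinguishes x from y; comparing the two times costs the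
  -- subtracted term.
  have b2 : m * |x - y| / 8 - 4 * √(t - s) ≤ Q := by
    have h1 := tsum_one_sub_exp_le hh
    have h2 := le_tsum_cosMode_sub_sq hx hy l
    have hs1 := ((hasSum_cosMode_sub_sq hx hy l).summable.hasSum.mul_left (κ / 2)).sub
      (summable_one_sub_exp hh).hasSum
    have hle := hasSum_le (fun k => ?_) hs1 hq
    · set Y := ∑' k, (cosMode k x - l * cosMode k y) ^ 2 / freq k with hY
      have hY0 : 0 ≤ Y := tsum_nonneg fun k => by have := freq_pos k; positivity
      have e1 : m * Y ≤ κ / 2 * Y := by gcongr; exact min_le_right _ _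
      have e2 : m * ((1 - l) ^ 2 / 2) ≤ s * (1 - l) ^ 2 := by
        have : m ≤ s := (min_le_left _ _).trans hs0
        nlinarith [sq_nonneg (1 - l), mul_le_mul_of_nonneg_right this (sq_nonneg (1 - l))]
      have e3 := mul_le_mul_of_nonneg_left h2 hm0.le
      linarith
    · have hf := freq_pos k
      rw [← mul_div_assoc, ← sub_div]
      refine div_le_div_of_nonneg_right ?_ hf.le
      obtain ⟨h3, h4⟩ := hE k
      have h5 := hE' k
      exact heat_term_lower h3 h4 hκ0.le hκ1 h5 (cosMode_sq_le k x)
  have hQ0 : 0 ≤ Q := le_trans (by positivity) b1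
  -- The loss 4√(t - s) in `b2` is at most 4Q/c₁ by `b1`, so it can be moved to the side of Q.
  have b3 : c₂ * |x - y| ≤ Q := by
    have h1 : √(t - s) ≤ Q / c₁ := by rw [le_div_iff₀ hc₁0]; linarith
    have h2 : m * |x - y| / 8 ≤ (1 + 4 / c₁) * Q := by
      have : (1 + 4 / c₁) * Q = Q + 4 * (Q / c₁) := by ring
      linarith
    have h3 : c₂ * |x - y| = m * |x - y| / 8 / (1 + 4 / c₁) := by rw [hc₂]; ring
    rw [h3, div_le_iff₀ (by positivity)]
    linarith
  rw [hdet]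
  have b4 : c * parabolicDist (t, x) (s, y) ≤ Q := by
    unfold parabolicDist
    simp only [abs_of_nonneg hh]
    have e1 : min c₁ c₂ * √(t - s) ≤ Q := le_trans (by gcongr; exact min_le_left _ _) b1
    have e2 : min c₁ c₂ * |x - y| ≤ Q := le_trans (by gcongr; exact min_le_right _ _) b3
    calc c * (√(t - s) + |x - y|) = (min c₁ c₂ * √(t - s) + min c₁ c₂ * |x - y|) / 2 := by
          simp only [c]; ring
      _ ≤ Q := by linarith
  calc c * t₀ * parabolicDist (t, x) (s, y) = t₀ * (c * parabolicDist (t, x) (s, y)) := by ring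
    _ ≤ heatCov (s, y) (s, y) * Q := by
        have := parabolicDist_nonneg (t, x) (s, y)
        have := ht₀.le.trans hqq
        gcongr

/-! ### The inner products of the mild kernels -/

lemma integral_cos_int_mul_pi {n : ℤ} (hn : n ≠ 0) :
    ∫ v in (0 : ℝ)..1, Real.cos (n * Real.pi * v) = 0 := by
  have h : (n : ℝ) * Real.pi ≠ 0 := mul_ne_zero (Int.cast_ne_zero.2 hn) Real.pi_ne_zero
  rw [intervalIntegral.integral_comp_mul_left (fun x => Real.cos x) h, integral_cos]
  simp [Real.sin_int_mul_pi]

lemma continuous_cosMode (k : ℕ) : Continuous (cosMode k) := by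
  unfold cosMode; fun_prop

lemma setIntegral_cosMode (k : ℕ) : ∫ v in Set.Icc (0 : ℝ) 1, cosMode k v = 0 := by
  rw [integral_Icc_eq_integral_Ioc, ← intervalIntegral.integral_of_le zero_le_one]
  have := integral_cos_int_mul_pi (n := (k : ℤ) + 1) (by positivity)
  simpa [cosMode] using this

lemma setIntegral_cosMode_mul (k l : ℕ) :
    ∫ v in Set.Icc (0 : ℝ) 1, cosMode k v * cosMode l v = if k = l then 1 / 2 else 0 := by
  rw [integral_Icc_eq_integral_Ioc, ← intervalIntegral.integral_of_le zero_le_one]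
  have e : ∀ v, cosMode k v * cosMode l v =
      (Real.cos (((k : ℤ) - l : ℤ) * Real.pi * v) +
        Real.cos (((k : ℤ) + l + 2 : ℤ) * Real.pi * v)) / 2 := fun v => by
    have e1 : (((k : ℤ) - l : ℤ) : ℝ) * Real.pi * v =
      ((k : ℝ) + 1) * Real.pi * v - ((l : ℝ) + 1) * Real.pi * v := by push_cast; ring
    have e2 : (((k : ℤ) + l + 2 : ℤ) : ℝ) * Real.pi * v =
      ((k : ℝ) + 1) * Real.pi * v + ((l : ℝ) + 1) * Real.pi * v := by push_cast; ring
    rw [e1, e2, Real.cos_sub, Real.cos_add]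
    unfold cosMode; ring
  simp_rw [e]
  rw [intervalIntegral.integral_div, intervalIntegral.integral_add
    (Continuous.intervalIntegrable (by fun_prop) _ _)
    (Continuous.intervalIntegrable (by fun_prop) _ _),
    integral_cos_int_mul_pi (n := (k : ℤ) + l + 2) (by positivity)]
  split_ifs with h
  · simp [h]
  · rw [integral_cos_int_mul_pi (n := (k : ℤ) - l) (by omega)]; simp

lemma integrable_tsum_of_summable_integral_norm {X : Type*} [MeasurableSpace X] {μ : Measure X}
    {f : ℕ → X → ℝ} (hf : ∀ k, Integrable (f k) μ) (hs : Summable fun k => ∫ x, ‖f k x‖ ∂μ) :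
    Integrable (fun x => ∑' k, f k x) μ := by
  refine ⟨(AEMeasurable.tsum fun k => (hf k).aemeasurable).aestronglyMeasurable, ?_⟩
  calc ∫⁻ x, ‖∑' k, f k x‖ₑ ∂μ ≤ ∫⁻ x, ∑' k, ‖f k x‖ₑ ∂μ :=
        lintegral_mono fun x => enorm_tsum_le_tsum_enorm
    _ = ∑' k, ∫⁻ x, ‖f k x‖ₑ ∂μ := lintegral_tsum fun k => (hf k).aestronglyMeasurable.enorm
    _ = ∑' k, ENNReal.ofReal (∫ x, ‖f k x‖ ∂μ) := by
        simp_rw [ofReal_integral_norm_eq_lintegral_enorm (hf _)]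
    _ < ∞ := hs.tsum_ofReal_lt_top

/-- Termwise integration, legitimate because the modes are bounded by 1 and the coefficients are
absolutely summable. It is used both for F a single mode, to extract a coefficient, and for F a
whole Green kernel. -/
lemma integral_one_add_cosSeries_mul {α : ℕ → ℝ} (hα : Summable fun k => |α k|) {F : ℝ → ℝ}
    (hF : Integrable F (volume.restrict (Set.Icc (0 : ℝ) 1))) :
    ∫ v in Set.Icc (0 : ℝ) 1, (1 + ∑' k, α k * cosMode k v) * F v =
      (∫ v in Set.Icc (0 : ℝ) 1, F v) +
        ∑' k, α k * ∫ v in Set.Icc (0 : ℝ) 1, cosMode k v * F v := by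
  have hi : ∀ k, Integrable (fun v => α k * (cosMode k v * F v))
      (volume.restrict (Set.Icc (0 : ℝ) 1)) := fun k =>
    (hF.bdd_mul (c := 1) (continuous_cosMode k).aestronglyMeasurable
      (Eventually.of_forall fun v => abs_cosMode_le k v)).const_mul _
  have hb : ∀ k v, ‖α k * (cosMode k v * F v)‖ ≤ |α k| * ‖F v‖ := fun k v => by
    rw [norm_mul, norm_mul, Real.norm_eq_abs, Real.norm_eq_abs (cosMode k v)]
    have := abs_cosMode_le k v
    gcongr
    exact mul_le_of_le_one_left (norm_nonneg _) this
  have hs : Summable fun k => ∫ v in Set.Icc (0 : ℝ) 1, ‖α k * (cosMode k v * F v)‖ := by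
    refine Summable.of_nonneg_of_le (fun k => integral_nonneg fun v => norm_nonneg _)
      (fun k => ?_) (hα.mul_right (∫ v in Set.Icc (0 : ℝ) 1, ‖F v‖))
    rw [← integral_const_mul]
    exact integral_mono (hi k).norm (hF.norm.const_mul _) (hb k)
  have hsum := hasSum_integral_of_summable_integral_norm hi hs
  have hS : ∀ v, (1 + ∑' k, α k * cosMode k v) * F v =
      F v + ∑' k, α k * (cosMode k v * F v) := fun v => by
    rw [add_mul, one_mul, ← tsum_mul_right]
    simp only [mul_assoc]
  simp_rw [hS]
  rw [integral_add hF, ← hsum.tsum_eq]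
  · simp_rw [integral_const_mul]
  · exact integrable_tsum_of_summable_integral_norm hi hs

lemma summable_exp_freq {τ : ℝ} (hτ : 0 < τ) : Summable fun k => Real.exp (-(freq k * τ)) := by
  refine Summable.of_nonneg_of_le (fun _ => (Real.exp_pos _).le) (fun k => ?_)
    (summable_inv_freq.mul_right (1 / τ))
  have hf := freq_pos k
  rw [Real.exp_neg, one_div_mul_one_div, ← one_div]
  exact one_div_le_one_div_of_le (by positivity)
    (by linarith [Real.add_one_le_exp (freq k * τ)])

lemma neumannGreen_eq (τ x v : ℝ) : neumannGreen τ x v =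
    1 + ∑' k, 2 * Real.exp (-(freq k * τ)) * cosMode k x * cosMode k v := rfl

lemma summable_green_coef {τ : ℝ} (hτ : 0 < τ) (x : ℝ) :
    Summable fun k => |2 * Real.exp (-(freq k * τ)) * cosMode k x| := by
  refine Summable.of_nonneg_of_le (fun _ => abs_nonneg _) (fun k => ?_)
    ((summable_exp_freq hτ).mul_left 2)
  rw [abs_mul, abs_of_pos (by positivity)]
  exact mul_le_of_le_one_right (by positivity) (abs_cosMode_le k x)

/-- The semigroup property of the Green kernel. -/
lemma integral_green_mul_green {τ τ' : ℝ} (hτ : 0 < τ) (hτ' : 0 < τ') (x y : ℝ) :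
    ∫ v in Set.Icc (0 : ℝ) 1, neumannGreen τ x v * neumannGreen τ' y v =
      neumannGreen (τ + τ') x y := by
  simp_rw [neumannGreen_eq]
  set α : ℕ → ℝ := fun k => 2 * Real.exp (-(freq k * τ)) * cosMode k x with hα
  set β : ℕ → ℝ := fun k => 2 * Real.exp (-(freq k * τ')) * cosMode k y with hβ
  have hsα : Summable fun k => |α k| := summable_green_coef hτ x
  have hsβ : Summable fun k => |β k| := summable_green_coef hτ' y
  have hc : Continuous fun v => 1 + ∑' k, β k * cosMode k v := by
    refine continuous_const.add (continuous_tsum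
      (fun k => continuous_const.mul (continuous_cosMode k)) hsβ fun k v => ?_)
    rw [norm_mul]
    exact mul_le_of_le_one_right (norm_nonneg _) (abs_cosMode_le k v)
  have hone : ∫ v in Set.Icc (0 : ℝ) 1, (1 + ∑' k, β k * cosMode k v) = 1 := by
    have h := integral_one_add_cosSeries_mul hsβ (F := fun _ => 1) (integrable_const _)
    simpa [setIntegral_cosMode] using h
  have hk : ∀ k, ∫ v in Set.Icc (0 : ℝ) 1, cosMode k v * (1 + ∑' k, β k * cosMode k v) =
      β k / 2 := fun k => by
    have h := integral_one_add_cosSeries_mul hsβ (F := cosMode k)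
      (continuous_cosMode k).integrableOn_Icc
    simp_rw [mul_comm (cosMode k _)]
    rw [h, setIntegral_cosMode, zero_add, tsum_eq_single k]
    · rw [setIntegral_cosMode_mul]; simp; ring
    · intro l hl
      rw [setIntegral_cosMode_mul]; simp [hl]
  rw [integral_one_add_cosSeries_mul hsα hc.integrableOn_Icc, hone]
  congr 1
  refine tsum_congr fun k => ?_
  rw [hk, hα, hβ]
  have : Real.exp (-(freq k * (τ + τ'))) =
      Real.exp (-(freq k * τ)) * Real.exp (-(freq k * τ')) := by
    rw [← Real.exp_add]; congr 1; ring
  simp only [this]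
  ring

lemma stripMeasure_eq : stripMeasure =
    (volume.restrict (Set.Ici (0 : ℝ))).prod (volume.restrict (Set.Icc (0 : ℝ) 1)) := by
  rw [Measure.prod_restrict]; rfl

lemma integral_exp_time {a c m : ℝ} (ha : 0 < a) :
    ∫ r in (0 : ℝ)..m, 2 * Real.exp (-(a * (c - 2 * r))) =
      (Real.exp (-(a * (c - 2 * m))) - Real.exp (-(a * c))) / a := by
  have h : ∀ r ∈ Set.uIcc 0 m, HasDerivAt (fun r => Real.exp (-(a * (c - 2 * r))) / a)
      (2 * Real.exp (-(a * (c - 2 * r)))) r := fun r _ => by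
    have h1 : HasDerivAt (fun r => -(a * (c - 2 * r))) (2 * a) r := by
      have := ((((hasDerivAt_id r).const_mul 2).const_sub c).const_mul a).neg
      convert! this using 1; ring
    have := h1.exp.div_const a
    convert! this using 1
    field_simp
  rw [intervalIntegral.integral_eq_sub_of_hasDerivAt h
    (Continuous.intervalIntegrable (by fun_prop) _ _)]
  simp [sub_div]

lemma integral_green_time {t s : ℝ} (ht : 0 ≤ t) (hs : 0 ≤ s) (x y : ℝ) :
    ∫ r in Set.Ico (0 : ℝ) (min t s), neumannGreen (t - r + (s - r)) x y =
      heatCov (t, x) (s, y) := by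
  set m := min t s with hm
  have hm0 : 0 ≤ m := le_min ht hs
  have hms : t + s - 2 * m = |t - s| := by
    rw [hm]
    rcases le_total t s with h | h
    · rw [min_eq_left h, abs_of_nonpos (by linarith)]; ring
    · rw [min_eq_right h, abs_of_nonneg (by linarith)]; ring
  set f : ℕ → ℝ → ℝ := fun k r => 2 * Real.exp (-(freq k * (t + s - 2 * r))) * cosMode k x *
    cosMode k y with hf
  have hfc : ∀ k, Continuous (f k) := fun k => by simp only [hf]; fun_prop
  have hfi : ∀ k, Integrable (f k) (volume.restrict (Set.Ico 0 m)) := fun k =>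
    ((hfc k).integrableOn_Icc (a := 0) (b := m)).mono_set Set.Ico_subset_Icc_self
  have hval : ∀ k, ∫ r in Set.Ico 0 m, 2 * Real.exp (-(freq k * (t + s - 2 * r))) =
      (Real.exp (-(freq k * |t - s|)) - Real.exp (-(freq k * (t + s)))) / freq k := fun k => by
    rw [integral_Ico_eq_integral_Ioc, ← intervalIntegral.integral_of_le hm0,
      integral_exp_time (freq_pos k), hms]
  have hfs : Summable fun k => ∫ r in Set.Ico 0 m, ‖f k r‖ := by
    have hb : Summable fun k =>
        (Real.exp (-(freq k * |t - s|)) - Real.exp (-(freq k * (t + s)))) / freq k :=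
      summable_div_freq (C := 1) fun k => by
        have := freq_pos k
        exact abs_exp_sub_exp_le (by positivity) (by positivity)
    refine Summable.of_nonneg_of_le (fun k => integral_nonneg fun r => norm_nonneg _)
      (fun k => ?_) hb
    rw [← hval]
    refine integral_mono (hfi k).norm ?_ fun r => ?_
    · exact ((Continuous.integrableOn_Icc (by fun_prop))).mono_set Set.Ico_subset_Icc_self
    · simp only [hf]
      rw [norm_mul, norm_mul, Real.norm_of_nonneg (by positivity)]
      have h1 := abs_cosMode_le k x
      have h2 := abs_cosMode_le k y
      rw [mul_assoc]
      exact mul_le_of_le_one_right (by positivity) (mul_le_one₀ h1 (abs_nonneg _) h2)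
  have hsum := hasSum_integral_of_summable_integral_norm hfi hfs
  have e : ∀ r, neumannGreen (t - r + (s - r)) x y = 1 + ∑' k, f k r := fun r => by
    rw [neumannGreen_eq]
    have : t - r + (s - r) = t + s - 2 * r := by ring
    rw [this]
  simp_rw [e]
  rw [integral_add (integrable_const _) (integrable_tsum_of_summable_integral_norm hfi hfs),
    ← hsum.tsum_eq, heatCov]
  congr 1
  · simp [hm, ht, hs]
  · refine tsum_congr fun k => ?_
    have : ∀ r, f k r = 2 * Real.exp (-(freq k * (t + s - 2 * r))) *
      (cosMode k x * cosMode k y) := fun r => by simp only [hf]; ring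
    simp_rw [this]
    rw [integral_mul_const, hval]
    ring

/-- By Fubini, the semigroup property disposes of the space integral and leaves the kernel at time
(t - r) + (s - r), to be integrated over r < min(t, s). -/
lemma integral_mildKernel_mul {p q : ℝ × ℝ} (hp : 0 ≤ p.1) (hq : 0 ≤ q.1)
    (hp2 : MemLp (mildKernel p) 2 stripMeasure) (hq2 : MemLp (mildKernel q) 2 stripMeasure) :
    ∫ w, mildKernel p w * mildKernel q w ∂stripMeasure = heatCov p q := by
  have hintg : Integrable (fun w => mildKernel p w * mildKernel q w) stripMeasure :=
    hp2.integrable_mul hq2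
  rw [stripMeasure_eq] at hintg ⊢
  rw [integral_prod _ hintg]
  have h : ∀ r, ∫ v in Set.Icc (0 : ℝ) 1, mildKernel p (r, v) * mildKernel q (r, v) =
      (Set.Iio (min p.1 q.1)).indicator
        (fun r => neumannGreen (p.1 - r + (q.1 - r)) p.2 q.2) r := fun r => by
    by_cases hr : r < min p.1 q.1
    · rw [Set.indicator_of_mem (by exact hr)]
      have h1 : r < p.1 := hr.trans_le (min_le_left _ _)
      have h2 : r < q.1 := hr.trans_le (min_le_right _ _)
      simp only [mildKernel, h1, h2, if_true]
      exact integral_green_mul_green (by linarith) (by linarith) _ _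
    · rw [Set.indicator_of_notMem (by exact hr)]
      rw [lt_min_iff, not_and_or] at hr
      rcases hr with hr | hr <;> simp [mildKernel, hr]
  simp_rw [h]
  rw [integral_indicator measurableSet_Iio, Measure.restrict_restrict measurableSet_Iio,
    Set.inter_comm, Set.Ici_inter_Iio, integral_green_time hp hq]

/-! ### Wiener integrals -/

/-- The indicator of the rectangle `]0, q]`. -/
noncomputable def cornerInd (q : ℝ≥0 × unitInterval) (x : ℝ × ℝ) : ℝ :=
  (Set.Ioc 0 (q.1 : ℝ) ×ˢ Set.Ioc 0 (q.2 : ℝ)).indicator (fun _ => (1 : ℝ)) x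

/-- The finite linear combination `∑ c_q w(q)`. -/
noncomputable def gridSum {Ω : Type*} (c : (ℝ≥0 × unitInterval) →₀ ℝ)
    (w : ℝ≥0 × unitInterval → Ω → ℝ) (ω : Ω) : ℝ :=
  Finsupp.linearCombination ℝ (fun q => w q ω) c

lemma gridSum_eq {Ω : Type*} (c : (ℝ≥0 × unitInterval) →₀ ℝ) (w : ℝ≥0 × unitInterval → Ω → ℝ)
    (ω : Ω) : gridSum c w ω = ∑ q ∈ c.support, c q * w q ω := rfl

lemma gridSum_add_smul {Ω : Type*} (a b : ℝ) (c c' : (ℝ≥0 × unitInterval) →₀ ℝ)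
    (w : ℝ≥0 × unitInterval → Ω → ℝ) (ω : Ω) :
    gridSum (a • c + b • c') w ω = a * gridSum c w ω + b * gridSum c' w ω := by
  simp [gridSum]

/-- The coefficients of a step function at the corners of its rectangles. -/
noncomputable def StepFn.toGrid (f : StepFn) : (ℝ≥0 × unitInterval) →₀ ℝ :=
  ∑ k, f.coef k • (Finsupp.single (f.hi k) 1 - Finsupp.single ((f.lo k).1, (f.hi k).2) 1 -
    Finsupp.single ((f.hi k).1, (f.lo k).2) 1 + Finsupp.single (f.lo k) 1)

lemma StepFn.integral_eq {Ω : Type*} (f : StepFn) (w : ℝ≥0 × unitInterval → Ω → ℝ) (ω : Ω) :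
    f.integral w ω = gridSum f.toGrid w ω := by
  simp only [gridSum, StepFn.toGrid, StepFn.integral, map_sum, map_smul, map_add, map_sub,
    Finsupp.linearCombination_single, one_mul, smul_eq_mul]

lemma indicator_Ioc_sub {a b : ℝ} (ha : 0 ≤ a) (hab : a ≤ b) (x : ℝ) :
    (Set.Ioc a b).indicator (fun _ => (1 : ℝ)) x =
      (Set.Ioc 0 b).indicator (fun _ => (1 : ℝ)) x - (Set.Ioc 0 a).indicator (fun _ => 1) x := by
  simp only [Set.indicator_apply, Set.mem_Ioc]
  by_cases h2 : a < x
  · simp [h2, not_le.2 h2, ha.trans_lt h2]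
  · have h3 := not_lt.1 h2
    simp [h2, h3, h3.trans hab]

lemma indicator_prod_one (A B : Set ℝ) (x : ℝ × ℝ) :
    (A ×ˢ B).indicator (fun _ => (1 : ℝ)) x =
      A.indicator (fun _ => (1 : ℝ)) x.1 * B.indicator (fun _ => (1 : ℝ)) x.2 := by
  by_cases h1 : x.1 ∈ A <;> by_cases h2 : x.2 ∈ B <;> simp [h1, h2]

lemma StepFn.eval_eq (f : StepFn) (x : ℝ × ℝ) : f.eval x = gridSum f.toGrid cornerInd x := by
  simp only [gridSum, StepFn.toGrid, StepFn.eval, map_sum, map_smul, map_add, map_sub,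
    Finsupp.linearCombination_single, smul_eq_mul, cornerInd, one_mul]
  refine Finset.sum_congr rfl fun k _ => ?_
  congr 1
  simp only [indicator_prod_one]
  rw [indicator_Ioc_sub (f.lo k).1.coe_nonneg (NNReal.coe_le_coe.2 (f.le k).1),
    indicator_Ioc_sub (f.lo k).2.2.1 (f.le k).2]
  ring

lemma measurable_cornerInd (q : ℝ≥0 × unitInterval) : Measurable (cornerInd q) :=
  measurable_const.indicator (measurableSet_Ioc.prod measurableSet_Ioc)

lemma cornerInd_mul (q q' : ℝ≥0 × unitInterval) (x : ℝ × ℝ) :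
    cornerInd q x * cornerInd q' x = cornerInd (min q.1 q'.1, min q.2 q'.2) x := by
  unfold cornerInd
  simp only [Set.indicator_apply, Set.mem_prod, Set.mem_Ioc, NNReal.coe_min, le_min_iff]
  have : ((min q.2 q'.2 : unitInterval) : ℝ) = min (q.2 : ℝ) q'.2 := rfl
  rw [this]
  simp only [le_min_iff]
  split_ifs <;> simp_all

lemma integral_cornerInd (q : ℝ≥0 × unitInterval) :
    Integrable (cornerInd q) stripMeasure ∧ ∫ x, cornerInd q x ∂stripMeasure = q.1 * q.2 := by
  have hm : MeasurableSet (Set.Ioc 0 (q.1 : ℝ) ×ˢ Set.Ioc 0 (q.2 : ℝ)) :=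
    measurableSet_Ioc.prod measurableSet_Ioc
  have hsub : Set.Ioc 0 (q.1 : ℝ) ×ˢ Set.Ioc 0 (q.2 : ℝ) ⊆ Set.Ici 0 ×ˢ Set.Icc 0 1 :=
    Set.prod_mono (fun x hx => hx.1.le) (fun x hx => ⟨hx.1.le, hx.2.trans q.2.2.2⟩)
  have hvol : stripMeasure (Set.Ioc 0 (q.1 : ℝ) ×ˢ Set.Ioc 0 (q.2 : ℝ)) =
      ENNReal.ofReal (q.1 * q.2) := by
    rw [stripMeasure, Measure.restrict_apply hm, Set.inter_eq_left.2 hsub,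
      Measure.volume_eq_prod, Measure.prod_prod, Real.volume_Ioc, Real.volume_Ioc, sub_zero,
      sub_zero, ENNReal.ofReal_mul q.1.coe_nonneg]
  constructor
  · exact (integrable_indicator_iff hm).2 (integrableOn_const (by rw [hvol]; exact ENNReal.ofReal_ne_top))
  · unfold cornerInd
    rw [integral_indicator hm, setIntegral_const, measureReal_def, hvol,
      ENNReal.toReal_ofReal (mul_nonneg q.1.coe_nonneg q.2.2.1)]
    simp

lemma integral_cornerInd_mul (q q' : ℝ≥0 × unitInterval) :
    Integrable (fun x => cornerInd q x * cornerInd q' x) stripMeasure ∧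
    ∫ x, cornerInd q x * cornerInd q' x ∂stripMeasure =
      min (q.1 : ℝ) (q'.1 : ℝ) * min (q.2 : ℝ) (q'.2 : ℝ) := by
  simp_rw [cornerInd_mul]
  exact integral_cornerInd _

/-- The hypotheses are met both by the sheet under `P` and by the indicators `cornerInd` under
`stripMeasure`, as they have the same Gram matrix. The same coefficients therefore give the same
second moment, which is the Wiener isometry. -/
lemma integral_gridSum_sq {Ω : Type*} [MeasurableSpace Ω] {μ : Measure Ω}
    {w : ℝ≥0 × unitInterval → Ω → ℝ}
    (hw : ∀ q q', Integrable (fun ω => w q ω * w q' ω) μ)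
    (hcov : ∀ q q', ∫ ω, w q ω * w q' ω ∂μ =
      min (q.1 : ℝ) (q'.1 : ℝ) * min (q.2 : ℝ) (q'.2 : ℝ)) (c : (ℝ≥0 × unitInterval) →₀ ℝ) :
    ∫ ω, gridSum c w ω ^ 2 ∂μ = ∑ q ∈ c.support, ∑ q' ∈ c.support,
      c q * c q' * (min (q.1 : ℝ) (q'.1 : ℝ) * min (q.2 : ℝ) (q'.2 : ℝ)) := by
  have e : ∀ ω, gridSum c w ω ^ 2 = ∑ q ∈ c.support, ∑ q' ∈ c.support,
      c q * c q' * (w q ω * w q' ω) := fun ω => by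
    rw [gridSum_eq, sq, Finset.sum_mul_sum]
    refine Finset.sum_congr rfl fun q _ => Finset.sum_congr rfl fun q' _ => by ring
  simp_rw [e]
  rw [integral_finsetSum _ fun q _ => integrable_finsetSum _ fun q' _ => (hw q q').const_mul _]
  refine Finset.sum_congr rfl fun q _ => ?_
  rw [integral_finsetSum _ fun q' _ => (hw q q').const_mul _]
  refine Finset.sum_congr rfl fun q' _ => ?_
  rw [integral_const_mul, hcov]

lemma memLp_gridSum {Ω : Type*} [MeasurableSpace Ω] {μ : Measure Ω}
    {w : ℝ≥0 × unitInterval → Ω → ℝ} (hw : ∀ q, MemLp (w q) 2 μ)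
    (c : (ℝ≥0 × unitInterval) →₀ ℝ) : MemLp (gridSum c w) 2 μ := by
  have : gridSum c w = fun ω => ∑ q ∈ c.support, c q * w q ω := by ext ω; exact gridSum_eq c w ω
  rw [this]
  exact memLp_finsetSum _ fun q _ => (hw q).const_mul _

lemma memLp_cornerInd (q : ℝ≥0 × unitInterval) : MemLp (cornerInd q) 2 stripMeasure := by
  rw [memLp_two_iff_integrable_sq (measurable_cornerInd q).aestronglyMeasurable]
  simp_rw [sq]
  exact (integral_cornerInd_mul q q).1

section BrownianSheet

variable {d : ℕ} {Ω : Type*} [MeasurableSpace Ω] {P : Measure Ω}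
  {W : Fin d → ℝ≥0 × unitInterval → Ω → ℝ}

lemma IsBrownianSheets.memLp (hW : IsBrownianSheets P W) (j : Fin d) (q : ℝ≥0 × unitInterval) :
    MemLp (W j q) 2 P :=
  ((hW.gaussian j).hasGaussianLaw_eval q).memLp_two

/-- The isometry property for step functions. -/
lemma IsBrownianSheets.isometry (hW : IsBrownianSheets P W) (j : Fin d)
    (c : (ℝ≥0 × unitInterval) →₀ ℝ) :
    ∫ ω, gridSum c (W j) ω ^ 2 ∂P = ∫ x, gridSum c cornerInd x ^ 2 ∂stripMeasure := by
  rw [integral_gridSum_sq (fun q q' => (hW.memLp j q).integrable_mul (hW.memLp j q')) (hW.cov j),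
    integral_gridSum_sq (fun q q' => (integral_cornerInd_mul q q').1)
      (fun q q' => (integral_cornerInd_mul q q').2)]

lemma measurable_gridSum_path (c : (ℝ≥0 × unitInterval) →₀ ℝ) :
    Measurable fun w : ℝ≥0 × unitInterval → ℝ => Finsupp.linearCombination ℝ w c := by
  have : (fun w : ℝ≥0 × unitInterval → ℝ => Finsupp.linearCombination ℝ w c) =
      fun w => ∑ q ∈ c.support, c q * w q := rfl
  rw [this]
  fun_prop

lemma IsBrownianSheets.measurable_gridSum (hW : IsBrownianSheets P W) (j : Fin d)
    (c : (ℝ≥0 × unitInterval) →₀ ℝ) : Measurable (gridSum c (W j)) :=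
  (measurable_gridSum_path c).comp (measurable_pi_lambda _ fun q => hW.measurable j q)

/-- A finite combination of values of the sheet is a centred Gaussian variable whose variance is
given by the isometry; this is its characteristic function at 1. -/
lemma IsBrownianSheets.integral_exp_gridSum (hW : IsBrownianSheets P W) (j : Fin d)
    (c : (ℝ≥0 × unitInterval) →₀ ℝ) :
    ∫ ω, Complex.exp (gridSum c (W j) ω * Complex.I) ∂P =
      Complex.exp (-((∫ x, gridSum c cornerInd x ^ 2 ∂stripMeasure : ℝ) / 2 : ℂ)) := by
  have := (hW.gaussian j).isProbabilityMeasure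
  have hG : HasGaussianLaw (gridSum c (W j)) P :=
    ((hW.gaussian j).smul c).hasGaussianLaw_fun_sum (I := c.support)
  have hmean : ∫ ω, gridSum c (W j) ω ∂P = 0 := by
    simp_rw [gridSum_eq]
    rw [integral_finsetSum _ fun q _ =>
      ((hW.memLp j q).integrable (by norm_num)).const_mul _]
    simp [integral_const_mul, hW.mean]
  have hvar : Var[gridSum c (W j); P] = ∫ x, gridSum c cornerInd x ^ 2 ∂stripMeasure := by
    rw [variance_of_integral_eq_zero hG.aemeasurable hmean, hW.isometry]
  have h1 := hG.map_eq_gaussianReal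
  have h2 := charFun_gaussianReal (μ := P[gridSum c (W j)])
    (v := Var[gridSum c (W j); P].toNNReal) 1
  rw [← h1, charFun_apply, integral_map hG.aemeasurable (by fun_prop)] at h2
  rw [hmean, hvar, Real.coe_toNNReal _ (integral_nonneg fun _ => sq_nonneg _)] at h2
  simp only [Real.inner_apply, mul_one, Complex.ofReal_one, Complex.ofReal_zero, mul_zero,
    zero_mul, zero_sub, one_pow] at h2
  simpa using h2

lemma IsBrownianSheets.integral_exp_sum_gridSum (hW : IsBrownianSheets P W)
    (c : Fin d → (ℝ≥0 × unitInterval) →₀ ℝ) :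
    ∫ ω, Complex.exp ((∑ j, gridSum (c j) (W j) ω : ℝ) * Complex.I) ∂P =
      Complex.exp (-((∑ j, ∫ x, gridSum (c j) cornerInd x ^ 2 ∂stripMeasure : ℝ) / 2 : ℂ)) := by
  have h : ∀ ω, Complex.exp ((∑ j, gridSum (c j) (W j) ω : ℝ) * Complex.I) =
      ∏ j, Complex.exp (gridSum (c j) (W j) ω * Complex.I) := fun ω => by
    rw [← Complex.exp_sum, ← Finset.sum_mul]; push_cast; rfl
  simp_rw [h]
  have hi : iIndepFun (fun j => gridSum (c j) (W j)) P :=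
    hW.indep.comp (fun j w => Finsupp.linearCombination ℝ w (c j))
      fun j => measurable_gridSum_path (c j)
  rw [hi.integral_fun_prod_comp (f := fun _ (y : ℝ) => Complex.exp (y * Complex.I))
    (fun j => (hW.measurable_gridSum j (c j)).aemeasurable)
    (fun j => Continuous.aestronglyMeasurable (by fun_prop))]
  simp_rw [hW.integral_exp_gridSum]
  rw [← Complex.exp_sum]
  congr 1
  push_cast
  rw [Finset.sum_neg_distrib, ← Finset.sum_div]

end BrownianSheet

/-! ### Limits in `L²` -/

lemma tendsto_integral_sq_of_tendsto_eLpNorm {X : Type*} [MeasurableSpace X] {μ : Measure X}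
    {f : ℕ → X → ℝ} {g : X → ℝ} (hf : ∀ n, MemLp (f n) 2 μ) (hg : MemLp g 2 μ)
    (h : Tendsto (fun n => eLpNorm (fun x => f n x - g x) 2 μ) atTop (𝓝 0)) :
    Tendsto (fun n => ∫ x, f n x ^ 2 ∂μ) atTop (𝓝 (∫ x, g x ^ 2 ∂μ)) := by
  have h1 := (Lp.tendsto_Lp_iff_tendsto_eLpNorm'' f hf g hg).2 h
  have h2 := (h1.norm).pow 2
  have e : ∀ {k : X → ℝ} (hk : MemLp k 2 μ), ‖hk.toLp k‖ ^ 2 = ∫ x, k x ^ 2 ∂μ := fun {k} hk => by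
    rw [← real_inner_self_eq_norm_sq, L2.inner_def]
    refine integral_congr_ae ?_
    filter_upwards [hk.coeFn_toLp] with x hx
    simp [hx, sq]
  simpa only [e] using h2

lemma tendsto_eLpNorm_add_smul {X : Type*} [MeasurableSpace X] {μ : Measure X}
    {f f' : ℕ → X → ℝ} (hf : ∀ n, AEStronglyMeasurable (f n) μ)
    (hf' : ∀ n, AEStronglyMeasurable (f' n) μ)
    (h : Tendsto (fun n => eLpNorm (f n) 2 μ) atTop (𝓝 0))
    (h' : Tendsto (fun n => eLpNorm (f' n) 2 μ) atTop (𝓝 0)) (a b : ℝ) :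
    Tendsto (fun n => eLpNorm (fun x => a * f n x + b * f' n x) 2 μ) atTop (𝓝 0) := by
  have h1 : Tendsto (fun n => ‖a‖ₑ * eLpNorm (f n) 2 μ + ‖b‖ₑ * eLpNorm (f' n) 2 μ) atTop
      (𝓝 0) := by
    have := (ENNReal.Tendsto.const_mul h (Or.inr enorm_ne_top) (a := ‖a‖ₑ)).add
      (ENNReal.Tendsto.const_mul h' (Or.inr enorm_ne_top) (a := ‖b‖ₑ))
    simpa using this
  refine tendsto_of_tendsto_of_tendsto_of_le_of_le tendsto_const_nhds h1 (fun _ => zero_le)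
    fun n => ?_
  have := eLpNorm_add_le (p := 2) ((hf n).const_mul a) ((hf' n).const_mul b) (by norm_num)
  refine this.trans (le_of_eq ?_)
  congr 1
  · exact eLpNorm_const_smul a (f n) 2 μ
  · exact eLpNorm_const_smul b (f' n) 2 μ

lemma tendsto_eLpNorm_sum {X ι : Type*} [Fintype ι] [MeasurableSpace X] {μ : Measure X}
    {f : ι → ℕ → X → ℝ} (hf : ∀ i n, AEStronglyMeasurable (f i n) μ)
    (h : ∀ i, Tendsto (fun n => eLpNorm (f i n) 2 μ) atTop (𝓝 0)) :
    Tendsto (fun n => eLpNorm (fun x => ∑ i, f i n x) 2 μ) atTop (𝓝 0) := by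
  have h1 : Tendsto (fun n => ∑ i, eLpNorm (f i n) 2 μ) atTop (𝓝 0) := by
    simpa using tendsto_finsetSum Finset.univ fun i _ => h i
  refine tendsto_of_tendsto_of_tendsto_of_le_of_le tendsto_const_nhds h1 (fun _ => zero_le)
    fun n => ?_
  have := eLpNorm_sum_le (s := Finset.univ) (p := 2) (fun i _ => hf i n) (by norm_num)
  refine le_trans (le_of_eq ?_) this
  congr 1
  ext x; simp

/-- From |e^{ia} - e^{ib}| ≤ |a - b| and the domination of the L¹ norm by the L² norm under a
probability measure. -/
lemma tendsto_integral_exp_of_tendsto_eLpNorm {Ω : Type*} [MeasurableSpace Ω] {P : Measure Ω}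
    [IsProbabilityMeasure P] {S : ℕ → Ω → ℝ} {S' : Ω → ℝ}
    (hS : ∀ n, AEStronglyMeasurable (S n) P) (hS' : AEStronglyMeasurable S' P)
    (h : Tendsto (fun n => eLpNorm (fun ω => S n ω - S' ω) 2 P) atTop (𝓝 0)) :
    Tendsto (fun n => ∫ ω, Complex.exp (S n ω * Complex.I) ∂P) atTop
      (𝓝 (∫ ω, Complex.exp (S' ω * Complex.I) ∂P)) := by
  have hm : ∀ {k : Ω → ℝ}, AEStronglyMeasurable k P →
      AEStronglyMeasurable (fun ω => Complex.exp (k ω * Complex.I)) P := fun hk =>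
    (by fun_prop : Continuous fun y : ℝ => Complex.exp (y * Complex.I)).comp_aestronglyMeasurable hk
  refine tendsto_integral_of_L1 _ (hm hS') (Eventually.of_forall fun n => ?_) ?_
  · exact Integrable.of_bound (hm (hS n)) 1 (Eventually.of_forall fun ω => by
      rw [Complex.norm_exp_ofReal_mul_I])
  · refine tendsto_of_tendsto_of_tendsto_of_le_of_le tendsto_const_nhds h (fun _ => zero_le)
      fun n => ?_
    refine le_trans ?_ (eLpNorm_le_eLpNorm_of_exponent_le (p := 1) (by norm_num)
      ((hS n).sub hS'))
    rw [eLpNorm_one_eq_lintegral_enorm]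
    refine lintegral_mono fun ω => ?_
    have e : Complex.exp (S n ω * Complex.I) - Complex.exp (S' ω * Complex.I) =
        Complex.exp (Complex.I * (S' ω : ℝ)) *
          (Complex.exp (Complex.I * ((S n ω - S' ω : ℝ) : ℂ)) - 1) := by
      rw [mul_sub, ← Complex.exp_add, mul_one]
      congr 2 <;> [(push_cast; ring); ring]
    rw [e, enorm_mul, Complex.enorm_exp_I_mul_ofReal, one_mul]
    exact Real.enorm_exp_I_mul_ofReal_sub_one_le

/-! ### The joint law at two points -/

section JointLaw

variable {d : ℕ} {Ω : Type*} [MeasurableSpace Ω] {P : Measure Ω} [IsProbabilityMeasure P]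
  {W : Fin d → ℝ≥0 × unitInterval → Ω → ℝ}

/-- The joint characteristic function of two families of Wiener integrals. -/
lemma IsBrownianSheets.integral_exp_wienerIntegral (hW : IsBrownianSheets P W)
    {g g' : ℝ × ℝ → ℝ} {X X' : Fin d → Ω → ℝ} (hX : ∀ j, IsWienerIntegral P (W j) g (X j))
    (hX' : ∀ j, IsWienerIntegral P (W j) g' (X' j)) (a b : Fin d → ℝ) :
    ∫ ω, Complex.exp ((∑ j, (a j * X j ω + b j * X' j ω) : ℝ) * Complex.I) ∂P =
      Complex.exp (-((∑ j, ∫ x, (a j * g x + b j * g' x) ^ 2 ∂stripMeasure : ℝ) / 2 : ℂ)) := by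
  choose hg hXm f hfg hfX using hX
  choose hg' hXm' f' hfg' hfX' using hX'
  -- The approximating step functions may depend on the component j. Only the limit of their second
  -- moments enters, and that limit is determined by g and g'.
  set c : ℕ → Fin d → (ℝ≥0 × unitInterval) →₀ ℝ := fun n j =>
    a j • (f j n).toGrid + b j • (f' j n).toGrid with hc
  have hI : ∀ n j, MemLp (gridSum (c n j) (W j)) 2 P := fun n j =>
    memLp_gridSum (hW.memLp j) _
  have hE : ∀ n j, MemLp (gridSum (c n j) cornerInd) 2 stripMeasure := fun n j =>
    memLp_gridSum memLp_cornerInd _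
  have mI : ∀ j n, AEStronglyMeasurable (fun ω => (f j n).integral (W j) ω - X j ω) P :=
    fun j n => by
      simp_rw [StepFn.integral_eq]
      exact (memLp_gridSum (hW.memLp j) _).1.sub (hXm j).1
  have mI' : ∀ j n, AEStronglyMeasurable (fun ω => (f' j n).integral (W j) ω - X' j ω) P :=
    fun j n => by
      simp_rw [StepFn.integral_eq]
      exact (memLp_gridSum (hW.memLp j) _).1.sub (hXm' j).1
  have mE : ∀ j n, AEStronglyMeasurable (fun x => (f j n).eval x - g x) stripMeasure :=
    fun j n => by
      simp_rw [StepFn.eval_eq]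
      exact (memLp_gridSum memLp_cornerInd _).1.sub (hg j).1
  have mE' : ∀ j n, AEStronglyMeasurable (fun x => (f' j n).eval x - g' x) stripMeasure :=
    fun j n => by
      simp_rw [StepFn.eval_eq]
      exact (memLp_gridSum memLp_cornerInd _).1.sub (hg' j).1
  have lhs : Tendsto (fun n => ∫ ω, Complex.exp ((∑ j, gridSum (c n j) (W j) ω : ℝ) * Complex.I) ∂P)
      atTop (𝓝 (∫ ω, Complex.exp ((∑ j, (a j * X j ω + b j * X' j ω) : ℝ) * Complex.I) ∂P)) := by
    refine tendsto_integral_exp_of_tendsto_eLpNorm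
      (fun n => Finset.aestronglyMeasurable_fun_sum _ fun j _ => (hI n j).1)
      (Finset.aestronglyMeasurable_fun_sum _ fun j _ =>
        ((hXm j).1.const_mul _).add ((hXm' j).1.const_mul _)) ?_
    have := tendsto_eLpNorm_sum
      (f := fun j n ω => a j * ((f j n).integral (W j) ω - X j ω) +
        b j * ((f' j n).integral (W j) ω - X' j ω))
      (fun j n => ((mI j n).const_mul _).add ((mI' j n).const_mul _))
      (fun j => tendsto_eLpNorm_add_smul (mI j) (mI' j) (hfX j) (hfX' j) (a j) (b j))
    refine this.congr fun n => ?_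
    congr 1
    ext ω
    rw [← Finset.sum_sub_distrib]
    refine Finset.sum_congr rfl fun j _ => ?_
    simp only [hc, gridSum_add_smul, StepFn.integral_eq]
    ring
  have rhs : Tendsto (fun n => Complex.exp (-((∑ j, ∫ x, gridSum (c n j) cornerInd x ^ 2
      ∂stripMeasure : ℝ) / 2 : ℂ))) atTop
      (𝓝 (Complex.exp (-((∑ j, ∫ x, (a j * g x + b j * g' x) ^ 2 ∂stripMeasure : ℝ) / 2 : ℂ)))) := by
    have hs : Tendsto (fun n => ∑ j, ∫ x, gridSum (c n j) cornerInd x ^ 2 ∂stripMeasure) atTop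
        (𝓝 (∑ j, ∫ x, (a j * g x + b j * g' x) ^ 2 ∂stripMeasure)) := by
      refine tendsto_finsetSum _ fun j _ => ?_
      refine tendsto_integral_sq_of_tendsto_eLpNorm (fun n => hE n j)
        (((hg j).const_mul _).add ((hg' j).const_mul _)) ?_
      refine (tendsto_eLpNorm_add_smul (mE j) (mE' j) (hfg j) (hfg' j) (a j) (b j)).congr
        fun n => ?_
      congr 1
      ext x
      simp only [hc, gridSum_add_smul, StepFn.eval_eq]
      ring
    have hcont : Continuous fun y : ℝ => Complex.exp (-((y : ℂ) / 2)) := by fun_prop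
    exact (hcont.tendsto _).comp hs
  refine tendsto_nhds_unique lhs (rhs.congr fun n => ?_)
  rw [hW.integral_exp_sum_gridSum]

end JointLaw

/-! ### Gaussian vectors with independent components -/

/-- The law of a vector of `d` independent centred Gaussian variables of variance `v`. -/
noncomputable def gaussVec (d : ℕ) (v : ℝ) : Measure (E d) :=
  (Measure.pi fun _ : Fin d => gaussianReal 0 v.toNNReal).map (WithLp.toLp 2)

instance (d : ℕ) (v : ℝ) : IsProbabilityMeasure (gaussVec d v) :=
  Measure.isProbabilityMeasure_map (by fun_prop)

lemma charFunDual_gaussianReal_zero (v : ℝ≥0) (L : StrongDual ℝ ℝ) :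
    charFunDual (gaussianReal 0 v) L = Complex.exp (-((v : ℝ) * L 1 ^ 2 / 2 : ℝ)) := by
  have h := charFun_gaussianReal (μ := 0) (v := v) (L 1)
  rw [charFunDual_apply]
  rw [charFun_apply] at h
  have e : ∀ x : ℝ, L x = x * L 1 := fun x => by
    conv_lhs => rw [← mul_one x, ← smul_eq_mul, map_smul, smul_eq_mul]
  simp only [Complex.ofReal_zero, mul_zero, zero_mul, zero_sub, Real.inner_apply] at h
  have e' : (fun x : ℝ => Complex.exp (L x * Complex.I)) =
      fun x : ℝ => Complex.exp (((x * L 1 : ℝ) : ℂ) * Complex.I) := funext fun x => by rw [e x]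
  rw [e', h]
  congr 1
  push_cast
  ring

lemma charFunDual_gaussVec {d : ℕ} {v : ℝ} (hv : 0 ≤ v) (L : StrongDual ℝ (E d)) :
    charFunDual (gaussVec d v) L =
      Complex.exp (-((∑ j, v * L (EuclideanSpace.single j 1) ^ 2 : ℝ) / 2 : ℂ)) := by
  rw [gaussVec, charFunDual_pi']
  simp_rw [charFunDual_gaussianReal_zero]
  rw [← Complex.exp_sum]
  congr 1
  rw [Real.coe_toNNReal _ hv, Finset.sum_neg_distrib]
  push_cast
  rw [Finset.sum_div]
  rfl

lemma dual_eq_sum {d : ℕ} (L : StrongDual ℝ (E d)) (x : E d) :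
    L x = ∑ j, L (EuclideanSpace.single j 1) * x j := by
  conv_lhs => rw [← (EuclideanSpace.basisFun (Fin d) ℝ).sum_repr x]
  simp [mul_comm]

lemma integral_add_smul_sq {X : Type*} [MeasurableSpace X] {μ : Measure X} {g g' : X → ℝ}
    (hg : MemLp g 2 μ) (hg' : MemLp g' 2 μ) (a b : ℝ) :
    ∫ x, (a * g x + b * g' x) ^ 2 ∂μ = a ^ 2 * ∫ x, g x * g x ∂μ +
      2 * a * b * ∫ x, g x * g' x ∂μ + b ^ 2 * ∫ x, g' x * g' x ∂μ := by
  have i1 : Integrable (fun x => a ^ 2 * (g x * g x)) μ := (hg.integrable_mul hg).const_mul _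
  have i2 : Integrable (fun x => 2 * a * b * (g x * g' x)) μ := (hg.integrable_mul hg').const_mul _
  have i3 : Integrable (fun x => b ^ 2 * (g' x * g' x)) μ := (hg'.integrable_mul hg').const_mul _
  have e : ∀ x, (a * g x + b * g' x) ^ 2 = a ^ 2 * (g x * g x) + 2 * a * b * (g x * g' x) +
      b ^ 2 * (g' x * g' x) := fun x => by ring
  have i12 : Integrable (fun x => a ^ 2 * (g x * g x) + 2 * a * b * (g x * g' x)) μ := i1.add i2
  simp_rw [e]
  rw [integral_add i12 i3, integral_add i1 i2, integral_const_mul, integral_const_mul,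
    integral_const_mul]

section

variable {d : ℕ} {Ω : Type*} [MeasurableSpace Ω] {P : Measure Ω} [IsProbabilityMeasure P]
  {W : Fin d → ℝ≥0 × unitInterval → Ω → ℝ}

/-- The law of two families of Wiener integrals, after orthogonalisation. -/
lemma IsBrownianSheets.map_wienerIntegral (hW : IsBrownianSheets P W)
    {g g' : ℝ × ℝ → ℝ} {X X' : Fin d → Ω → ℝ} (hg : MemLp g 2 stripMeasure)
    (hg' : MemLp g' 2 stripMeasure) (hX : ∀ j, IsWienerIntegral P (W j) g (X j))
    (hX' : ∀ j, IsWienerIntegral P (W j) g' (X' j)) {A B l : ℝ} (hA : 0 ≤ A)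
    (h1 : ∫ x, g x * g x ∂stripMeasure = A + l ^ 2 * B)
    (h2 : ∫ x, g x * g' x ∂stripMeasure = l * B)
    (h3 : ∫ x, g' x * g' x ∂stripMeasure = B) :
    P.map (fun ω => ((WithLp.toLp 2 fun j => X j ω - l * X' j ω : E d),
      (WithLp.toLp 2 fun j => X' j ω : E d))) = (gaussVec d A).prod (gaussVec d B) := by
  have hB : 0 ≤ B := by rw [← h3]; exact integral_nonneg fun x => mul_self_nonneg _
  have mX : ∀ j, AEMeasurable (X j) P := fun j => (hX j).2.1.1.aemeasurable
  have mX' : ∀ j, AEMeasurable (X' j) P := fun j => (hX' j).2.1.1.aemeasurable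
  have hm : AEMeasurable (fun ω => ((WithLp.toLp 2 fun j => X j ω - l * X' j ω : E d),
      (WithLp.toLp 2 fun j => X' j ω : E d))) P := by
    refine AEMeasurable.prodMk ?_ ?_
    · exact (by fun_prop : Measurable (WithLp.toLp 2 : (Fin d → ℝ) → E d)).comp_aemeasurable
        (aemeasurable_pi_lambda _ fun j => (mX j).sub ((mX' j).const_mul l))
    · exact (by fun_prop : Measurable (WithLp.toLp 2 : (Fin d → ℝ) → E d)).comp_aemeasurable
        (aemeasurable_pi_lambda _ mX')
  have := Measure.isProbabilityMeasure_map (μ := P) hm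
  refine Measure.ext_of_charFunDual (funext fun L => ?_)
  rw [charFunDual_prod, charFunDual_gaussVec hA, charFunDual_gaussVec hB, charFunDual_apply,
    integral_map hm (Continuous.aestronglyMeasurable (by fun_prop)), ← Complex.exp_add]
  -- A functional with coordinates a, b on the pair (X - lX', X') has coefficients a on X and b - la
  -- on X'. By the choice of l the cross term cancels and the variance is ∑ (A a_j² + B b_j²), as
  -- for the product measure.
  set a : Fin d → ℝ := fun j => (L.comp (.inl ℝ (E d) (E d))) (EuclideanSpace.single j 1) with ha
  set b : Fin d → ℝ := fun j => (L.comp (.inr ℝ (E d) (E d))) (EuclideanSpace.single j 1) with hb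
  have hL : ∀ ω, L ((WithLp.toLp 2 fun j => X j ω - l * X' j ω : E d),
      (WithLp.toLp 2 fun j => X' j ω : E d)) =
      ∑ j, (a j * X j ω + (b j - l * a j) * X' j ω) := fun ω => by
    rw [← L.comp_inl_add_comp_inr, dual_eq_sum, dual_eq_sum, ← Finset.sum_add_distrib]
    refine Finset.sum_congr rfl fun j _ => ?_
    simp only [ha, hb]
    ring
  simp_rw [hL]
  rw [hW.integral_exp_wienerIntegral hX hX']
  congr 1
  have key : ∀ j, ∫ x, (a j * g x + (b j - l * a j) * g' x) ^ 2 ∂stripMeasure =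
      A * a j ^ 2 + B * b j ^ 2 := fun j => by
    rw [integral_add_smul_sq hg hg', h1, h2, h3]
    ring
  simp_rw [key]
  change _ = -((∑ j, A * a j ^ 2 : ℝ) / 2 : ℂ) + -((∑ j, B * b j ^ 2 : ℝ) / 2 : ℂ)
  rw [Finset.sum_add_distrib]
  push_cast
  ring

end

/-- The conditional variance of `X(p)` given `X(q)`. -/
noncomputable def condVar (p q : ℝ × ℝ) : ℝ := heatCov p p - heatCov p q ^ 2 / heatCov q q

/-- The linear isomorphism of `ℝ^d` given by an invertible matrix. -/
noncomputable def matrixEquiv {d : ℕ} (σ : Matrix (Fin d) (Fin d) ℝ) (hσ : IsUnit σ.det) :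
    E d ≃L[ℝ] E d :=
  ContinuousLinearEquiv.equivOfInverse (Matrix.toEuclideanCLM (𝕜 := ℝ) σ)
    (Matrix.toEuclideanCLM (𝕜 := ℝ) σ⁻¹)
    (fun x => by
      rw [← mul_apply_eq_comp, ← map_mul, Matrix.nonsing_inv_mul σ hσ, map_one]; rfl)
    (fun x => by
      rw [← mul_apply_eq_comp, ← map_mul, Matrix.mul_nonsing_inv σ hσ, map_one]; rfl)

/-- A continuous random field `u` such that the components of `S⁻¹ u` are independent and have
the covariance function `heatCov`. Only the two-point laws matter. -/
structure IsHeatField {d : ℕ} {Ω : Type*} [MeasurableSpace Ω] (P : Measure Ω) (t₀ T : ℝ)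
    (S : E d ≃L[ℝ] E d) (u : ℝ × ℝ → Ω → E d) : Prop where
  aemeasurable : ∀ p ∈ Set.Icc t₀ T ×ˢ Set.Icc (0 : ℝ) 1, AEMeasurable (u p) P
  law : ∀ p ∈ Set.Icc t₀ T ×ˢ Set.Icc (0 : ℝ) 1, ∀ q ∈ Set.Icc t₀ T ×ˢ Set.Icc (0 : ℝ) 1,
    P.map (fun ω => (S.symm (u p ω) - (heatCov p q / heatCov q q) • S.symm (u q ω),
      S.symm (u q ω))) = (gaussVec d (condVar p q)).prod (gaussVec d (heatCov q q))
  continuous : ∀ᵐ ω ∂P, ContinuousOn (fun p => u p ω) (Set.Icc t₀ T ×ˢ Set.Icc (0 : ℝ) 1)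

lemma heatCov_pos {t₀ T : ℝ} (ht₀ : 0 < t₀) {p : ℝ × ℝ}
    (hp : p ∈ Set.Icc t₀ T ×ˢ Set.Icc (0 : ℝ) 1) : 0 < heatCov p p :=
  ht₀.trans_le (hp.1.1.trans (le_heatCov_self (ht₀.le.trans hp.1.1)))

lemma condVar_mul {t₀ T : ℝ} (ht₀ : 0 < t₀) {p q : ℝ × ℝ}
    (hq : q ∈ Set.Icc t₀ T ×ˢ Set.Icc (0 : ℝ) 1) :
    condVar p q * heatCov q q = heatCov p p * heatCov q q - heatCov p q ^ 2 := by
  have := heatCov_pos ht₀ hq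
  rw [condVar]
  field_simp

lemma condVar_nonneg {t₀ T : ℝ} (ht₀ : 0 < t₀) {p q : ℝ × ℝ}
    (hp : p ∈ Set.Icc t₀ T ×ˢ Set.Icc (0 : ℝ) 1) (hq : q ∈ Set.Icc t₀ T ×ˢ Set.Icc (0 : ℝ) 1) :
    0 ≤ condVar p q := by
  obtain ⟨c, hc, h⟩ := exists_le_det ht₀ T
  have h1 := h p hp q hq
  rw [← condVar_mul ht₀ hq] at h1
  have h2 := parabolicDist_nonneg p q
  exact nonneg_of_mul_nonneg_left (le_trans (by positivity) h1) (heatCov_pos ht₀ hq)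

/-- The only passage from the stochastic equation to Gaussian two-point laws; the later estimates
see the solution only through `IsHeatField`. -/
lemma IsLinearSolution.isHeatField {d : ℕ} {Ω : Type*} [MeasurableSpace Ω] {P : Measure Ω}
    [IsProbabilityMeasure P] {t₀ T : ℝ} (ht₀ : 0 < t₀)
    {σ : Matrix (Fin d) (Fin d) ℝ} (hσ : IsUnit σ.det) {W : Fin d → ℝ≥0 × unitInterval → Ω → ℝ}
    {u : ℝ × ℝ → Ω → E d} (hd : 0 < d) (hu : IsLinearSolution P T σ W u) :
    IsHeatField P t₀ T (matrixEquiv σ hσ) u := by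
  have hsub : Set.Icc t₀ T ×ˢ Set.Icc (0 : ℝ) 1 ⊆ Set.Icc 0 T ×ˢ Set.Icc (0 : ℝ) 1 :=
    Set.prod_mono (Set.Icc_subset_Icc_left ht₀.le) le_rfl
  have hS : ∀ {X : Fin d → Ω → ℝ} {p ω}, (∀ i, u p ω i = ∑ j, σ i j * X j ω) →
      u p ω = matrixEquiv σ hσ (WithLp.toLp 2 fun j => X j ω) := fun {X p ω} h => by
    ext i
    rw [h i]
    rfl
  refine ⟨fun p hp => ?_, fun p hp q hq => ?_, hu.continuous.mono fun ω h => h.mono hsub⟩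
  · obtain ⟨X, hX, hXu⟩ := hu.mild p (hsub hp)
    have : AEMeasurable (fun ω => matrixEquiv σ hσ (WithLp.toLp 2 fun j => X j ω)) P := by
      refine (matrixEquiv σ hσ).continuous.measurable.comp_aemeasurable ?_
      exact (by fun_prop : Measurable (WithLp.toLp 2 : (Fin d → ℝ) → E d)).comp_aemeasurable
        (aemeasurable_pi_lambda _ fun j => (hX j).2.1.1.aemeasurable)
    refine this.congr ?_
    filter_upwards [hXu] with ω h
    exact (hS h).symm
  · obtain ⟨X, hX, hXu⟩ := hu.mild p (hsub hp)
    obtain ⟨X', hX', hXu'⟩ := hu.mild q (hsub hq)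
    have hqq := heatCov_pos ht₀ hq
    have hp0 : 0 ≤ p.1 := ht₀.le.trans hp.1.1
    have hq0 : 0 ≤ q.1 := ht₀.le.trans hq.1.1
    -- Square integrability of the mild kernel is part of `IsWienerIntegral`, so any one component
    -- provides it.
    have hg := (hX ⟨0, hd⟩).1
    have hg' := (hX' ⟨0, hd⟩).1
    have i1 := integral_mildKernel_mul hp0 hp0 hg hg
    have i2 := integral_mildKernel_mul hp0 hq0 hg hg'
    have i3 := integral_mildKernel_mul hq0 hq0 hg' hg'
    set l := heatCov p q / heatCov q q with hl
    have hlB : heatCov p q = l * heatCov q q := by rw [hl]; field_simp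
    have hA : heatCov p p = condVar p q + l ^ 2 * heatCov q q := by
      rw [condVar, hl]; field_simp; ring
    have hA0 : 0 ≤ condVar p q := condVar_nonneg ht₀ hp hq
    rw [← hu.noise.map_wienerIntegral hg hg' hX hX' hA0 (i1.trans hA) (i2.trans hlB) i3]
    refine Measure.map_congr ?_
    filter_upwards [hXu, hXu'] with ω h h'
    rw [hS h, hS h', ContinuousLinearEquiv.symm_apply_apply,
      ContinuousLinearEquiv.symm_apply_apply]
    congr 1

/-! ### Densities -/

/-- The density of `gaussVec d v`. -/
noncomputable def gaussDens (d : ℕ) (v : ℝ) (y : E d) : ℝ :=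
  (√(2 * Real.pi * v))⁻¹ ^ d * Real.exp (-(‖y‖ ^ 2 / (2 * v)))

lemma continuous_gaussDens (d : ℕ) (v : ℝ) : Continuous (gaussDens d v) := by
  unfold gaussDens; fun_prop

lemma gaussDens_nonneg (d : ℕ) (v : ℝ) (y : E d) : 0 ≤ gaussDens d v y := by
  unfold gaussDens; positivity

lemma gaussDens_le {d : ℕ} {v : ℝ} (hv : 0 ≤ v) (y : E d) :
    gaussDens d v y ≤ (√(2 * Real.pi * v))⁻¹ ^ d := by
  unfold gaussDens
  refine mul_le_of_le_one_right (by positivity) (Real.exp_le_one_iff.2 ?_)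
  rw [neg_nonpos]; positivity

lemma prod_gaussianPDFReal {d : ℕ} {v : ℝ} (hv : 0 ≤ v) (y : E d) :
    ∏ j, gaussianPDFReal 0 v.toNNReal (y j) = gaussDens d v y := by
  simp only [gaussianPDFReal, Real.coe_toNNReal _ hv, sub_zero]
  rw [Finset.prod_mul_distrib, ← Real.exp_sum, gaussDens, EuclideanSpace.norm_sq_eq]
  simp [Finset.sum_div, neg_div]

lemma pi_gaussianReal_eq {d : ℕ} {v : ℝ≥0} (hv : v ≠ 0) :
    (Measure.pi fun _ : Fin d => gaussianReal 0 v) =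
      volume.withDensity fun y => ENNReal.ofReal (∏ j, gaussianPDFReal 0 v (y j)) := by
  refine Measure.pi_eq fun s hs => ?_
  rw [withDensity_apply _ (MeasurableSet.univ_pi hs),
    ← ofReal_integral_eq_lintegral_ofReal, volume_pi, Measure.restrict_pi_pi,
    integral_fintype_prod_eq_prod (fun _ => gaussianPDFReal 0 v),
    ENNReal.ofReal_prod_of_nonneg fun j _ => integral_nonneg fun x => gaussianPDFReal_nonneg 0 v x]
  · exact Finset.prod_congr rfl fun j _ => (gaussianReal_apply_eq_integral 0 hv (s j)).symm
  · exact (Integrable.fintype_prod fun _ => integrable_gaussianPDFReal 0 v).restrict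
  · exact Eventually.of_forall fun y => Finset.prod_nonneg fun j _ => gaussianPDFReal_nonneg 0 v _

lemma map_withDensity_equiv {X Y : Type*} [MeasurableSpace X] [MeasurableSpace Y]
    (e : X ≃ᵐ Y) (μ : Measure X) (f : X → ℝ≥0∞) :
    (μ.withDensity f).map e = (μ.map e).withDensity (f ∘ e.symm) := by
  ext s hs
  rw [e.map_apply, withDensity_apply _ (e.measurable hs), withDensity_apply _ hs,
    e.measurableEmbedding.restrict_map, lintegral_map_equiv]
  simp

lemma gaussVec_eq_withDensity {d : ℕ} {v : ℝ} (hv : 0 < v) :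
    gaussVec d v = volume.withDensity fun y => ENNReal.ofReal (gaussDens d v y) := by
  have hv' : v.toNNReal ≠ 0 := (Real.toNNReal_pos.2 hv).ne'
  have h := map_withDensity_equiv (MeasurableEquiv.toLp 2 (Fin d → ℝ)) volume
    (fun y => ENNReal.ofReal (∏ j, gaussianPDFReal 0 v.toNNReal (y j)))
  rw [← pi_gaussianReal_eq hv'] at h
  change gaussVec d v = _ at h
  rw [h]
  have hvol : Measure.map (MeasurableEquiv.toLp 2 (Fin d → ℝ)) volume = (volume : Measure (E d)) :=
    (PiLp.volume_preserving_toLp (Fin d)).map_eq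
  rw [hvol]
  congr 1
  ext y
  simp only [Function.comp]
  rw [← prod_gaussianPDFReal hv.le]
  rfl

/-- The factor by which `S⁻¹` changes volumes. -/
noncomputable def invDet {d : ℕ} (S : E d ≃L[ℝ] E d) : ℝ :=
  |(LinearMap.det (S : E d →ₗ[ℝ] E d))⁻¹|

lemma det_ne_zero {d : ℕ} (S : E d ≃L[ℝ] E d) : LinearMap.det (S : E d →ₗ[ℝ] E d) ≠ 0 :=
  (LinearEquiv.isUnit_det' S.toLinearEquiv).ne_zero

lemma invDet_pos {d : ℕ} (S : E d ≃L[ℝ] E d) : 0 < invDet S :=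
  abs_pos.2 (inv_ne_zero (det_ne_zero S))

lemma map_volume_equiv {d : ℕ} (S : E d ≃L[ℝ] E d) :
    Measure.map S volume = ENNReal.ofReal (invDet S) • (volume : Measure (E d)) :=
  Measure.map_linearMap_addHaar_eq_smul_addHaar volume (det_ne_zero S)

/-- The one-point density. -/
noncomputable def dens₁ {d : ℕ} (S : E d ≃L[ℝ] E d) (p : ℝ × ℝ) (z : E d) : ℝ :=
  invDet S * gaussDens d (heatCov p p) (S.symm z)

/-- The two-point density. -/
noncomputable def dens₂ {d : ℕ} (S : E d ≃L[ℝ] E d) (p q : ℝ × ℝ) (z : E d × E d) : ℝ :=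
  invDet S ^ 2 * (gaussDens d (condVar p q)
    (S.symm z.1 - (heatCov p q / heatCov q q) • S.symm z.2) *
      gaussDens d (heatCov q q) (S.symm z.2))

lemma continuous_dens₁ {d : ℕ} (S : E d ≃L[ℝ] E d) (p : ℝ × ℝ) : Continuous (dens₁ S p) := by
  have := continuous_gaussDens d (heatCov p p)
  unfold dens₁; fun_prop

lemma continuous_dens₂ {d : ℕ} (S : E d ≃L[ℝ] E d) (p q : ℝ × ℝ) : Continuous (dens₂ S p q) := by
  have := continuous_gaussDens d (heatCov q q)
  have := continuous_gaussDens d (condVar p q)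
  unfold dens₂; fun_prop

/-- The map `(r, y) ↦ (S (r + l y), S y)`. -/
noncomputable def shearEquiv {d : ℕ} (S : E d ≃L[ℝ] E d) (l : ℝ) : E d × E d ≃ᵐ E d × E d where
  toFun z := (S (z.1 + l • z.2), S z.2)
  invFun z := (S.symm z.1 - l • S.symm z.2, S.symm z.2)
  left_inv z := by simp
  right_inv z := by simp
  measurable_toFun := by
    have : Continuous fun z : E d × E d => (S (z.1 + l • z.2), S z.2) := by fun_prop
    exact this.measurable
  measurable_invFun := by
    have : Continuous fun z : E d × E d => (S.symm z.1 - l • S.symm z.2, S.symm z.2) := by fun_prop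
    exact this.measurable

/-- The shear r ↦ r + l y preserves volume by Fubini, so only the two copies of S change it. -/
lemma map_volume_shearEquiv {d : ℕ} (S : E d ≃L[ℝ] E d) (l : ℝ) :
    Measure.map (shearEquiv S l) volume =
      ENNReal.ofReal (invDet S ^ 2) • (volume : Measure (E d × E d)) := by
  have h1 : MeasurePreserving (fun z : E d × E d => (z.1 + l • z.2, z.2))
      (volume.prod volume) (volume.prod volume) := by
    have h := MeasurePreserving.skew_product (MeasurePreserving.id (volume : Measure (E d)))
      (g := fun (y : E d) (r : E d) => r + l • y) (μc := volume) (μd := volume)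
      (by fun_prop) (Eventually.of_forall fun y => map_add_right_eq_self _ _)
    exact (Measure.measurePreserving_swap.comp h).comp Measure.measurePreserving_swap
  have hS : Measurable S := S.continuous.measurable
  have e : (shearEquiv S l : E d × E d → E d × E d) =
      Prod.map S S ∘ fun z : E d × E d => (z.1 + l • z.2, z.2) := rfl
  rw [e, Measure.volume_eq_prod, ← Measure.map_map (hS.prodMap hS) h1.measurable, h1.map_eq,
    ← Measure.map_prod_map _ _ hS hS, map_volume_equiv, Measure.prod_smul_left,
    Measure.prod_smul_right, smul_smul, ← ENNReal.ofReal_mul (invDet_pos S).le, sq]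

section

variable {d : ℕ} {Ω : Type*} [MeasurableSpace Ω] {P : Measure Ω} {t₀ T : ℝ}
  {S : E d ≃L[ℝ] E d} {u : ℝ × ℝ → Ω → E d}

lemma IsHeatField.aemeasurable_symm (hu : IsHeatField P t₀ T S u) {p : ℝ × ℝ}
    (hp : p ∈ Set.Icc t₀ T ×ˢ Set.Icc (0 : ℝ) 1) : AEMeasurable (fun ω => S.symm (u p ω)) P :=
  S.symm.continuous.measurable.comp_aemeasurable (hu.aemeasurable p hp)

lemma IsHeatField.aemeasurable_pair (hu : IsHeatField P t₀ T S u) {p q : ℝ × ℝ}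
    (hp : p ∈ Set.Icc t₀ T ×ˢ Set.Icc (0 : ℝ) 1) (hq : q ∈ Set.Icc t₀ T ×ˢ Set.Icc (0 : ℝ) 1)
    (l : ℝ) : AEMeasurable (fun ω => (S.symm (u p ω) - l • S.symm (u q ω), S.symm (u q ω))) P :=
  ((hu.aemeasurable_symm hp).sub ((hu.aemeasurable_symm hq).const_smul l)).prodMk
    (hu.aemeasurable_symm hq)

/-- Second marginal of the two-point law at q = p, where the residual is degenerate. -/
lemma IsHeatField.map_symm (hu : IsHeatField P t₀ T S u) {p : ℝ × ℝ}
    (hp : p ∈ Set.Icc t₀ T ×ˢ Set.Icc (0 : ℝ) 1) :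
    P.map (fun ω => S.symm (u p ω)) = gaussVec d (heatCov p p) := by
  have h := congrArg Measure.snd (hu.law p hp p hp)
  rw [Measure.snd_prod, Measure.snd, AEMeasurable.map_map_of_aemeasurable (by fun_prop)
    (hu.aemeasurable_pair hp hp _)] at h
  exact h

lemma IsHeatField.hasContinuousDensity (hu : IsHeatField P t₀ T S u) (ht₀ : 0 < t₀) {p : ℝ × ℝ}
    (hp : p ∈ Set.Icc t₀ T ×ˢ Set.Icc (0 : ℝ) 1) :
    HasContinuousDensity P (u p) (dens₁ S p) := by
  refine ⟨hu.aemeasurable p hp, continuous_dens₁ S p,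
    fun z => mul_nonneg (invDet_pos S).le (gaussDens_nonneg _ _ _), ?_⟩
  have h := hu.map_symm hp
  have h1 : P.map (u p) = (P.map fun ω => S.symm (u p ω)).map
      S.toHomeomorph.toMeasurableEquiv := by
    rw [AEMeasurable.map_map_of_aemeasurable (by fun_prop) (hu.aemeasurable_symm hp)]
    congr 1
    ext1 ω
    exact (S.apply_symm_apply _).symm
  rw [h1, h, gaussVec_eq_withDensity (heatCov_pos ht₀ hp), map_withDensity_equiv]
  have h2 : Measure.map S.toHomeomorph.toMeasurableEquiv volume =
      ENNReal.ofReal (invDet S) • (volume : Measure (E d)) := map_volume_equiv S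
  rw [h2, withDensity_smul_measure, ← withDensity_smul]
  · congr 1
    ext z
    rw [dens₁, ENNReal.ofReal_mul (invDet_pos S).le]
    rfl
  · exact (continuous_gaussDens d _).measurable.ennreal_ofReal.comp (MeasurableEquiv.measurable _)

/-- The residual and the value at q are independent with explicit Gaussian densities, and
`shearEquiv` rebuilds the pair (u(p), u(q)) from them. -/
lemma IsHeatField.hasContinuousDensity_pair (hu : IsHeatField P t₀ T S u) (ht₀ : 0 < t₀)
    {p q : ℝ × ℝ} (hp : p ∈ Set.Icc t₀ T ×ˢ Set.Icc (0 : ℝ) 1)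
    (hq : q ∈ Set.Icc t₀ T ×ˢ Set.Icc (0 : ℝ) 1) (hv : 0 < condVar p q) :
    HasContinuousDensity P (fun ω => (u p ω, u q ω)) (dens₂ S p q) := by
  refine ⟨(hu.aemeasurable p hp).prodMk (hu.aemeasurable q hq), continuous_dens₂ S p q,
    fun z => mul_nonneg (sq_nonneg _) (mul_nonneg (gaussDens_nonneg _ _ _)
      (gaussDens_nonneg _ _ _)), ?_⟩
  have h := hu.law p hp q hq
  set l := heatCov p q / heatCov q q with hl
  have h1 : P.map (fun ω => (u p ω, u q ω)) =
      (P.map fun ω => (S.symm (u p ω) - l • S.symm (u q ω), S.symm (u q ω))).map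
        (shearEquiv S l) := by
    rw [AEMeasurable.map_map_of_aemeasurable (MeasurableEquiv.measurable _).aemeasurable
      (hu.aemeasurable_pair hp hq _)]
    congr 1
    ext1 ω
    simp [shearEquiv]
  have m1 : ∀ v, Measurable fun y => ENNReal.ofReal (gaussDens d v y) := fun v =>
    (continuous_gaussDens d v).measurable.ennreal_ofReal
  rw [h1, h, gaussVec_eq_withDensity (heatCov_pos ht₀ hq), gaussVec_eq_withDensity hv,
    prod_withDensity (m1 _) (m1 _), map_withDensity_equiv, ← Measure.volume_eq_prod,
    map_volume_shearEquiv, withDensity_smul_measure, ← withDensity_smul]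
  · congr 1
    ext z
    rw [dens₂, ENNReal.ofReal_mul (sq_nonneg _), ENNReal.ofReal_mul (gaussDens_nonneg _ _ _)]
    rfl
  · exact (((m1 _).comp measurable_fst).mul ((m1 _).comp measurable_snd)).comp
      (MeasurableEquiv.measurable _)

end

/-! ### Bounds for the densities -/

/-- With l the regression coefficient, Var(X(p) - X(q)) = `condVar p q` + (l - 1)² Var X(q). Both
summands are nonnegative, so the bound O(Δ) on the increment passes to each of them, as Var X(q) ≥
t₀. -/
lemma exists_condVar_bounds {t₀ T : ℝ} (ht₀ : 0 < t₀) : ∃ c > 0, ∃ C > 0,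
    ∀ p ∈ Set.Icc t₀ T ×ˢ Set.Icc (0 : ℝ) 1, ∀ q ∈ Set.Icc t₀ T ×ˢ Set.Icc (0 : ℝ) 1,
      c * parabolicDist p q ≤ condVar p q * heatCov q q ∧
      condVar p q ≤ C * parabolicDist p q ∧
      (heatCov p q / heatCov q q - 1) ^ 2 ≤ C * parabolicDist p q := by
  obtain ⟨c, hc, hdet⟩ := exists_le_det ht₀ T
  obtain ⟨C, hC, hincr⟩ := exists_incr_le T
  have hsub : Set.Icc t₀ T ×ˢ Set.Icc (0 : ℝ) 1 ⊆ Set.Icc 0 T ×ˢ Set.Icc (0 : ℝ) 1 :=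
    Set.prod_mono (Set.Icc_subset_Icc_left ht₀.le) le_rfl
  refine ⟨c, hc, C + C / t₀, by positivity, fun p hp q hq => ?_⟩
  have h1 := hdet p hp q hq
  have h2 := hincr p (hsub hp) q (hsub hq)
  have hD := parabolicDist_nonneg p q
  have hqq := heatCov_pos ht₀ hq
  have hq0 : t₀ ≤ heatCov q q := hq.1.1.trans (le_heatCov_self (ht₀.le.trans hq.1.1))
  have hv := condVar_nonneg ht₀ hp hq
  rw [← condVar_mul ht₀ hq] at h1
  have e : heatCov p p - 2 * heatCov p q + heatCov q q =
      condVar p q + heatCov q q * (heatCov p q / heatCov q q - 1) ^ 2 := by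
    rw [condVar]; field_simp; ring
  have hnn := mul_nonneg hqq.le (sq_nonneg (heatCov p q / heatCov q q - 1))
  have hCt : 0 ≤ C / t₀ * parabolicDist p q := by positivity
  refine ⟨h1, by linarith, ?_⟩
  have h3 : t₀ * (heatCov p q / heatCov q q - 1) ^ 2 ≤ C * parabolicDist p q := by
    refine le_trans (mul_le_mul_of_nonneg_right hq0 (sq_nonneg _)) ?_
    linarith
  have h4 : (heatCov p q / heatCov q q - 1) ^ 2 ≤ C / t₀ * parabolicDist p q := by
    rw [div_mul_eq_mul_div, le_div_iff₀ ht₀]; linarith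
  have : 0 ≤ C * parabolicDist p q := by positivity
  linarith

lemma condVar_pos {t₀ T : ℝ} (ht₀ : 0 < t₀) {p q : ℝ × ℝ}
    (hp : p ∈ Set.Icc t₀ T ×ˢ Set.Icc (0 : ℝ) 1) (hq : q ∈ Set.Icc t₀ T ×ˢ Set.Icc (0 : ℝ) 1)
    (hpq : p ≠ q) : 0 < condVar p q := by
  obtain ⟨c, hc, C, hC, h⟩ := exists_condVar_bounds (T := T) ht₀
  have h1 := (h p hp q hq).1
  have h2 := parabolicDist_pos hpq
  exact pos_of_mul_pos_left (lt_of_lt_of_le (by positivity) h1) (heatCov_pos ht₀ hq).le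

lemma norm_sq_le_of_mem_cube {d : ℕ} {M : ℝ} {z : E d} (hz : z ∈ cube d M) :
    ‖z‖ ^ 2 ≤ d * M ^ 2 := by
  rw [EuclideanSpace.norm_sq_eq]
  calc ∑ i, ‖z i‖ ^ 2 ≤ ∑ _i : Fin d, M ^ 2 := by
        refine Finset.sum_le_sum fun i _ => ?_
        rw [Real.norm_eq_abs]
        have := abs_le.2 (hz i)
        gcongr
    _ = d * M ^ 2 := by simp

lemma norm_le_of_mem_cube {d : ℕ} {M : ℝ} (hM : 0 ≤ M) {z : E d} (hz : z ∈ cube d M) :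
    ‖z‖ ≤ M * √d := by
  refine le_of_sq_le_sq ?_ (by positivity)
  rw [mul_pow, Real.sq_sqrt (Nat.cast_nonneg d), mul_comm]
  exact norm_sq_le_of_mem_cube hz

lemma norm_symm_sq_le {d : ℕ} (S : E d ≃L[ℝ] E d) {M : ℝ} {z : E d} (hz : z ∈ cube d M) :
    ‖S.symm z‖ ^ 2 ≤ ‖(S.symm : E d →L[ℝ] E d)‖ ^ 2 * (d * M ^ 2) := by
  have h := (S.symm : E d →L[ℝ] E d).le_opNorm z
  calc ‖S.symm z‖ ^ 2 ≤ (‖(S.symm : E d →L[ℝ] E d)‖ * ‖z‖) ^ 2 := by gcongr; exact h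
    _ = ‖(S.symm : E d →L[ℝ] E d)‖ ^ 2 * ‖z‖ ^ 2 := by ring
    _ ≤ _ := by gcongr; exact norm_sq_le_of_mem_cube hz

lemma hypA1_dens₁ {d : ℕ} (S : E d ≃L[ℝ] E d) {t₀ T : ℝ} (ht₀ : 0 < t₀) :
    HypA1 (Set.Icc t₀ T) (Set.Icc 0 1) (dens₁ S) := by
  intro M hM
  set K := ‖(S.symm : E d →L[ℝ] E d)‖ ^ 2 * (d * M ^ 2) with hK
  have hdet := invDet_pos S
  -- If T < t₀ the parameter set is empty; otherwise the variances lie between t₀ and T + 1.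
  rcases lt_or_ge T t₀ with hT | hT
  · exact ⟨1, one_pos, fun p hp => absurd (hp.1.1.trans hp.1.2) (not_le.2 hT)⟩
  have hT0 : 0 < T := ht₀.trans_le hT
  refine ⟨invDet S * ((√(2 * Real.pi * (T + 1)))⁻¹ ^ d * Real.exp (-(K / (2 * t₀)))),
    by positivity, fun p hp z hz => ?_⟩
  have h1 : t₀ ≤ heatCov p p := hp.1.1.trans (le_heatCov_self (ht₀.le.trans hp.1.1))
  have h2 : heatCov p p ≤ T + 1 :=
    (heatCov_self_le (ht₀.le.trans hp.1.1)).trans (by linarith [hp.1.2])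
  have h3 := norm_symm_sq_le S hz
  have h0 := heatCov_pos ht₀ hp
  have hK0 : 0 ≤ K := by positivity
  unfold dens₁ gaussDens
  gcongr

lemma gaussDens_mul_le {d : ℕ} {v w a : ℝ} (hv : 0 ≤ v) (hw : 0 ≤ w) (ha : 0 < a)
    (h : a ≤ v * w) (x y : E d) :
    gaussDens d v x * gaussDens d w y ≤ (√a)⁻¹ ^ d * Real.exp (-(‖x‖ ^ 2 / (2 * v))) := by
  have h1 := gaussDens_le hw y
  have h2 : (√(2 * Real.pi * v))⁻¹ * (√(2 * Real.pi * w))⁻¹ ≤ (√a)⁻¹ := by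
    rw [← mul_inv, ← Real.sqrt_mul (by positivity)]
    refine inv_anti₀ (Real.sqrt_pos.2 ha) (Real.sqrt_le_sqrt ?_)
    have : 1 ≤ (2 * Real.pi) ^ 2 := by nlinarith [Real.pi_gt_three]
    calc a ≤ 1 * (v * w) := by linarith
      _ ≤ (2 * Real.pi) ^ 2 * (v * w) := by gcongr
      _ = _ := by ring
  calc gaussDens d v x * gaussDens d w y
      ≤ ((√(2 * Real.pi * v))⁻¹ ^ d * Real.exp (-(‖x‖ ^ 2 / (2 * v)))) *
        (√(2 * Real.pi * w))⁻¹ ^ d := by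
        unfold gaussDens at h1 ⊢; gcongr
    _ = ((√(2 * Real.pi * v))⁻¹ * (√(2 * Real.pi * w))⁻¹) ^ d *
        Real.exp (-(‖x‖ ^ 2 / (2 * v))) := by rw [mul_pow]; ring
    _ ≤ _ := by gcongr

lemma rpow_natCast_div_two {x : ℝ} (hx : 0 ≤ x) (d : ℕ) : x ^ ((d : ℝ) / 2) = √x ^ d := by
  rw [Real.sqrt_eq_rpow, ← Real.rpow_natCast, ← Real.rpow_mul hx]
  congr 1; ring

/-- The determinant bound gives the prefactor Δ^{-d/2}. The Gaussian factor involves y₁ - l y₂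
rather than y₁ - y₂; since (l - 1)² = O(Δ) and y₂ is bounded, the replacement changes the exponent,
after division by Δ, by a bounded amount. -/
lemma hypA2_dens₂ {d : ℕ} (S : E d ≃L[ℝ] E d) {t₀ T : ℝ} (ht₀ : 0 < t₀) :
    HypA2 (Set.Icc t₀ T) (Set.Icc 0 1) d (dens₂ S) := by
  intro M hM
  obtain ⟨c, hc, C, hC, hb⟩ := exists_condVar_bounds (T := T) ht₀
  set K := ‖(S.symm : E d →L[ℝ] E d)‖ ^ 2 * (d * M ^ 2) with hK
  set n := ‖(S : E d →L[ℝ] E d)‖ + 1 with hn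
  have hn0 : 0 < n := by positivity
  have hdet := invDet_pos S
  set c₁ := invDet S ^ 2 * ((√c)⁻¹ ^ d * Real.exp K) with hc₁
  have hc₁0 : 0 < c₁ := by positivity
  set c₂ := 4 * C * n ^ 2 with hc₂
  have hc₂0 : 0 < c₂ := by positivity
  refine ⟨max c₁ c₂, by positivity, fun p hp q hq hpq z₁ hz₁ z₂ hz₂ => ?_⟩
  obtain ⟨h1, h2, h3⟩ := hb p hp q hq
  have hD := parabolicDist_pos hpq
  set D := parabolicDist p q
  have hv := condVar_pos ht₀ hp hq hpq
  have hqq := heatCov_pos ht₀ hq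
  set l := heatCov p q / heatCov q q
  set y₁ := S.symm z₁ with hy₁
  set y₂ := S.symm z₂ with hy₂
  have hy2 : ‖y₂‖ ^ 2 ≤ K := norm_symm_sq_le S hz₂
  have hz : ‖z₁ - z₂‖ ≤ n * ‖y₁ - y₂‖ := by
    have e : z₁ - z₂ = (S : E d →L[ℝ] E d) (y₁ - y₂) := by simp [hy₁, hy₂]
    rw [e]
    refine ((S : E d →L[ℝ] E d).le_opNorm _).trans ?_
    gcongr
    simp [hn]
  have hy : ‖y₁ - y₂‖ ^ 2 ≤ 2 * ‖y₁ - l • y₂‖ ^ 2 + 2 * ((l - 1) ^ 2 * ‖y₂‖ ^ 2) := by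
    have e : y₁ - y₂ = (y₁ - l • y₂) + (l - 1) • y₂ := by module
    have h := norm_add_le (y₁ - l • y₂) ((l - 1) • y₂)
    rw [← e, norm_smul] at h
    calc ‖y₁ - y₂‖ ^ 2 ≤ (‖y₁ - l • y₂‖ + ‖l - 1‖ * ‖y₂‖) ^ 2 := by gcongr
      _ ≤ 2 * ‖y₁ - l • y₂‖ ^ 2 + 2 * (‖l - 1‖ * ‖y₂‖) ^ 2 := by
          nlinarith [sq_nonneg (‖y₁ - l • y₂‖ - ‖l - 1‖ * ‖y₂‖)]
      _ = _ := by rw [mul_pow, Real.norm_eq_abs, sq_abs]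
  have hexp : Real.exp (-(‖y₁ - l • y₂‖ ^ 2 / (2 * condVar p q))) ≤
      Real.exp K * Real.exp (-(‖z₁ - z₂‖ ^ 2 / (c₂ * D))) := by
    rw [← Real.exp_add, Real.exp_le_exp]
    have e1 : ‖y₁ - l • y₂‖ ^ 2 / (2 * (C * D)) ≤ ‖y₁ - l • y₂‖ ^ 2 / (2 * condVar p q) := by
      gcongr
    have e2 : ‖z₁ - z₂‖ ^ 2 / (c₂ * D) ≤ ‖y₁ - y₂‖ ^ 2 / (4 * (C * D)) := by
      rw [hc₂, div_le_div_iff₀ (by positivity) (by positivity)]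
      have : ‖z₁ - z₂‖ ^ 2 ≤ n ^ 2 * ‖y₁ - y₂‖ ^ 2 := by rw [← mul_pow]; gcongr
      calc ‖z₁ - z₂‖ ^ 2 * (4 * (C * D)) ≤ n ^ 2 * ‖y₁ - y₂‖ ^ 2 * (4 * (C * D)) := by gcongr
        _ = _ := by ring
    -- The summand K becomes the factor `Real.exp K` in c₁.
    have e3 : ‖y₁ - y₂‖ ^ 2 / (4 * (C * D)) ≤ ‖y₁ - l • y₂‖ ^ 2 / (2 * (C * D)) + K := by
      have h4 : (l - 1) ^ 2 * ‖y₂‖ ^ 2 ≤ C * D * K := by gcongr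
      have hCDK : 0 ≤ C * D * K := by positivity
      rw [div_le_iff₀ (by positivity)]
      have e4 : (‖y₁ - l • y₂‖ ^ 2 / (2 * (C * D)) + K) * (4 * (C * D)) =
          2 * ‖y₁ - l • y₂‖ ^ 2 + 4 * (C * D * K) := by field_simp; ring
      rw [e4]
      linarith
    linarith
  have hg := gaussDens_mul_le (d := d) hv.le hqq.le (by positivity : 0 < c * D) h1 (y₁ - l • y₂) y₂
  have hsq : (√(c * D))⁻¹ ^ d = (√c)⁻¹ ^ d / D ^ ((d : ℝ) / 2) := by
    rw [rpow_natCast_div_two hD.le, Real.sqrt_mul hc.le, mul_inv, mul_pow, div_eq_mul_inv, inv_pow,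
      inv_pow]
  have step : dens₂ S p q (z₁, z₂) ≤
      c₁ / D ^ ((d : ℝ) / 2) * Real.exp (-(‖z₁ - z₂‖ ^ 2 / (c₂ * D))) := by
    calc dens₂ S p q (z₁, z₂) ≤ invDet S ^ 2 * ((√(c * D))⁻¹ ^ d *
          Real.exp (-(‖y₁ - l • y₂‖ ^ 2 / (2 * condVar p q)))) := by
          unfold dens₂; gcongr
      _ ≤ invDet S ^ 2 * ((√(c * D))⁻¹ ^ d *
          (Real.exp K * Real.exp (-(‖z₁ - z₂‖ ^ 2 / (c₂ * D))))) := by gcongr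
      _ = _ := by rw [hsq, hc₁]; ring
  refine step.trans ?_
  gcongr
  · exact le_max_left _ _
  · exact le_max_right _ _

/-! ### Probabilities of balls -/

lemma exists_volume_ball (d : ℕ) : ∃ κ : ℝ, 0 < κ ∧ ∀ (z : E d) (r : ℝ), 0 < r →
    volume (Metric.ball z r) = ENNReal.ofReal (κ * r ^ d) ∧
    volume (Metric.closedBall z r) = ENNReal.ofReal (κ * r ^ d) := by
  have hfin : volume (Metric.ball (0 : E d) 1) ≠ ∞ := measure_ball_lt_top.ne
  refine ⟨(volume (Metric.ball (0 : E d) 1)).toReal,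
    ENNReal.toReal_pos (Metric.measure_ball_pos _ _ one_pos).ne' hfin, fun z r hr => ?_⟩
  rw [Measure.addHaar_closedBall _ _ hr.le, Measure.addHaar_ball_of_pos _ _ hr, mul_comm,
    ENNReal.ofReal_mul ENNReal.toReal_nonneg, ENNReal.ofReal_toReal hfin, finrank_euclideanSpace,
    Fintype.card_fin]
  exact ⟨rfl, rfl⟩

section

variable {d : ℕ} {t₀ T : ℝ} {S : E d ≃L[ℝ] E d}

lemma exists_prob_closedBall_le (S : E d ≃L[ℝ] E d) (ht₀ : 0 < t₀) (T : ℝ) : ∃ C > 0,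
    ∀ {Ω : Type u} [MeasurableSpace Ω] {P : Measure Ω} {u : ℝ × ℝ → Ω → E d},
      IsHeatField P t₀ T S u → ∀ p ∈ Set.Icc t₀ T ×ˢ Set.Icc (0 : ℝ) 1, ∀ z : E d, ∀ r > 0,
      P {ω | u p ω ∈ Metric.closedBall z r} ≤ ENNReal.ofReal (C * r ^ d) := by
  obtain ⟨κ, hκ, hvol⟩ := exists_volume_ball d
  have hdet := invDet_pos S
  set C₁ := invDet S * (√(2 * Real.pi * t₀))⁻¹ ^ d with hC₁
  have hC₁0 : 0 < C₁ := by positivity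
  refine ⟨C₁ * κ, by positivity, fun {Ω} _ P u hu p hp z r hr => ?_⟩
  have hden := hu.hasContinuousDensity ht₀ hp
  have h1 : P {ω | u p ω ∈ Metric.closedBall z r} = P.map (u p) (Metric.closedBall z r) :=
    (Measure.map_apply_of_aemeasurable hden.aemeasurable Metric.isClosed_closedBall.measurableSet).symm
  rw [h1, hden.map_eq, withDensity_apply _ Metric.isClosed_closedBall.measurableSet]
  have hle : ∀ y, dens₁ S p y ≤ C₁ := fun y => by
    have h2 : t₀ ≤ heatCov p p := hp.1.1.trans (le_heatCov_self (ht₀.le.trans hp.1.1))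
    have h3 := gaussDens_le (heatCov_pos ht₀ hp).le (S.symm y)
    unfold dens₁
    calc _ ≤ invDet S * (√(2 * Real.pi * heatCov p p))⁻¹ ^ d := by gcongr
      _ ≤ _ := by rw [hC₁]; gcongr
  calc ∫⁻ y in Metric.closedBall z r, ENNReal.ofReal (dens₁ S p y)
      ≤ ∫⁻ y in Metric.closedBall z r, ENNReal.ofReal C₁ :=
        lintegral_mono fun y => ENNReal.ofReal_le_ofReal (hle y)
    _ = ENNReal.ofReal (C₁ * κ * r ^ d) := by
        rw [setLIntegral_const, (hvol z r hr).2, ← ENNReal.ofReal_mul hC₁0.le]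
        congr 1; ring

lemma mem_cube_of_mem_ball {M ε : ℝ} {z y : E d} (hz : z ∈ cube d M) (hε : ε ≤ 1)
    (hy : y ∈ Metric.ball z ε) : y ∈ cube d (M + 1) := by
  intro i
  have h1 : |y i - z i| ≤ 1 := by
    have h2 : ‖(y - z) i‖ ≤ ‖y - z‖ := PiLp.norm_apply_le (y - z) i
    have h3 : ‖y - z‖ < ε := by rw [← dist_eq_norm]; exact hy
    have h4 : (y - z) i = y i - z i := rfl
    rw [h4, Real.norm_eq_abs] at h2
    linarith
  have h5 := hz i
  rw [abs_le] at h1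
  constructor <;> linarith [h5.1, h5.2]

/-- A1 is applied on the cube of size M + 1, because a ball of radius at most 1 may leave the
original cube. -/
lemma exists_le_prob_ball (S : E d ≃L[ℝ] E d) (ht₀ : 0 < t₀) (T : ℝ) {M : ℝ} (hM : 0 < M) :
    ∃ C > 0, ∀ {Ω : Type u} [MeasurableSpace Ω] {P : Measure Ω} {u : ℝ × ℝ → Ω → E d},
      IsHeatField P t₀ T S u → ∀ p ∈ Set.Icc t₀ T ×ˢ Set.Icc (0 : ℝ) 1, ∀ z ∈ cube d M,
      ∀ r, 0 < r → r ≤ 1 → ENNReal.ofReal (C * r ^ d) ≤ P {ω | u p ω ∈ Metric.ball z r} := by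
  obtain ⟨κ, hκ, hvol⟩ := exists_volume_ball d
  obtain ⟨C, hC, hA1⟩ := hypA1_dens₁ S (T := T) ht₀ (M + 1) (by linarith)
  refine ⟨C * κ, by positivity, fun {Ω} _ P u hu p hp z hz r hr hr1 => ?_⟩
  have hden := hu.hasContinuousDensity ht₀ hp
  have h1 : P {ω | u p ω ∈ Metric.ball z r} = P.map (u p) (Metric.ball z r) :=
    (Measure.map_apply_of_aemeasurable hden.aemeasurable measurableSet_ball).symm
  rw [h1, hden.map_eq, withDensity_apply _ measurableSet_ball]
  calc ENNReal.ofReal (C * κ * r ^ d) = ∫⁻ y in Metric.ball z r, ENNReal.ofReal C := by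
        rw [setLIntegral_const, (hvol z r hr).1, ← ENNReal.ofReal_mul hC.le, mul_assoc]
    _ ≤ _ := setLIntegral_mono' measurableSet_ball fun y hy =>
        ENNReal.ofReal_le_ofReal (hA1 p hp y (mem_cube_of_mem_ball hz hr1 hy))

end

/-! ### Increments -/

lemma gaussVec_eq_map_smul {d : ℕ} {v : ℝ} (hv : 0 ≤ v) :
    gaussVec d v = (gaussVec d 1).map ((√v • ContinuousLinearMap.id ℝ (E d)) : E d →L[ℝ] E d) := by
  have : IsProbabilityMeasure ((gaussVec d 1).map
      ((√v • ContinuousLinearMap.id ℝ (E d)) : E d →L[ℝ] E d)) :=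
    Measure.isProbabilityMeasure_map (by fun_prop)
  refine Measure.ext_of_charFunDual (funext fun L => ?_)
  rw [charFunDual_map, charFunDual_gaussVec hv, charFunDual_gaussVec zero_le_one]
  congr 4
  refine Finset.sum_congr rfl fun j _ => ?_
  simp [mul_pow, Real.sq_sqrt hv]

/-- Markov's inequality for the 14th moment. The power only has to be large enough for the chaining:
refining a grid multiplies the number of points by about 64, while the tail decreases by the factor
(9/4)⁷ > 128. -/
lemma exists_gaussVec_tail (d : ℕ) : ∃ K > 0, ∀ v a : ℝ, 0 ≤ v → 0 < a →
    gaussVec d v {y | a ≤ ‖y‖} ≤ ENNReal.ofReal (K * (v ^ 7 / a ^ 14)) := by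
  have hm : MemLp id 14 (gaussVec d 1) := by
    have h := map_pi_eq_stdGaussian (ι := Fin d)
    have h' : gaussVec d 1 = stdGaussian (E d) := by
      rw [← h, gaussVec, Real.toNNReal_one]
    rw [h']
    exact IsGaussian.memLp_id _ _ (by norm_num)
  have hintg : Integrable (fun y : E d => ‖y‖ ^ 14) (gaussVec d 1) := by
    have := hm.integrable_norm_pow (p := 14) (by norm_num)
    simpa using this
  set m := ∫ y, ‖y‖ ^ 14 ∂(gaussVec d 1) with hm'
  have hm0 : 0 ≤ m := integral_nonneg fun y => by positivity
  refine ⟨m + 1, by positivity, fun v a hv ha => ?_⟩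
  have hset : MeasurableSet {y : E d | a ≤ ‖y‖} := measurableSet_le measurable_const measurable_norm
  rw [gaussVec_eq_map_smul hv, Measure.map_apply (by fun_prop) hset]
  have hsub : ((√v • ContinuousLinearMap.id ℝ (E d)) : E d →L[ℝ] E d) ⁻¹' {y : E d | a ≤ ‖y‖} ⊆
      {y | ENNReal.ofReal (a ^ 14) ≤ ENNReal.ofReal (v ^ 7 * ‖y‖ ^ 14)} := by
    intro y hy
    have h1 : a ≤ √v * ‖y‖ := by
      have : a ≤ ‖√v • y‖ := hy
      rwa [norm_smul, Real.norm_of_nonneg (Real.sqrt_nonneg v)] at this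
    have h2 : a ^ 14 ≤ v ^ 7 * ‖y‖ ^ 14 := by
      calc a ^ 14 ≤ (√v * ‖y‖) ^ 14 := by gcongr
        _ = (√v ^ 2) ^ 7 * ‖y‖ ^ 14 := by ring
        _ = _ := by rw [Real.sq_sqrt hv]
    exact ENNReal.ofReal_le_ofReal h2
  refine (measure_mono hsub).trans ?_
  refine (meas_ge_le_lintegral_div (by fun_prop) (by simp; positivity) ENNReal.ofReal_ne_top).trans ?_
  rw [← ofReal_integral_eq_lintegral_ofReal (hintg.const_mul _)
    (Eventually.of_forall fun y => by positivity), integral_const_mul,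
    ← ENNReal.ofReal_div_of_pos (by positivity)]
  refine ENNReal.ofReal_le_ofReal ?_
  rw [← hm', mul_comm, mul_div_assoc]
  gcongr
  linarith

/-- The field is near `z` at `p` and has a large increment between `p` and `p'`. -/
lemma exists_prob_incr_le {d : ℕ} (S : E d ≃L[ℝ] E d) {t₀ : ℝ} (ht₀ : 0 < t₀) (T : ℝ) :
    ∃ A > 0, ∃ C > 0,
    ∀ {Ω : Type u} [MeasurableSpace Ω] {P : Measure Ω} {u : ℝ × ℝ → Ω → E d},
      IsHeatField P t₀ T S u → ∀ p ∈ Set.Icc t₀ T ×ˢ Set.Icc (0 : ℝ) 1,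
      ∀ p' ∈ Set.Icc t₀ T ×ˢ Set.Icc (0 : ℝ) 1, ∀ z : E d, ∀ r > 0, ∀ s > 0,
      A * (‖z‖ + r) * √(parabolicDist p' p) ≤ s →
      P {ω | u p ω ∈ Metric.closedBall z r ∧ s < ‖u p' ω - u p ω‖} ≤
        ENNReal.ofReal (C * r ^ d * (parabolicDist p' p ^ 7 / s ^ 14)) := by
  obtain ⟨c, hc, C, hC, hb⟩ := exists_condVar_bounds (T := T) ht₀
  obtain ⟨K, hK, htail⟩ := exists_gaussVec_tail d
  obtain ⟨C₁, hC₁, hball⟩ := exists_prob_closedBall_le.{u} S ht₀ T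
  set n := ‖(S : E d →L[ℝ] E d)‖ + 1 with hn
  have hn0 : 0 < n := by positivity
  refine ⟨2 * √C, by positivity, K * C ^ 7 * (2 * n) ^ 14 * C₁, by positivity,
    fun {Ω} _ P u hu p hp p' hp' z r hr s hs hA => ?_⟩
  obtain ⟨-, h2, h3⟩ := hb p' hp' p hp
  have hD := parabolicDist_nonneg p' p
  set D := parabolicDist p' p
  set l := heatCov p' p / heatCov p p with hl
  have hv := condVar_nonneg ht₀ hp' hp
  set B : Set (E d) := {y | S y ∈ Metric.closedBall z r}
  set F : Set (E d) := {y | s / (2 * n) ≤ ‖y‖}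
  have hB : MeasurableSet B := S.continuous.measurable Metric.isClosed_closedBall.measurableSet
  have hF : MeasurableSet F := measurableSet_le measurable_const measurable_norm
  have hlaw := hu.law p' hp' p hp
  have hsub : {ω | u p ω ∈ Metric.closedBall z r ∧ s < ‖u p' ω - u p ω‖} ⊆
      (fun ω => (S.symm (u p' ω) - l • S.symm (u p ω), S.symm (u p ω))) ⁻¹' (F ×ˢ B) := by
    rintro ω ⟨h4, h5⟩
    refine ⟨?_, by simpa [B] using h4⟩
    set R := S.symm (u p' ω) - l • S.symm (u p ω) with hR
    -- R is independent of u(p). The drift (l - 1)u(p) is at most s/2 by the hypothesis on s, so an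
    -- increment larger than s forces ‖R‖ ≥ s/(2n), and the two probabilities multiply.
    have e : u p' ω - u p ω = (S : E d →L[ℝ] E d) R + (l - 1) • u p ω := by
      simp only [hR, ContinuousLinearEquiv.coe_coe, map_sub, map_smul,
        ContinuousLinearEquiv.apply_symm_apply]
      module
    have h6 : ‖u p ω‖ ≤ ‖z‖ + r := by
      have : ‖u p ω - z‖ ≤ r := by rw [← dist_eq_norm]; exact h4
      linarith [norm_le_norm_add_norm_sub' (u p ω) z, norm_sub_rev z (u p ω)]
    have h7 : |l - 1| ≤ √C * √D := by
      rw [← Real.sqrt_mul hC.le, ← Real.sqrt_sq_eq_abs]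
      exact Real.sqrt_le_sqrt h3
    have h8 : ‖u p' ω - u p ω‖ ≤ n * ‖R‖ + s / 2 := by
      rw [e]
      refine (norm_add_le _ _).trans (add_le_add ?_ ?_)
      · refine ((S : E d →L[ℝ] E d).le_opNorm _).trans ?_
        gcongr
        simp [hn]
      · rw [norm_smul, Real.norm_eq_abs]
        calc |l - 1| * ‖u p ω‖ ≤ (√C * √D) * (‖z‖ + r) := by gcongr
          _ = (2 * √C * (‖z‖ + r) * √D) / 2 := by ring
          _ ≤ s / 2 := by gcongr
    change s / (2 * n) ≤ ‖R‖
    rw [div_le_iff₀ (by positivity)]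
    linarith
  have hgB : gaussVec d (heatCov p p) B ≤ ENNReal.ofReal (C₁ * r ^ d) := by
    rw [← hu.map_symm hp, Measure.map_apply_of_aemeasurable (hu.aemeasurable_symm hp) hB]
    refine le_trans (measure_mono fun ω hω => ?_) (hball hu p hp z r hr)
    simpa [B] using hω
  calc P {ω | u p ω ∈ Metric.closedBall z r ∧ s < ‖u p' ω - u p ω‖}
      ≤ P ((fun ω => (S.symm (u p' ω) - l • S.symm (u p ω), S.symm (u p ω))) ⁻¹' (F ×ˢ B)) :=
        measure_mono hsub
    _ = gaussVec d (condVar p' p) F * gaussVec d (heatCov p p) B := by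
        rw [← Measure.map_apply_of_aemeasurable (hu.aemeasurable_pair hp' hp _) (hF.prod hB),
          hlaw, Measure.prod_prod]
    _ ≤ ENNReal.ofReal (K * (condVar p' p ^ 7 / (s / (2 * n)) ^ 14)) *
        ENNReal.ofReal (C₁ * r ^ d) := by
        gcongr
        exact htail _ _ hv (by positivity)
    _ ≤ _ := by
        rw [← ENNReal.ofReal_mul (by positivity)]
        refine ENNReal.ofReal_le_ofReal ?_
        calc K * (condVar p' p ^ 7 / (s / (2 * n)) ^ 14) * (C₁ * r ^ d)
            ≤ K * ((C * D) ^ 7 / (s / (2 * n)) ^ 14) * (C₁ * r ^ d) := by gcongr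
          _ = _ := by field_simp

/-! ### Hitting probabilities of small rectangles -/

/-- The grid of generation `n` on the rectangle with corner `o` and sides `h`, `k`. -/
noncomputable def gridPoint (o : ℝ × ℝ) (h k : ℝ) (n i j : ℕ) : ℝ × ℝ :=
  (o.1 + (i : ℝ) / (16 : ℝ) ^ n * h, o.2 + (j : ℝ) / (4 : ℝ) ^ n * k)

/-- The quotient `i / b` in ℕ is the parent of i in the coarser grid. -/
lemma div_pow_sub_div_pow_succ {b : ℕ} (hb : 0 < b) (n i : ℕ) :
    |((i / b : ℕ) : ℝ) / (b : ℝ) ^ n - (i : ℝ) / (b : ℝ) ^ (n + 1)| ≤ 1 / (b : ℝ) ^ n := by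
  have hb' : (0 : ℝ) < b := by exact_mod_cast hb
  have e : ((i / b : ℕ) : ℝ) / (b : ℝ) ^ n - (i : ℝ) / (b : ℝ) ^ (n + 1) =
      (((i / b : ℕ) : ℝ) - (i : ℝ) / b) / (b : ℝ) ^ n := by
    rw [pow_succ]; field_simp
  rw [e, abs_div, abs_of_pos (pow_pos hb' n)]
  gcongr
  have h1 : ((i / b : ℕ) : ℝ) ≤ (i : ℝ) / b := Nat.cast_div_le
  have h2 : (i : ℝ) / b ≤ ((i / b : ℕ) : ℝ) + 1 := by
    rw [div_le_iff₀ hb']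
    have := Nat.lt_div_mul_add (a := i) hb
    have h3 : i ≤ (i / b + 1) * b := by rw [add_mul, one_mul]; exact this.le
    exact_mod_cast h3
  rw [abs_le]; constructor <;> linarith

/-- Time is refined by 16 and space by 4, so that both terms of the parabolic distance shrink by 4
per generation. -/
lemma parabolicDist_gridPoint_le (o : ℝ × ℝ) {h k η : ℝ} (hh : 0 ≤ h) (hk : 0 ≤ k)
    (hhη : h ≤ η ^ 4) (hkη : k ≤ η ^ 2) (n i j : ℕ) :
    parabolicDist (gridPoint o h k n (i / 16) (j / 4)) (gridPoint o h k (n + 1) i j) ≤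
      2 * η ^ 2 / 4 ^ n := by
  have h1 := div_pow_sub_div_pow_succ (b := 16) (by norm_num) n i
  have h2 := div_pow_sub_div_pow_succ (b := 4) (by norm_num) n j
  push_cast at h1 h2
  have e1 : (gridPoint o h k n (i / 16) (j / 4)).1 - (gridPoint o h k (n + 1) i j).1 =
      (((i / 16 : ℕ) : ℝ) / 16 ^ n - (i : ℝ) / 16 ^ (n + 1)) * h := by
    simp only [gridPoint]; ring
  have e2 : (gridPoint o h k n (i / 16) (j / 4)).2 - (gridPoint o h k (n + 1) i j).2 =
      (((j / 4 : ℕ) : ℝ) / 4 ^ n - (j : ℝ) / 4 ^ (n + 1)) * k := by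
    simp only [gridPoint]; ring
  have h3 : √|(((i / 16 : ℕ) : ℝ) / 16 ^ n - (i : ℝ) / 16 ^ (n + 1)) * h| ≤ η ^ 2 / 4 ^ n := by
    refine Real.sqrt_le_iff.2 ⟨by positivity, ?_⟩
    rw [abs_mul, abs_of_nonneg hh]
    calc _ ≤ 1 / (16 : ℝ) ^ n * η ^ 4 := by gcongr
      _ = _ := by
        rw [div_pow, ← pow_mul, ← pow_mul, show (16 : ℝ) = 4 ^ 2 by norm_num, ← pow_mul,
          mul_comm 2 n]; ring
  have h4 : |(((j / 4 : ℕ) : ℝ) / 4 ^ n - (j : ℝ) / 4 ^ (n + 1)) * k| ≤ η ^ 2 / 4 ^ n := by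
    rw [abs_mul, abs_of_nonneg hk]
    calc _ ≤ 1 / (4 : ℝ) ^ n * η ^ 2 := by gcongr
      _ = _ := by ring
  rw [parabolicDist, e1, e2]
  calc _ ≤ η ^ 2 / 4 ^ n + η ^ 2 / 4 ^ n := add_le_add h3 h4
    _ = _ := by ring

lemma exists_eq_add_mul_of_mem_Icc {a h x : ℝ} (hx : x ∈ Set.Icc a (a + h)) :
    ∃ θ ∈ Set.Icc (0 : ℝ) 1, x = a + θ * h := by
  have hh : 0 ≤ h := by linarith [hx.1, hx.2]
  rcases hh.eq_or_lt with h0 | h0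
  · exact ⟨0, by simp, by subst h0; linarith [hx.1, hx.2]⟩
  · refine ⟨(x - a) / h, ⟨div_nonneg (by linarith [hx.1]) hh, ?_⟩, by field_simp; ring⟩
    rw [div_le_one h0]; linarith [hx.2]

lemma gridPoint_mem {o : ℝ × ℝ} {h k : ℝ} (hh : 0 ≤ h) (hk : 0 ≤ k) {n i j : ℕ}
    (hi : i ≤ 16 ^ n) (hj : j ≤ 4 ^ n) :
    gridPoint o h k n i j ∈ Set.Icc o.1 (o.1 + h) ×ˢ Set.Icc o.2 (o.2 + k) := by
  have h1 : (i : ℝ) / 16 ^ n ≤ 1 := div_le_one_of_le₀ (by exact_mod_cast hi) (by positivity)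
  have h2 : (j : ℝ) / 4 ^ n ≤ 1 := div_le_one_of_le₀ (by exact_mod_cast hj) (by positivity)
  have h3 : (i : ℝ) / 16 ^ n * h ≤ 1 * h := by gcongr
  have h4 : (j : ℝ) / 4 ^ n * k ≤ 1 * k := by gcongr
  refine ⟨⟨?_, ?_⟩, ?_, ?_⟩ <;> simp only [gridPoint]
  · have : 0 ≤ (i : ℝ) / 16 ^ n * h := by positivity
    linarith
  · linarith
  · have : 0 ≤ (j : ℝ) / 4 ^ n * k := by positivity
    linarith
  · linarith

lemma floor_mul_pow_le {θ : ℝ} (hθ : θ ∈ Set.Icc (0 : ℝ) 1) (b n : ℕ) :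
    ⌊θ * (b : ℝ) ^ n⌋₊ ≤ b ^ n := by
  refine Nat.floor_le_of_le ?_
  push_cast
  exact mul_le_of_le_one_left (by positivity) hθ.2

lemma floor_mul_pow_succ_div {θ : ℝ} {b : ℕ} (hb : 0 < b) (n : ℕ) :
    ⌊θ * (b : ℝ) ^ (n + 1)⌋₊ / b = ⌊θ * (b : ℝ) ^ n⌋₊ := by
  rw [← Nat.floor_div_natCast]
  congr 1
  have hb' : (b : ℝ) ≠ 0 := by exact_mod_cast hb.ne'
  rw [pow_succ]; field_simp

lemma tendsto_floor_mul_pow {θ : ℝ} (hθ : 0 ≤ θ) {b : ℕ} (hb : 1 < b) :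
    Tendsto (fun n : ℕ => ((⌊θ * (b : ℝ) ^ n⌋₊ : ℕ) : ℝ) / (b : ℝ) ^ n) atTop (𝓝 θ) :=
  (tendsto_nat_floor_mul_div_atTop hθ).comp
    (tendsto_pow_atTop_atTop_of_one_lt (by exact_mod_cast hb))

lemma sum_range_sum_range_ofReal (n m : ℕ) (x : ℝ) :
    ∑ _i ∈ Finset.range n, ∑ _j ∈ Finset.range m, ENNReal.ofReal x =
      ENNReal.ofReal (n * (m * x)) := by
  rw [Finset.sum_const, Finset.sum_const, Finset.card_range, Finset.card_range, nsmul_eq_mul,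
    nsmul_eq_mul, ENNReal.ofReal_mul (Nat.cast_nonneg n), ENNReal.ofReal_mul (Nat.cast_nonneg m),
    ENNReal.ofReal_natCast, ENNReal.ofReal_natCast]

/-- The chaining step: a path which visits the `δ`-ball at a point of the rectangle either is
within `6δ` of `z` at a corner, or has a large increment on some grid. -/
lemma exists_of_mem_closedBall {d : ℕ} {o : ℝ × ℝ} {h k δ : ℝ} (hδ : 0 < δ) {f : ℝ × ℝ → E d}
    (hf : ContinuousOn f (Set.Icc o.1 (o.1 + h) ×ˢ Set.Icc o.2 (o.2 + k)))
    {p : ℝ × ℝ} (hp : p ∈ Set.Icc o.1 (o.1 + h) ×ˢ Set.Icc o.2 (o.2 + k)) {z : E d}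
    (hz : f p ∈ Metric.closedBall z δ) :
    (∃ i j : ℕ, i ≤ 1 ∧ j ≤ 1 ∧ f (gridPoint o h k 0 i j) ∈ Metric.closedBall z (6 * δ)) ∨
    ∃ n i j : ℕ, i ≤ 16 ^ (n + 1) ∧ j ≤ 4 ^ (n + 1) ∧
      f (gridPoint o h k (n + 1) i j) ∈ Metric.closedBall z (6 * δ) ∧
      δ * (3 / 4 : ℝ) ^ n <
        ‖f (gridPoint o h k n (i / 16) (j / 4)) - f (gridPoint o h k (n + 1) i j)‖ := by
  by_contra! hcon
  obtain ⟨hcon0, hcon⟩ := hcon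
  have hh : 0 ≤ h := by linarith [hp.1.1, hp.1.2]
  have hk : 0 ≤ k := by linarith [hp.2.1, hp.2.2]
  obtain ⟨θ, hθ, h1⟩ := exists_eq_add_mul_of_mem_Icc hp.1
  obtain ⟨φ, hφ, h2⟩ := exists_eq_add_mul_of_mem_Icc hp.2
  set g : ℕ → ℝ × ℝ := fun n => gridPoint o h k n ⌊θ * (16 : ℕ) ^ n⌋₊ ⌊φ * (4 : ℕ) ^ n⌋₊ with hg
  have hgm : ∀ n, g n ∈ Set.Icc o.1 (o.1 + h) ×ˢ Set.Icc o.2 (o.2 + k) := fun n =>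
    gridPoint_mem hh hk (floor_mul_pow_le hθ 16 n) (floor_mul_pow_le hφ 4 n)
  have hlim : Tendsto g atTop (𝓝 p) := by
    have e : p = (o.1 + θ * h, o.2 + φ * k) := Prod.ext h1 h2
    rw [e]
    refine Tendsto.prodMk_nhds ?_ ?_
    · exact tendsto_const_nhds.add ((tendsto_floor_mul_pow hθ.1 (b := 16) (by norm_num)).mul_const h)
    · exact tendsto_const_nhds.add ((tendsto_floor_mul_pow hφ.1 (b := 4) (by norm_num)).mul_const k)
  have hflim : Tendsto (fun n => f (g n)) atTop (𝓝 (f p)) :=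
    (hf p hp).tendsto.comp (tendsto_nhdsWithin_iff.2 ⟨hlim, Eventually.of_forall hgm⟩)
  obtain ⟨N, hN⟩ := (Metric.tendsto_atTop.1 hflim) δ hδ
  -- Backward induction from a generation N where the grid point is δ-close to p in value. A step
  -- adds δ(3/4)^l, and 4(3/4)^{l+1} + (3/4)^l = 4(3/4)^l. The distance thus never exceeds 6δ, which
  -- is what makes `hcon` applicable at each step.
  have key : ∀ m ≤ N, ‖f (g (N - m)) - z‖ ≤ 2 * δ + 4 * δ * (3 / 4 : ℝ) ^ (N - m) := by
    intro m
    induction m with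
    | zero =>
      intro _
      have h3 := hN N le_rfl
      rw [dist_eq_norm] at h3
      rw [Metric.mem_closedBall, dist_eq_norm] at hz
      have h4 := norm_sub_le_norm_sub_add_norm_sub (f (g N)) (f p) z
      have : 0 ≤ 4 * δ * (3 / 4 : ℝ) ^ (N - 0) := by positivity
      simp only [Nat.sub_zero] at *
      linarith
    | succ m ih =>
      intro hm
      have ih := ih (by omega)
      obtain ⟨l, hl⟩ : ∃ l, N - m = l + 1 := ⟨N - m - 1, by omega⟩
      have hl' : N - (m + 1) = l := by omega
      rw [hl] at ih
      rw [hl']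
      have h5 : f (g (l + 1)) ∈ Metric.closedBall z (6 * δ) := by
        rw [Metric.mem_closedBall, dist_eq_norm]
        have : (3 / 4 : ℝ) ^ (l + 1) ≤ 1 := pow_le_one₀ (by norm_num) (by norm_num)
        nlinarith
      have h6 := hcon l _ _ (floor_mul_pow_le hθ 16 (l + 1)) (floor_mul_pow_le hφ 4 (l + 1)) h5
      rw [floor_mul_pow_succ_div (by norm_num), floor_mul_pow_succ_div (by norm_num)] at h6
      have h7 := norm_sub_le_norm_sub_add_norm_sub (f (g l)) (f (g (l + 1))) z
      have h8 : ‖f (g l) - f (g (l + 1))‖ ≤ δ * (3 / 4) ^ l := h6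
      rw [pow_succ] at ih
      linarith
  have h9 := key N le_rfl
  refine hcon0 _ _ (floor_mul_pow_le hθ 16 0) (floor_mul_pow_le hφ 4 0) ?_
  rw [Metric.mem_closedBall, dist_eq_norm]
  simp only [Nat.sub_self, pow_zero] at h9
  calc _ ≤ _ := h9
    _ = _ := by ring

section

variable {d : ℕ} {t₀ : ℝ}

/-- Union bound over the alternatives of `exists_of_mem_closedBall`. Each event places the field
within 6δ of z at a grid point and so carries a factor δ^d; the increment probabilities decay faster
than the number of grid points grows. -/
lemma exists_hitProb_small_le (S : E d ≃L[ℝ] E d) (ht₀ : 0 < t₀) (T : ℝ) {M : ℝ} (hM : 0 < M) :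
    ∃ η > 0, ∃ C > 0,
    ∀ {Ω : Type u} [MeasurableSpace Ω] {P : Measure Ω} {u : ℝ × ℝ → Ω → E d},
      IsHeatField P t₀ T S u → ∀ (o : ℝ × ℝ) (h k δ : ℝ), 0 < δ → δ ≤ 1 → 0 ≤ h → 0 ≤ k →
      h ≤ (η * δ) ^ 4 → k ≤ (η * δ) ^ 2 →
      Set.Icc o.1 (o.1 + h) ×ˢ Set.Icc o.2 (o.2 + k) ⊆ Set.Icc t₀ T ×ˢ Set.Icc (0 : ℝ) 1 →
      ∀ z : E d, ‖z‖ ≤ M →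
      hitProb P u (Set.Icc o.1 (o.1 + h) ×ˢ Set.Icc o.2 (o.2 + k)) (Metric.closedBall z δ) ≤
        ENNReal.ofReal (C * δ ^ d) := by
  obtain ⟨A, hA, C₁, hC₁, hincr⟩ := exists_prob_incr_le.{u} S ht₀ T
  obtain ⟨C₂, hC₂, hball⟩ := exists_prob_closedBall_le.{u} S ht₀ T
  -- Chosen so that the drift condition of `exists_prob_incr_le` holds at every generation with s =
  -- δ(3/4)^n.
  set η := (2 * (A * (M + 6)))⁻¹ with hη
  have hη0 : 0 < η := by positivity
  set C₃ := C₁ * 6 ^ d * (128 * η ^ 14) * 256 with hC₃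
  have hC₃0 : 0 < C₃ := by positivity
  refine ⟨η, hη0, 4 * (C₂ * 6 ^ d) + C₃ * 2, by positivity,
    fun {Ω} _ P u hu o h k δ hδ hδ1 hh hk hhη hkη hsub z hz => ?_⟩
  set G : ℕ → ℕ → ℕ → Set Ω := fun n i j =>
    {ω | u (gridPoint o h k (n + 1) i j) ω ∈ Metric.closedBall z (6 * δ) ∧ δ * (3 / 4 : ℝ) ^ n <
      ‖u (gridPoint o h k n (i / 16) (j / 4)) ω - u (gridPoint o h k (n + 1) i j) ω‖} with hG
  have hbad : ∀ n i j : ℕ, i ≤ 16 ^ (n + 1) → j ≤ 4 ^ (n + 1) →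
      P (G n i j) ≤ ENNReal.ofReal (C₁ * (6 * δ) ^ d * (128 * η ^ 14 * (((3 / 4 : ℝ) ^ 14 * 4 ^ 7) ^ n)⁻¹)) := by
    intro n i j hi hj
    have hD := parabolicDist_gridPoint_le o hh hk hhη hkη n i j
    have hi' : i / 16 ≤ 16 ^ n := by rw [pow_succ] at hi; omega
    have hj' : j / 4 ≤ 4 ^ n := by rw [pow_succ] at hj; omega
    have hD0 := parabolicDist_nonneg (gridPoint o h k n (i / 16) (j / 4))
      (gridPoint o h k (n + 1) i j)
    refine (hincr hu _ (hsub (gridPoint_mem hh hk hi hj)) _ (hsub (gridPoint_mem hh hk hi' hj'))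
      z (6 * δ) (by positivity) (δ * (3 / 4 : ℝ) ^ n) (by positivity) ?_).trans ?_
    · have h1 : √(parabolicDist (gridPoint o h k n (i / 16) (j / 4))
          (gridPoint o h k (n + 1) i j)) ≤ 2 * (η * δ) * (3 / 4) ^ n := by
        refine Real.sqrt_le_iff.2 ⟨by positivity, hD.trans ?_⟩
        have h2 : (1 / 4 : ℝ) ^ n ≤ ((3 / 4) ^ 2) ^ n := by gcongr; norm_num
        calc 2 * (η * δ) ^ 2 / 4 ^ n = 2 * (η * δ) ^ 2 * (1 / 4) ^ n := by
              rw [one_div, inv_pow]; ring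
          _ ≤ 4 * (η * δ) ^ 2 * ((3 / 4) ^ 2) ^ n := by gcongr; norm_num
          _ = _ := by rw [← pow_mul, mul_comm 2 n, pow_mul]; ring
      calc A * (‖z‖ + 6 * δ) * √(parabolicDist (gridPoint o h k n (i / 16) (j / 4))
          (gridPoint o h k (n + 1) i j)) ≤ A * (M + 6) * (2 * (η * δ) * (3 / 4) ^ n) := by
            gcongr; linarith
        _ = (2 * (A * (M + 6))) * η * (δ * (3 / 4) ^ n) := by ring
        _ = δ * (3 / 4) ^ n := by
            rw [hη, mul_inv_cancel₀ (by positivity), one_mul]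
    · refine ENNReal.ofReal_le_ofReal ?_
      have h3 : parabolicDist (gridPoint o h k n (i / 16) (j / 4))
          (gridPoint o h k (n + 1) i j) ^ 7 ≤ (2 * (η * δ) ^ 2 / 4 ^ n) ^ 7 := by gcongr
      calc _ ≤ C₁ * (6 * δ) ^ d * ((2 * (η * δ) ^ 2 / 4 ^ n) ^ 7 / (δ * (3 / 4) ^ n) ^ 14) := by
            gcongr
        _ = C₁ * (6 * δ) ^ d * (128 * η ^ 14 * (((3 / 4) ^ n) ^ 14 * (4 ^ n) ^ 7)⁻¹) := by
            congr 1
            field_simp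
            ring
        _ = _ := by
            congr 3
            rw [mul_pow, ← pow_mul, ← pow_mul, ← pow_mul, ← pow_mul, mul_comm n 14, mul_comm n 7]
  have hlevel : ∀ n, P (⋃ i ∈ Finset.range (16 ^ (n + 1) + 1),
      ⋃ j ∈ Finset.range (4 ^ (n + 1) + 1), G n i j) ≤
      ENNReal.ofReal (C₃ * δ ^ d * (1 / 2) ^ n) := by
    intro n
    calc _ ≤ ∑ i ∈ Finset.range (16 ^ (n + 1) + 1), ∑ j ∈ Finset.range (4 ^ (n + 1) + 1),
          ENNReal.ofReal (C₁ * (6 * δ) ^ d * (128 * η ^ 14 * (((3 / 4 : ℝ) ^ 14 * 4 ^ 7) ^ n)⁻¹)) := by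
          refine (measure_biUnion_finset_le _ _).trans (Finset.sum_le_sum fun i hi => ?_)
          refine (measure_biUnion_finset_le _ _).trans (Finset.sum_le_sum fun j hj => ?_)
          exact hbad n i j (Nat.lt_succ_iff.1 (Finset.mem_range.1 hi))
            (Nat.lt_succ_iff.1 (Finset.mem_range.1 hj))
      _ = ENNReal.ofReal ((16 ^ (n + 1) + 1) * ((4 ^ (n + 1) + 1) *
          (C₁ * (6 * δ) ^ d * (128 * η ^ 14 * (((3 / 4 : ℝ) ^ 14 * 4 ^ 7) ^ n)⁻¹)))) := by
          rw [sum_range_sum_range_ofReal]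
          push_cast
          rfl
      _ ≤ _ := by
          refine ENNReal.ofReal_le_ofReal ?_
          have h1 : (16 : ℝ) ^ (n + 1) + 1 ≤ 2 * 16 ^ (n + 1) := by
            linarith [one_le_pow₀ (by norm_num : (1 : ℝ) ≤ 16) (n := n + 1)]
          have h2 : (4 : ℝ) ^ (n + 1) + 1 ≤ 2 * 4 ^ (n + 1) := by
            linarith [one_le_pow₀ (by norm_num : (1 : ℝ) ≤ 4) (n := n + 1)]
          -- The ratio is 64/(9/4)⁷ < 1/2; this is where the 14th moment is needed.
          have h3 : (16 * 4 * ((3 / 4 : ℝ) ^ 14 * 4 ^ 7)⁻¹) ^ n ≤ (1 / 2) ^ n := by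
            gcongr
            norm_num
          calc _ ≤ 2 * 16 ^ (n + 1) * (2 * 4 ^ (n + 1) *
                (C₁ * (6 * δ) ^ d * (128 * η ^ 14 * (((3 / 4 : ℝ) ^ 14 * 4 ^ 7) ^ n)⁻¹))) := by gcongr
            _ = C₃ * δ ^ d * (16 * 4 * ((3 / 4 : ℝ) ^ 14 * 4 ^ 7)⁻¹) ^ n := by
                rw [hC₃, mul_pow (16 * 4 : ℝ), inv_pow, mul_pow (16 : ℝ), mul_pow 6 δ, pow_succ, pow_succ]
                generalize (3 / 4 : ℝ) ^ 14 * 4 ^ 7 = q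
                clear_value η
                ring
            _ ≤ _ := by gcongr
  have hcorner : P (⋃ i ∈ Finset.range 2, ⋃ j ∈ Finset.range 2,
      {ω | u (gridPoint o h k 0 i j) ω ∈ Metric.closedBall z (6 * δ)}) ≤
      ENNReal.ofReal (4 * (C₂ * 6 ^ d) * δ ^ d) := by
    calc _ ≤ ∑ i ∈ Finset.range 2, ∑ j ∈ Finset.range 2,
          ENNReal.ofReal (C₂ * (6 * δ) ^ d) := by
          refine (measure_biUnion_finset_le _ _).trans (Finset.sum_le_sum fun i hi => ?_)
          refine (measure_biUnion_finset_le _ _).trans (Finset.sum_le_sum fun j hj => ?_)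
          refine hball hu _ (hsub (gridPoint_mem hh hk ?_ ?_)) z _ (by positivity)
          · exact Nat.lt_succ_iff.1 (Finset.mem_range.1 hi)
          · exact Nat.lt_succ_iff.1 (Finset.mem_range.1 hj)
      _ = ENNReal.ofReal (2 * (2 * (C₂ * (6 * δ) ^ d))) := by
          rw [sum_range_sum_range_ofReal]
          push_cast
          rfl
      _ = _ := by congr 1; rw [mul_pow]; ring
  -- The inclusion holds only on the paths that are continuous. The hitting event need not be
  -- measurable; monotonicity of the outer measure suffices.
  have hincl : {ω | ((fun p => u p ω) '' (Set.Icc o.1 (o.1 + h) ×ˢ Set.Icc o.2 (o.2 + k)) ∩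
      Metric.closedBall z δ).Nonempty} ≤ᵐ[P] ((⋃ i ∈ Finset.range 2, ⋃ j ∈ Finset.range 2,
      {ω | u (gridPoint o h k 0 i j) ω ∈ Metric.closedBall z (6 * δ)}) ∪
      ⋃ n, ⋃ i ∈ Finset.range (16 ^ (n + 1) + 1), ⋃ j ∈ Finset.range (4 ^ (n + 1) + 1), G n i j :
        Set Ω) := by
    filter_upwards [hu.continuous] with ω hω
    rintro ⟨_, ⟨p, hp, rfl⟩, hpz⟩
    rcases exists_of_mem_closedBall hδ (hω.mono hsub) hp hpz with ⟨i, j, hi, hj, h1⟩ |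
      ⟨n, i, j, hi, hj, h1⟩
    · left
      simp only [Set.mem_iUnion, Finset.mem_range]
      exact ⟨i, by omega, j, by omega, h1⟩
    · right
      simp only [Set.mem_iUnion, Finset.mem_range]
      exact ⟨n, i, by omega, j, by omega, h1⟩
  calc hitProb P u _ _ ≤ P (_ ∪ _) := measure_mono_ae hincl
    _ ≤ ENNReal.ofReal (4 * (C₂ * 6 ^ d) * δ ^ d) +
        ∑' n, ENNReal.ofReal (C₃ * δ ^ d * (1 / 2) ^ n) := by
        refine (measure_union_le _ _).trans (add_le_add hcorner ?_)
        exact (measure_iUnion_le _).trans (ENNReal.tsum_le_tsum hlevel)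
    _ = _ := by
        rw [← ENNReal.ofReal_tsum_of_nonneg (fun n => by positivity)
          (summable_geometric_two.mul_left _), tsum_mul_left, tsum_geometric_two,
          ← ENNReal.ofReal_add (by positivity) (by positivity)]
        congr 1; ring

lemma exists_lt_of_mem_Icc {n : ℕ} (hn : 0 < n) {x : ℝ} (hx : x ∈ Set.Icc (0 : ℝ) 1) :
    ∃ i < n, (i : ℝ) / n ≤ x ∧ x ≤ ((i : ℝ) + 1) / n := by
  have hn' : (0 : ℝ) < n := by exact_mod_cast hn
  have h1 : ⌈x * n⌉₊ ≤ n := Nat.ceil_le.2 (mul_le_of_le_one_left hn'.le hx.2)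
  refine ⟨⌈x * n⌉₊ - 1, by omega, ?_, ?_⟩
  · rw [div_le_iff₀ hn']
    rcases Nat.eq_zero_or_pos ⌈x * n⌉₊ with h | h
    · rw [h]; simpa using mul_nonneg hx.1 hn'.le
    · exact (Nat.lt_ceil.1 (by omega)).le
  · rw [le_div_iff₀ hn']
    refine (Nat.le_ceil _).trans ?_
    have : ⌈x * n⌉₊ ≤ ⌈x * n⌉₊ - 1 + 1 := by omega
    exact_mod_cast this

/-- Cut into n × m equal pieces of sides at most (ηδ)⁴ and (ηδ)². The summands 1 count the one piece
still needed when a side is short or degenerate, which is how fixed-time and fixed-place sections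
are included. -/
lemma exists_hitProb_rect_le (S : E d ≃L[ℝ] E d) (ht₀ : 0 < t₀) (T : ℝ) {M : ℝ} (hM : 0 < M) :
    ∃ C > 0,
    ∀ {Ω : Type u} [MeasurableSpace Ω] {P : Measure Ω} {u : ℝ × ℝ → Ω → E d},
      IsHeatField P t₀ T S u → ∀ a a' b b' : ℝ, a ≤ a' → b ≤ b' →
      Set.Icc a a' ×ˢ Set.Icc b b' ⊆ Set.Icc t₀ T ×ˢ Set.Icc (0 : ℝ) 1 →
      ∀ z : E d, ‖z‖ ≤ M → ∀ δ, 0 < δ → δ ≤ 1 →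
      hitProb P u (Set.Icc a a' ×ˢ Set.Icc b b') (Metric.closedBall z δ) ≤
        ENNReal.ofReal (C * ((1 + (a' - a) / δ ^ 4) * (1 + (b' - b) / δ ^ 2) * δ ^ d)) := by
  obtain ⟨η, hη, C, hC, hsmall⟩ := exists_hitProb_small_le.{u} S ht₀ T hM
  refine ⟨(1 + (η ^ 4)⁻¹) * (1 + (η ^ 2)⁻¹) * C, by positivity,
    fun {Ω} _ P u hu a a' b b' haa hbb hsub z hz δ hδ hδ1 => ?_⟩
  obtain ⟨l, hl, rfl⟩ : ∃ l, 0 ≤ l ∧ a' = a + l := ⟨a' - a, by linarith, by ring⟩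
  obtain ⟨w, hw, rfl⟩ : ∃ w, 0 ≤ w ∧ b' = b + w := ⟨b' - b, by linarith, by ring⟩
  have hpieces : ∀ (c l : ℝ), 0 < c → 0 ≤ l → ∃ n : ℕ, 0 < n ∧ l / n ≤ c ∧ (n : ℝ) ≤ 1 + l / c := by
    intro c l hc hl
    refine ⟨⌊l / c⌋₊ + 1, by omega, ?_, ?_⟩
    · rw [div_le_iff₀ (by positivity), ← div_le_iff₀' hc]
      exact_mod_cast (Nat.lt_floor_add_one _).le
    · push_cast
      linarith [Nat.floor_le (div_nonneg hl hc.le)]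
  obtain ⟨n, hn, hn1, hn2⟩ := hpieces ((η * δ) ^ 4) l (by positivity) hl
  obtain ⟨m, hm, hm1, hm2⟩ := hpieces ((η * δ) ^ 2) w (by positivity) hw
  have hn' : (0 : ℝ) < n := by exact_mod_cast hn
  have hm' : (0 : ℝ) < m := by exact_mod_cast hm
  have hcov : {ω | ((fun p => u p ω) '' (Set.Icc a (a + l) ×ˢ Set.Icc b (b + w)) ∩
      Metric.closedBall z δ).Nonempty} ⊆ ⋃ i ∈ Finset.range n, ⋃ j ∈ Finset.range m,
      {ω | ((fun p => u p ω) '' (Set.Icc (a + i / n * l) (a + i / n * l + l / n) ×ˢ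
        Set.Icc (b + j / m * w) (b + j / m * w + w / m)) ∩ Metric.closedBall z δ).Nonempty} := by
    rintro ω ⟨_, ⟨p, hp, rfl⟩, hpz⟩
    obtain ⟨θ, hθ, h1⟩ := exists_eq_add_mul_of_mem_Icc hp.1
    obtain ⟨φ, hφ, h2⟩ := exists_eq_add_mul_of_mem_Icc hp.2
    obtain ⟨i, hi, hi1, hi2⟩ := exists_lt_of_mem_Icc hn hθ
    obtain ⟨j, hj, hj1, hj2⟩ := exists_lt_of_mem_Icc hm hφ
    simp only [Set.mem_iUnion, Finset.mem_range]
    refine ⟨i, hi, j, hj, _, ⟨p, ⟨⟨?_, ?_⟩, ?_, ?_⟩, rfl⟩, hpz⟩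
    · rw [h1]; gcongr
    · rw [h1, add_assoc]; gcongr
      calc θ * l ≤ ((i : ℝ) + 1) / n * l := by gcongr
        _ = _ := by ring
    · rw [h2]; gcongr
    · rw [h2, add_assoc]; gcongr
      calc φ * w ≤ ((j : ℝ) + 1) / m * w := by gcongr
        _ = _ := by ring
  calc hitProb P u _ _ ≤ _ := measure_mono hcov
    _ ≤ ∑ i ∈ Finset.range n, ∑ j ∈ Finset.range m, ENNReal.ofReal (C * δ ^ d) := by
        refine (measure_biUnion_finset_le _ _).trans (Finset.sum_le_sum fun i hi => ?_)
        refine (measure_biUnion_finset_le _ _).trans (Finset.sum_le_sum fun j hj => ?_)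
        refine hsmall hu (a + i / n * l, b + j / m * w) (l / n) (w / m) δ hδ hδ1 (by positivity)
          (by positivity) hn1 hm1 (Set.Subset.trans (Set.prod_mono ?_ ?_) hsub) z hz
        · refine Set.Icc_subset_Icc (by simp only; linarith [show 0 ≤ (i : ℝ) / n * l by positivity]) ?_
          have h3 : ((i : ℝ) + 1) / n ≤ 1 := by
            rw [div_le_one hn']; exact_mod_cast Finset.mem_range.1 hi
          calc a + i / n * l + l / n = a + ((i : ℝ) + 1) / n * l := by ring
            _ ≤ a + 1 * l := by gcongr
            _ = _ := by ring
        · refine Set.Icc_subset_Icc (by simp only; linarith [show 0 ≤ (j : ℝ) / m * w by positivity]) ?_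
          have h3 : ((j : ℝ) + 1) / m ≤ 1 := by
            rw [div_le_one hm']; exact_mod_cast Finset.mem_range.1 hj
          calc b + j / m * w + w / m = b + ((j : ℝ) + 1) / m * w := by ring
            _ ≤ b + 1 * w := by gcongr
            _ = _ := by ring
    _ = ENNReal.ofReal (n * (m * (C * δ ^ d))) := by
        rw [sum_range_sum_range_ofReal]
    _ ≤ _ := by
        refine ENNReal.ofReal_le_ofReal ?_
        have h1 : (n : ℝ) ≤ (1 + (η ^ 4)⁻¹) * (1 + l / δ ^ 4) := by
          have : 0 ≤ (η ^ 4)⁻¹ + l / δ ^ 4 := by positivity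
          calc (n : ℝ) ≤ 1 + l / (η * δ) ^ 4 := hn2
            _ = 1 + (η ^ 4)⁻¹ * (l / δ ^ 4) := by rw [mul_pow]; field_simp
            _ ≤ _ := by linarith
        have h2 : (m : ℝ) ≤ (1 + (η ^ 2)⁻¹) * (1 + w / δ ^ 2) := by
          have : 0 ≤ (η ^ 2)⁻¹ + w / δ ^ 2 := by positivity
          calc (m : ℝ) ≤ 1 + w / (η * δ) ^ 2 := hm2
            _ = 1 + (η ^ 2)⁻¹ * (w / δ ^ 2) := by rw [mul_pow]; field_simp
            _ ≤ _ := by linarith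
        calc (n : ℝ) * (m * (C * δ ^ d)) ≤ ((1 + (η ^ 4)⁻¹) * (1 + l / δ ^ 4)) *
              (((1 + (η ^ 2)⁻¹) * (1 + w / δ ^ 2)) * (C * δ ^ d)) := by gcongr
          _ = _ := by rw [add_sub_cancel_left, add_sub_cancel_left]; ring

end

/-! ### Upper bounds by Hausdorff measures -/

/-- Sum the ball estimate over a cover; (2r)^β dominates r^β since β ≥ 0. Only covers by balls of
radius at most 1 are needed, because `hausdorff` is the supremum of the contents over all scales. -/
lemma measure_le_mul_hausdorff {X Ω : Type*} [MeasurableSpace Ω] {P : Measure Ω}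
    {ρ : X → X → ℝ} {β c : ℝ} (hc : 0 < c) {F : Set X} {V : Set Ω} {ev : X → Set Ω}
    (hV : V ⊆ ⋃ y ∈ F, ev y)
    (h : ∀ x r, 0 < r → r ≤ 1 → P (⋃ y ∈ {y ∈ F | ρ y x < r}, ev y) ≤ ENNReal.ofReal (c * r ^ β)) :
    P V ≤ ENNReal.ofReal c * hausdorff ρ β F := by
  have hc' : ENNReal.ofReal c ≠ 0 := by simpa using hc
  unfold hausdorff
  split_ifs with hβ
  · rw [ENNReal.mul_top hc']; exact le_top
  push Not at hβ
  have h1 : (ENNReal.ofReal c)⁻¹ * P V ≤ ballContent ρ β 1 F := by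
    refine le_iInf fun I => le_iInf fun x => le_iInf fun r => le_iInf fun hr => le_iInf fun hF => ?_
    rw [← ENNReal.div_eq_inv_mul]
    refine ENNReal.div_le_of_le_mul' ?_
    have h2 : V ⊆ ⋃ i : I, ⋃ y ∈ {y ∈ F | ρ y (x i) < r i}, ev y := by
      intro ω hω
      obtain ⟨y, hy, hyω⟩ := Set.mem_iUnion₂.1 (hV hω)
      obtain ⟨i, hi, hyi⟩ := Set.mem_iUnion₂.1 (hF hy)
      exact Set.mem_iUnion.2 ⟨⟨i, hi⟩, Set.mem_iUnion₂.2 ⟨y, ⟨hy, hyi⟩, hyω⟩⟩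
    calc P V ≤ ∑' i : I, P (⋃ y ∈ {y ∈ F | ρ y (x i) < r i}, ev y) :=
          (measure_mono h2).trans (measure_iUnion_le _)
      _ ≤ ∑' i : I, ENNReal.ofReal c * ENNReal.ofReal (2 * r i) ^ β := by
          refine ENNReal.tsum_le_tsum fun i => ?_
          obtain ⟨hr0, hr1⟩ := hr i i.2
          refine (h _ _ hr0 hr1).trans ?_
          rw [ENNReal.ofReal_rpow_of_pos (by positivity), ← ENNReal.ofReal_mul hc.le]
          refine ENNReal.ofReal_le_ofReal ?_
          gcongr
          linarith
      _ = _ := ENNReal.tsum_mul_left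
  calc P V = ENNReal.ofReal c * ((ENNReal.ofReal c)⁻¹ * P V) := by
        rw [← mul_assoc, ENNReal.mul_inv_cancel hc' ENNReal.ofReal_ne_top, one_mul]
    _ ≤ _ := by
        gcongr
        exact h1.trans (le_iSup₂_of_le 1 one_pos le_rfl)

section

variable {d : ℕ} {t₀ : ℝ}

/-- The enclosing box may stick out of the parameter rectangle, as boxes around covering balls do;
the rectangle bound is applied to the intersection. -/
lemma exists_hitProb_le (S : E d ≃L[ℝ] E d) (ht₀ : 0 < t₀) (T : ℝ) {M : ℝ} (hM : 0 < M) :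
    ∃ C > 0,
    ∀ {Ω : Type u} [MeasurableSpace Ω] {P : Measure Ω} {u : ℝ × ℝ → Ω → E d},
      IsHeatField P t₀ T S u → ∀ (R : Set (ℝ × ℝ)) (a b l w : ℝ), 0 ≤ l → 0 ≤ w →
      R ⊆ Set.Icc t₀ T ×ˢ Set.Icc (0 : ℝ) 1 → R ⊆ Set.Icc a (a + l) ×ˢ Set.Icc b (b + w) →
      ∀ z : E d, ‖z‖ ≤ M → ∀ δ, 0 < δ → δ ≤ 1 →
      hitProb P u R (Metric.closedBall z δ) ≤
        ENNReal.ofReal (C * ((1 + l / δ ^ 4) * (1 + w / δ ^ 2) * δ ^ d)) := by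
  obtain ⟨C, hC, hrect⟩ := exists_hitProb_rect_le.{u} S ht₀ T hM
  refine ⟨C, hC, fun {Ω} _ P u hu R a b l w hl hw hR hR' z hz δ hδ hδ1 => ?_⟩
  rcases R.eq_empty_or_nonempty with rfl | ⟨p, hp⟩
  · simp [hitProb]
  have hsub : R ⊆ Set.Icc (max a t₀) (min (a + l) T) ×ˢ Set.Icc (max b 0) (min (b + w) 1) := by
    intro q hq
    have h1 := hR hq
    have h2 := hR' hq
    exact ⟨⟨max_le h2.1.1 h1.1.1, le_min h2.1.2 h1.1.2⟩, max_le h2.2.1 h1.2.1,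
      le_min h2.2.2 h1.2.2⟩
  have hp' := hsub hp
  have h1 : max a t₀ ≤ min (a + l) T := hp'.1.1.trans hp'.1.2
  have h2 : max b 0 ≤ min (b + w) 1 := hp'.2.1.trans hp'.2.2
  have h3 : min (a + l) T - max a t₀ ≤ l := by
    linarith [min_le_left (a + l) T, le_max_left a t₀]
  have h4 : min (b + w) 1 - max b 0 ≤ w := by
    linarith [min_le_left (b + w) 1, le_max_left b 0]
  calc hitProb P u R (Metric.closedBall z δ) ≤ hitProb P u _ (Metric.closedBall z δ) :=
        measure_mono fun ω hω => hω.mono (Set.inter_subset_inter_left _ (Set.image_mono hsub))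
    _ ≤ _ := hrect hu _ _ _ _ h1 h2 (Set.prod_mono
        (Set.Icc_subset_Icc (le_max_right _ _) (min_le_right _ _))
        (Set.Icc_subset_Icc (le_max_right _ _) (min_le_right _ _))) z hz δ hδ hδ1
    _ ≤ _ := by
        refine ENNReal.ofReal_le_ofReal ?_
        have := sub_nonneg.2 h2
        gcongr

lemma one_add_div_pow_le {x L : ℝ} (hx : 0 < x) (hx1 : x ≤ 1) (n : ℕ) :
    1 + L / x ^ n ≤ (1 + L) / x ^ n := by
  rw [add_div]
  gcongr
  rw [le_div_iff₀ (by positivity), one_mul]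
  exact pow_le_one₀ hx.le hx1

lemma rpow_natCast_sub_natCast {x : ℝ} (hx : 0 < x) (d n : ℕ) :
    x ^ ((d : ℝ) - n) = x ^ d / x ^ n := by
  rw [Real.rpow_sub hx, Real.rpow_natCast, Real.rpow_natCast]

/-- Applied at radius 2ε ≥ 2^{-n}, for which the dyadic rectangle has sides at most (2ε)⁴ and (2ε)².
For 2ε > 1 the trivial bound by (2ε)^d is enough. -/
lemma exists_smallBall (S : E d ≃L[ℝ] E d) (ht₀ : 0 < t₀) (T : ℝ) {M : ℝ} (hM : 0 < M) :
    ∃ c > 0,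
    ∀ {Ω : Type u} [MeasurableSpace Ω] {P : Measure Ω} [IsProbabilityMeasure P]
      {u : ℝ × ℝ → Ω → E d}, IsHeatField P t₀ T S u →
      ∀ c' ≥ c, SmallBall P u (Set.Icc t₀ T) (Set.Icc 0 1) d M c' := by
  obtain ⟨C, hC, hhit⟩ := exists_hitProb_le.{u} S ht₀ T (M := M * √d + 1) (by positivity)
  refine ⟨2 ^ d * (4 * C + 1), by positivity,
    fun {Ω} _ P _ u hu c' hc' z hz n hn ε hε k l hR => ?_⟩
  have hε0 : 0 < ε := lt_trans (by positivity) hε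
  refine le_trans ?_ (ENNReal.ofReal_le_ofReal (mul_le_mul_of_nonneg_right hc' (by positivity)))
  rw [Real.rpow_natCast]
  rcases le_or_gt (2 * ε) 1 with h1 | h1
  · have h2 : (1 / 2 : ℝ) ^ n ≤ 2 * ε := by rw [pow_succ] at hε; linarith
    have h3 : 1 / (2 : ℝ) ^ (4 * n) ≤ (2 * ε) ^ 4 := by
      calc 1 / (2 : ℝ) ^ (4 * n) = ((1 / 2 : ℝ) ^ n) ^ 4 := by
            rw [← pow_mul, mul_comm n 4, one_div_pow]
        _ ≤ _ := by gcongr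
    have h4 : 1 / (2 : ℝ) ^ (2 * n) ≤ (2 * ε) ^ 2 := by
      calc 1 / (2 : ℝ) ^ (2 * n) = ((1 / 2 : ℝ) ^ n) ^ 2 := by
            rw [← pow_mul, mul_comm n 2, one_div_pow]
        _ ≤ _ := by gcongr
    have hz' := norm_le_of_mem_cube hM.le hz
    calc hitProb P u (dyadicRect n k l) (Metric.ball z ε)
        ≤ hitProb P u (dyadicRect n k l) (Metric.closedBall z (2 * ε)) :=
          measure_mono fun ω hω => hω.mono (Set.inter_subset_inter_right _
            (Metric.ball_subset_closedBall.trans (Metric.closedBall_subset_closedBall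
              (by linarith))))
      _ ≤ _ := hhit hu _ ((k : ℝ) / 2 ^ (4 * n)) ((l : ℝ) / 2 ^ (2 * n)) (1 / 2 ^ (4 * n))
          (1 / 2 ^ (2 * n)) (by positivity) (by positivity) hR
          (by rw [dyadicRect, ← add_div, ← add_div]) z (by linarith) (2 * ε) (by positivity) h1
      _ ≤ _ := by
          refine ENNReal.ofReal_le_ofReal ?_
          have h5 : 1 / (2 : ℝ) ^ (4 * n) / (2 * ε) ^ 4 ≤ 1 := div_le_one_of_le₀ h3 (by positivity)
          have h6 : 1 / (2 : ℝ) ^ (2 * n) / (2 * ε) ^ 2 ≤ 1 := div_le_one_of_le₀ h4 (by positivity)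
          calc _ ≤ C * ((1 + 1) * (1 + 1) * (2 * ε) ^ d) := by gcongr
            _ = 2 ^ d * (4 * C) * ε ^ d := by rw [mul_pow]; ring
            _ ≤ _ := by gcongr; linarith
  · refine (prob_le_one).trans ?_
    rw [← ENNReal.ofReal_one]
    refine ENNReal.ofReal_le_ofReal ?_
    calc (1 : ℝ) ≤ (2 * ε) ^ d := one_le_pow₀ h1.le
      _ = 2 ^ d * 1 * ε ^ d := by rw [mul_pow]; ring
      _ ≤ _ := by gcongr; linarith

/-- The passage from closed balls to Hausdorff measures. -/
lemma hitProb_le_hausdorff {Ω : Type*} [MeasurableSpace Ω] {P : Measure Ω}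
    {u : ℝ × ℝ → Ω → E d} {R : Set (ℝ × ℝ)} {M c β : ℝ} (hM : 0 < M) (hc : 0 < c)
    (h : ∀ z : E d, ‖z‖ ≤ M * √d + 1 → ∀ δ, 0 < δ → δ ≤ 1 →
      hitProb P u R (Metric.closedBall z δ) ≤ ENNReal.ofReal (c * δ ^ β))
    {K : Set (E d)} (hK : K ⊆ cube d M) :
    hitProb P u R K ≤ ENNReal.ofReal c * hausdorff dist β K := by
  refine measure_le_mul_hausdorff (ev := fun y => {ω | ∃ p ∈ R, u p ω = y}) hc ?_ ?_
  · rintro ω ⟨_, ⟨p, hp, rfl⟩, hpK⟩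
    exact Set.mem_iUnion₂.2 ⟨_, hpK, p, hp, rfl⟩
  · intro x r hr hr1
    -- A covering ball may be centred outside the cube; if it meets K, its centre has norm at most
    -- M√d + 1.
    rcases {y ∈ K | dist y x < r}.eq_empty_or_nonempty with he | ⟨y, hyK, hy⟩
    · rw [he]; simp
    have hx : ‖x‖ ≤ M * √d + 1 := by
      have h1 := norm_le_of_mem_cube hM.le (hK hyK)
      have h2 := norm_le_norm_add_norm_sub' x y
      rw [dist_comm, dist_eq_norm] at hy
      linarith
    refine le_trans (measure_mono ?_) (h x hx r hr hr1)
    intro ω hω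
    obtain ⟨y, ⟨-, hy⟩, p, hp, rfl⟩ := Set.mem_iUnion₂.1 hω
    exact ⟨_, ⟨p, hp, rfl⟩, hy.le⟩

/-- A full time interval costs δ⁻⁴ and a full space interval δ⁻², whence the exponents d - 6, d - 2,
d - 4; a fixed coordinate is a side of length 0. -/
lemma exists_hitUpperBounds (S : E d ≃L[ℝ] E d) (ht₀ : 0 < t₀) {T : ℝ} (hT : t₀ < T) {M : ℝ}
    (hM : 0 < M) : ∃ c > 0,
    ∀ {Ω : Type u} [MeasurableSpace Ω] {P : Measure Ω} {u : ℝ × ℝ → Ω → E d},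
      IsHeatField P t₀ T S u →
      ∀ c' ≥ c, HitUpperBounds P u (Set.Icc t₀ T) (Set.Icc 0 1) d M c' := by
  obtain ⟨C, hC, hhit⟩ := exists_hitProb_le.{u} S ht₀ T (M := M * √d + 1) (by positivity)
  set L := T - t₀ with hL
  have hL0 : 0 < L := sub_pos.2 hT
  have hTL : T = t₀ + L := by rw [hL]; ring
  refine ⟨C * ((1 + L) * (1 + 1)), by positivity, fun {Ω} _ P u hu c' hc' => ⟨?_, ?_, ?_⟩⟩
  · intro K hK _
    refine hitProb_le_hausdorff hM (lt_of_lt_of_le (by positivity) hc') (fun z hz δ hδ hδ1 => ?_) hK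
    refine (hhit hu _ t₀ 0 L 1 hL0.le zero_le_one le_rfl (by rw [← hTL, zero_add]) z hz δ hδ
      hδ1).trans (ENNReal.ofReal_le_ofReal ?_)
    have h1 := one_add_div_pow_le (L := L) hδ hδ1 4
    have h2 := one_add_div_pow_le (L := 1) hδ hδ1 2
    have h3 := rpow_natCast_sub_natCast hδ d 6
    push_cast at h3
    rw [h3]
    calc C * ((1 + L / δ ^ 4) * (1 + 1 / δ ^ 2) * δ ^ d)
        ≤ C * (((1 + L) / δ ^ 4) * ((1 + 1) / δ ^ 2) * δ ^ d) := by gcongr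
      _ = C * ((1 + L) * (1 + 1)) * (δ ^ d / δ ^ 6) := by field_simp
      _ ≤ _ := by gcongr
  · intro t ht K hK _
    refine hitProb_le_hausdorff hM (lt_of_lt_of_le (by positivity) hc') (fun z hz δ hδ hδ1 => ?_) hK
    refine (hhit hu _ t 0 0 1 le_rfl zero_le_one
      (Set.prod_mono (Set.singleton_subset_iff.2 ht) le_rfl) (by simp) z hz δ hδ
      hδ1).trans (ENNReal.ofReal_le_ofReal ?_)
    have h2 := one_add_div_pow_le (L := 1) hδ hδ1 2
    have h3 := rpow_natCast_sub_natCast hδ d 2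
    push_cast at h3
    rw [h3]
    calc C * ((1 + 0 / δ ^ 4) * (1 + 1 / δ ^ 2) * δ ^ d)
        ≤ C * ((1 + 0 / δ ^ 4) * ((1 + 1) / δ ^ 2) * δ ^ d) := by gcongr
      _ = C * (1 * (1 + 1)) * (δ ^ d / δ ^ 2) := by rw [zero_div, add_zero]; field_simp
      _ ≤ C * ((1 + L) * (1 + 1)) * (δ ^ d / δ ^ 2) := by gcongr; linarith
      _ ≤ _ := by gcongr
  · intro x hx K hK _
    refine hitProb_le_hausdorff hM (lt_of_lt_of_le (by positivity) hc') (fun z hz δ hδ hδ1 => ?_) hK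
    refine (hhit hu _ t₀ x L 0 hL0.le le_rfl
      (Set.prod_mono le_rfl (Set.singleton_subset_iff.2 hx)) (by simp [← hTL]) z hz δ hδ
      hδ1).trans (ENNReal.ofReal_le_ofReal ?_)
    have h1 := one_add_div_pow_le (L := L) hδ hδ1 4
    have h3 := rpow_natCast_sub_natCast hδ d 4
    push_cast at h3
    rw [h3]
    calc C * ((1 + L / δ ^ 4) * (1 + 0 / δ ^ 2) * δ ^ d)
        ≤ C * (((1 + L) / δ ^ 4) * (1 + 0 / δ ^ 2) * δ ^ d) := by gcongr
      _ = C * ((1 + L) * 1) * (δ ^ d / δ ^ 4) := by rw [zero_div, add_zero]; field_simp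
      _ ≤ C * ((1 + L) * (1 + 1)) * (δ ^ d / δ ^ 4) := by gcongr; linarith
      _ ≤ _ := by gcongr

lemma mem_Icc_of_abs_lt {x y r : ℝ} (h : |x - y| < r) : x ∈ Set.Icc (y - r) (y - r + 2 * r) := by
  rw [abs_lt] at h
  constructor <;> linarith

/-- The passage from hitting probabilities of points to Hausdorff measures of parameter sets. -/
lemma measure_level_le {X Ω : Type*} [MeasurableSpace Ω] {P : Measure Ω}
    {u : ℝ × ℝ → Ω → E d} {ρ : X → X → ℝ} {c β : ℝ} {z : E d} {F : Set X} {V : Set Ω}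
    {D : X → Set (ℝ × ℝ)} (hc : 0 < c) (hV : ∀ ω ∈ V, ∃ y ∈ F, ∃ p ∈ D y, u p ω = z)
    {g : ℝ → ℝ} (hg : ∀ r, 0 < r → 0 < g r)
    (h : ∀ x r, 0 < r → r ≤ 1 →
      hitProb P u (⋃ y ∈ {y ∈ F | ρ y x < r}, D y) (Metric.closedBall z (g r)) ≤
        ENNReal.ofReal (c * r ^ β)) :
    P V ≤ ENNReal.ofReal c * hausdorff ρ β F := by
  refine measure_le_mul_hausdorff (ev := fun y => {ω | ∃ p ∈ D y, u p ω = z}) hc ?_ ?_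
  · intro ω hω
    obtain ⟨y, hy, h1⟩ := hV ω hω
    exact Set.mem_iUnion₂.2 ⟨y, hy, h1⟩
  · intro x r hr hr1
    refine le_trans (measure_mono ?_) (h x r hr hr1)
    intro ω hω
    obtain ⟨y, hy, p, hp, h1⟩ := Set.mem_iUnion₂.1 hω
    exact ⟨z, ⟨p, Set.mem_iUnion₂.2 ⟨y, hy, hp⟩, h1⟩,
      Metric.mem_closedBall_self (hg r hr).le⟩

/-- The radius δ in the state space is matched to the size r of the piece of parameter set: δ = √r
for parabolic balls and space intervals, δ = r^{1/4} for time intervals. The matched sides then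
contribute only constants. -/
lemma exists_levelUpperBounds (S : E d ≃L[ℝ] E d) (ht₀ : 0 < t₀) {T : ℝ} (hT : t₀ < T) {M : ℝ}
    (hM : 0 < M) : ∃ c > 0,
    ∀ {Ω : Type u} [MeasurableSpace Ω] {P : Measure Ω} {u : ℝ × ℝ → Ω → E d},
      IsHeatField P t₀ T S u →
      ∀ c' ≥ c, LevelUpperBounds P u (Set.Icc t₀ T) (Set.Icc 0 1) d M c' := by
  obtain ⟨C, hC, hhit⟩ := exists_hitProb_le.{u} S ht₀ T (M := M * √d + 1) (by positivity)
  set L := T - t₀ with hL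
  have hL0 : 0 < L := sub_pos.2 hT
  have hTL : T = t₀ + L := by rw [hL]; ring
  have hcube : ∀ z ∈ cube d M, ‖z‖ ≤ M * √d + 1 := fun z hz => by
    linarith [norm_le_of_mem_cube hM.le hz]
  have hs : ∀ r : ℝ, 0 < r → 0 < √r := fun r => Real.sqrt_pos.2
  have hs1 : ∀ r : ℝ, r ≤ 1 → √r ≤ 1 := fun r hr => by
    simpa using Real.sqrt_le_sqrt hr
  have hs2 : ∀ r : ℝ, 0 < r → √r ^ 2 = r := fun r hr => Real.sq_sqrt hr.le
  have hs4 : ∀ r : ℝ, 0 < r → √r ^ 4 = r ^ 2 := fun r hr => by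
    rw [show 4 = 2 * 2 from rfl, pow_mul, hs2 r hr]
  have hss4 : ∀ r : ℝ, 0 < r → √(√r) ^ 4 = r := fun r hr => by rw [hs4 _ (hs r hr), hs2 r hr]
  have hsd : ∀ r : ℝ, 0 < r → r ^ ((d : ℝ) / 2) = √r ^ d := fun r hr =>
    rpow_natCast_div_two hr.le d
  have hssd : ∀ r : ℝ, 0 < r → r ^ ((d : ℝ) / 4) = √(√r) ^ d := fun r hr => by
    rw [← hsd _ (hs r hr), Real.sqrt_eq_rpow, ← Real.rpow_mul hr.le]
    congr 1; ring
  -- A ball of radius r has sides of twice the matched length, giving a factor 1 + 2 per coordinate;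
  -- 9 is the case of both coordinates, and 1 + L bounds the cost of a full time interval.
  set c := C * (9 * (1 + L)) with hcdef
  have hc0 : 0 < c := by positivity
  refine ⟨c, hc0, fun {Ω} _ P u hu c' hc' => ?_⟩
  have hc'0 : 0 < c' := hc0.trans_le hc'
  have hfin : ∀ x k : ℝ, 0 ≤ x → k ≤ 9 * (1 + L) → C * (k * x) ≤ c' * x := fun x k hx hk => by
    calc C * (k * x) ≤ C * (9 * (1 + L) * x) := by gcongr
      _ = c * x := by rw [hcdef]; ring
      _ ≤ _ := by gcongr
  refine ⟨?_, ?_, ?_, ?_, ?_⟩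
  · intro z hz H hH _
    refine measure_level_le (D := fun p => {p}) (u := u) (z := z) (g := fun r => √r) hc'0 ?_ hs ?_
    · rintro ω ⟨p, ⟨-, h1⟩, hpH⟩
      exact ⟨p, hpH, p, rfl, h1⟩
    · intro x r hr hr1
      refine (hhit hu _ (x.1 - r ^ 2) (x.2 - r) (2 * r ^ 2) (2 * r) (by positivity) (by positivity)
        ?_ ?_ z (hcube z hz) _ (hs r hr) (hs1 r hr1)).trans (ENNReal.ofReal_le_ofReal ?_)
      · simp only [Set.iUnion_subset_iff, Set.singleton_subset_iff]
        exact fun p hp => hH hp.1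
      · simp only [Set.iUnion_subset_iff, Set.singleton_subset_iff]
        rintro p ⟨-, hp⟩
        rw [parabolicDist] at hp
        have h1 : √|p.1 - x.1| < r := by linarith [abs_nonneg (p.2 - x.2)]
        have h2 : |p.2 - x.2| < r := by linarith [Real.sqrt_nonneg |p.1 - x.1|]
        exact ⟨mem_Icc_of_abs_lt ((Real.sqrt_lt' hr).1 h1), mem_Icc_of_abs_lt h2⟩
      · rw [hs4 r hr, hs2 r hr, mul_div_cancel_right₀ _ (by positivity),
          mul_div_cancel_right₀ _ hr.ne', hsd r hr]
        exact hfin _ _ (by positivity) (by nlinarith)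
  · intro z hz F hF _
    refine measure_level_le (D := fun t => {t} ×ˢ Set.Icc 0 1) (u := u) (z := z)
      (g := fun r => √(√r)) hc'0 ?_ (fun r hr => hs _ (hs r hr)) ?_
    · rintro ω ⟨t, ⟨ht, x, hx, h1⟩, htF⟩
      exact ⟨t, htF, (t, x), ⟨rfl, hx⟩, h1⟩
    · intro s r hr hr1
      have hr2 := hs _ (hs r hr)
      have hr3 := hs1 _ (hs1 r hr1)
      refine (hhit hu _ (s - r) 0 (2 * r) 1 (by positivity) zero_le_one
        ?_ ?_ z (hcube z hz) _ hr2 hr3).trans (ENNReal.ofReal_le_ofReal ?_)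
      · simp only [Set.iUnion_subset_iff]
        rintro t ⟨ht, -⟩
        exact Set.prod_mono (Set.singleton_subset_iff.2 (hF ht)) le_rfl
      · simp only [Set.iUnion_subset_iff]
        rintro t ⟨-, ht⟩
        exact Set.prod_mono (Set.singleton_subset_iff.2 (mem_Icc_of_abs_lt ht)) (by rw [zero_add])
      · have e : r ^ (((d : ℝ) - 2) / 4) = √(√r) ^ d / √(√r) ^ 2 := by
          rw [sub_div, Real.rpow_sub hr, hssd r hr, hs2 _ (hs r hr), Real.sqrt_eq_rpow r]
          norm_num
        rw [hss4 r hr, mul_div_cancel_right₀ _ hr.ne', e]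
        calc _ ≤ C * ((1 + 2) * ((1 + 1) / √(√r) ^ 2) * √(√r) ^ d) := by
              gcongr; exact one_add_div_pow_le hr2 hr3 2
          _ = C * (6 * (√(√r) ^ d / √(√r) ^ 2)) := by ring
          _ ≤ _ := hfin _ _ (by positivity) (by linarith)
  · intro z hz G hG _
    refine measure_level_le (D := fun x => Set.Icc t₀ T ×ˢ {x}) (u := u) (z := z)
      (g := fun r => √r) hc'0 ?_ hs ?_
    · rintro ω ⟨x, ⟨hx, t, ht, h1⟩, hxG⟩
      exact ⟨x, hxG, (t, x), ⟨ht, rfl⟩, h1⟩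
    · intro y r hr hr1
      have hr2 := hs r hr
      have hr3 := hs1 r hr1
      refine (hhit hu _ t₀ (y - r) L (2 * r) hL0.le (by positivity)
        ?_ ?_ z (hcube z hz) _ hr2 hr3).trans (ENNReal.ofReal_le_ofReal ?_)
      · simp only [Set.iUnion_subset_iff]
        rintro x ⟨hx, -⟩
        exact Set.prod_mono le_rfl (Set.singleton_subset_iff.2 (hG hx))
      · simp only [Set.iUnion_subset_iff]
        rintro x ⟨-, hx⟩
        exact Set.prod_mono (by rw [← hTL]) (Set.singleton_subset_iff.2 (mem_Icc_of_abs_lt hx))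
      · have e : r ^ (((d : ℝ) - 4) / 2) = √r ^ d / √r ^ 4 := by
          rw [sub_div, Real.rpow_sub hr, hsd r hr, hs4 r hr]
          norm_num
        rw [hs2 r hr, mul_div_cancel_right₀ _ hr.ne', e]
        calc _ ≤ C * ((1 + L) / √r ^ 4 * (1 + 2) * √r ^ d) := by
              gcongr; exact one_add_div_pow_le hr2 hr3 4
          _ = C * (3 * (1 + L) * (√r ^ d / √r ^ 4)) := by ring
          _ ≤ _ := hfin _ _ (by positivity) (by linarith)
  · intro z hz F hF _ x hx
    refine measure_level_le (D := fun t => {(t, x)}) (u := u) (z := z)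
      (g := fun r => √(√r)) hc'0 ?_ (fun r hr => hs _ (hs r hr)) ?_
    · rintro ω ⟨t, ⟨ht, h1⟩, htF⟩
      exact ⟨t, htF, (t, x), rfl, h1⟩
    · intro s r hr hr1
      refine (hhit hu _ (s - r) x (2 * r) 0 (by positivity) le_rfl
        ?_ ?_ z (hcube z hz) _ (hs _ (hs r hr)) (hs1 _ (hs1 r hr1))).trans
          (ENNReal.ofReal_le_ofReal ?_)
      · simp only [Set.iUnion_subset_iff, Set.singleton_subset_iff]
        exact fun t ht => ⟨hF ht.1, hx⟩
      · simp only [Set.iUnion_subset_iff, Set.singleton_subset_iff]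
        exact fun t ht => ⟨mem_Icc_of_abs_lt ht.2, by simp⟩
      · rw [hss4 r hr, mul_div_cancel_right₀ _ hr.ne', hssd r hr, zero_div]
        exact hfin _ _ (by positivity) (by linarith)
  · intro z hz G hG _ t ht
    refine measure_level_le (D := fun x => {(t, x)}) (u := u) (z := z)
      (g := fun r => √r) hc'0 ?_ hs ?_
    · rintro ω ⟨x, ⟨hx, h1⟩, hxG⟩
      exact ⟨x, hxG, (t, x), rfl, h1⟩
    · intro y r hr hr1
      refine (hhit hu _ t (y - r) 0 (2 * r) le_rfl (by positivity)
        ?_ ?_ z (hcube z hz) _ (hs r hr) (hs1 r hr1)).trans (ENNReal.ofReal_le_ofReal ?_)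
      · simp only [Set.iUnion_subset_iff, Set.singleton_subset_iff]
        exact fun x hx => ⟨ht, hG hx.1⟩
      · simp only [Set.iUnion_subset_iff, Set.singleton_subset_iff]
        exact fun x hx => ⟨by simp, mem_Icc_of_abs_lt hx.2⟩
      · rw [hs2 r hr, mul_div_cancel_right₀ _ hr.ne', hsd r hr, zero_div]
        exact hfin _ _ (by positivity) (by linarith)

end

/-! ### The second moment method -/

lemma exists_pow_mul_exp_le (d : ℕ) {c : ℝ} (hc : 0 < c) :
    ∃ B > 0, ∀ s : ℝ, 0 ≤ s → s ^ d * Real.exp (-(s ^ 2 / c)) ≤ B := by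
  refine ⟨1 + d.factorial * c ^ d, by positivity, fun s hs => ?_⟩
  have h1 := Real.pow_div_factorial_le_exp (s ^ 2 / c) (by positivity) d
  have hf : (0 : ℝ) < d.factorial := by exact_mod_cast d.factorial_pos
  have h2 : s ^ (2 * d) ≤ d.factorial * c ^ d * Real.exp (s ^ 2 / c) := by
    rw [div_le_iff₀ hf, div_pow, div_le_iff₀ (by positivity), ← pow_mul] at h1
    linarith
  have h3 : s ^ d ≤ 1 + s ^ (2 * d) := by
    rw [mul_comm 2 d, pow_mul]
    nlinarith [sq_nonneg (s ^ d - 1)]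
  rw [Real.exp_neg, ← div_eq_mul_inv, div_le_iff₀ (Real.exp_pos _)]
  have h4 := Real.one_le_exp (show 0 ≤ s ^ 2 / c by positivity)
  linarith

/-- The kernel of the energy on pairs (parameter, level). -/
noncomputable def jointKernel {d : ℕ} (ζ ξ : (ℝ × ℝ) × E d) : ℝ≥0∞ :=
  (ENNReal.ofReal (max (√(parabolicDist ζ.1 ξ.1)) ‖ζ.2 - ξ.2‖))⁻¹ ^ d

lemma continuous_parabolicDist : Continuous fun x : (ℝ × ℝ) × (ℝ × ℝ) => parabolicDist x.1 x.2 := by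
  unfold parabolicDist
  fun_prop

lemma measurable_jointKernel {d : ℕ} :
    Measurable fun x : ((ℝ × ℝ) × E d) × ((ℝ × ℝ) × E d) => jointKernel x.1 x.2 := by
  have h : Continuous fun x : ((ℝ × ℝ) × E d) × ((ℝ × ℝ) × E d) =>
      max (√(parabolicDist x.1.1 x.2.1)) ‖x.1.2 - x.2.2‖ := by
    have h1 : Continuous fun x : ((ℝ × ℝ) × E d) × ((ℝ × ℝ) × E d) =>
        parabolicDist x.1.1 x.2.1 :=
      continuous_parabolicDist.comp (by fun_prop : Continuous fun x :
        ((ℝ × ℝ) × E d) × ((ℝ × ℝ) × E d) => (x.1.1, x.2.1))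
    fun_prop
  exact (h.measurable.ennreal_ofReal.inv).pow_const d

lemma inv_ofReal_pow {m : ℝ} (hm : 0 < m) (d : ℕ) :
    (ENNReal.ofReal m)⁻¹ ^ d = ENNReal.ofReal (m⁻¹ ^ d) := by
  rw [← ENNReal.ofReal_inv_of_pos hm, ENNReal.ofReal_pow (by positivity)]

section

variable {d : ℕ} {t₀ : ℝ}

lemma exists_prob_pair_le_of_dens (S : E d ≃L[ℝ] E d) (ht₀ : 0 < t₀) (T : ℝ) {M : ℝ} :
    ∃ C > 0, ∀ {Ω : Type u} [MeasurableSpace Ω] {P : Measure Ω} {u : ℝ × ℝ → Ω → E d},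
      IsHeatField P t₀ T S u → ∀ p ∈ Set.Icc t₀ T ×ˢ Set.Icc (0 : ℝ) 1,
      ∀ q ∈ Set.Icc t₀ T ×ˢ Set.Icc (0 : ℝ) 1, p ≠ q → ∀ z ∈ cube d M, ∀ w ∈ cube d M,
      ∀ ε, 0 < ε → ε ≤ 1 → ∀ D : ℝ, (∀ z' ∈ Metric.ball z ε, ∀ w' ∈ Metric.ball w ε,
        dens₂ S p q (z', w') ≤ D) →
      P {ω | u p ω ∈ Metric.ball z ε ∧ u q ω ∈ Metric.ball w ε} ≤
        ENNReal.ofReal (C * D * (ε ^ d) ^ 2) := by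
  obtain ⟨κ, hκ, hvol⟩ := exists_volume_ball d
  refine ⟨κ ^ 2, by positivity, fun {Ω} _ P u hu p hp q hq hpq z hz w hw ε hε hε1 D hD => ?_⟩
  have hden := hu.hasContinuousDensity_pair ht₀ hp hq (condVar_pos ht₀ hp hq hpq)
  have hset : MeasurableSet (Metric.ball z ε ×ˢ Metric.ball w ε) :=
    measurableSet_ball.prod measurableSet_ball
  have h1 : P {ω | u p ω ∈ Metric.ball z ε ∧ u q ω ∈ Metric.ball w ε} =
      P.map (fun ω => (u p ω, u q ω)) (Metric.ball z ε ×ˢ Metric.ball w ε) :=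
    (Measure.map_apply_of_aemeasurable hden.aemeasurable hset).symm
  rw [h1, hden.map_eq, withDensity_apply _ hset]
  have hD0 : 0 ≤ D := (hden.nonneg (z, w)).trans
    (hD z (Metric.mem_ball_self hε) w (Metric.mem_ball_self hε))
  calc _ ≤ ∫⁻ _y in Metric.ball z ε ×ˢ Metric.ball w ε, ENNReal.ofReal D :=
        setLIntegral_mono' hset fun y hy => ENNReal.ofReal_le_ofReal (hD y.1 hy.1 y.2 hy.2)
    _ = _ := by
        rw [setLIntegral_const, Measure.volume_eq_prod, Measure.prod_prod, (hvol z ε hε).1,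
          (hvol w ε hε).1, ← ENNReal.ofReal_mul (by positivity), ← ENNReal.ofReal_mul hD0]
        congr 1; ring

/-- If √Δ dominates, the prefactor of A2 suffices. If ‖z - w‖ dominates and is at least 4ε, the
Gaussian factor converts Δ^{-d/2} into ‖z - w‖^{-d}. If ‖z - w‖ < 4ε, the one-point bound ε^d is at
most ε^{2d}(4/‖z - w‖)^d. -/
lemma exists_prob_pair_le (hd : 0 < d) (S : E d ≃L[ℝ] E d) (ht₀ : 0 < t₀) (T : ℝ) {M : ℝ}
    (hM : 0 < M) :
    ∃ C > 0, ∀ {Ω : Type u} [MeasurableSpace Ω] {P : Measure Ω} {u : ℝ × ℝ → Ω → E d},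
      IsHeatField P t₀ T S u → ∀ ζ ∈ (Set.Icc t₀ T ×ˢ Set.Icc (0 : ℝ) 1) ×ˢ cube d M,
      ∀ ξ ∈ (Set.Icc t₀ T ×ˢ Set.Icc (0 : ℝ) 1) ×ˢ cube d M, ∀ ε, 0 < ε → ε ≤ 1 →
      P {ω | u ζ.1 ω ∈ Metric.ball ζ.2 ε ∧ u ξ.1 ω ∈ Metric.ball ξ.2 ε} ≤
        ENNReal.ofReal (C * (ε ^ d) ^ 2) * jointKernel ζ ξ := by
  obtain ⟨c, hc, hA2⟩ := hypA2_dens₂ S (T := T) ht₀ (M + 1) (by linarith)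
  obtain ⟨C₁, hC₁, hpair⟩ := exists_prob_pair_le_of_dens.{u} S ht₀ T (M := M)
  obtain ⟨C₂, hC₂, hball⟩ := exists_prob_closedBall_le.{u} S ht₀ T
  obtain ⟨B, hB, hexp⟩ := exists_pow_mul_exp_le d (c := 4 * c) (by positivity)
  set C := C₁ * c + C₁ * c * B + C₂ * 4 ^ d with hC
  have hC0 : 0 < C := by positivity
  refine ⟨C, hC0, fun {Ω} _ P u hu => ?_⟩
  rintro ⟨p, z⟩ ⟨hp, hz⟩ ⟨q, w⟩ ⟨hq, hw⟩ ε hε hε1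
  simp only [jointKernel]
  set m := max (√(parabolicDist p q)) ‖z - w‖ with hm
  have hm0 : 0 ≤ m := le_max_of_le_left (Real.sqrt_nonneg _)
  rcases hm0.eq_or_lt with h0 | hm0
  -- On the diagonal the kernel is infinite, because d > 0, and nothing is to be proved.
  · rw [← h0, ENNReal.ofReal_zero, ENNReal.inv_zero, ENNReal.top_pow hd.ne',
      ENNReal.mul_top (by simp; positivity)]
    exact le_top
  rw [inv_ofReal_pow hm0, ← ENNReal.ofReal_mul (by positivity)]
  have hbound : ∀ x : ℝ, x ≤ C → x * m⁻¹ ^ d * (ε ^ d) ^ 2 ≤ C * (ε ^ d) ^ 2 * m⁻¹ ^ d := by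
    intro x hx
    calc x * m⁻¹ ^ d * (ε ^ d) ^ 2 ≤ C * m⁻¹ ^ d * (ε ^ d) ^ 2 := by gcongr
      _ = _ := by ring
  rcases le_or_gt ‖z - w‖ (√(parabolicDist p q)) with h1 | h1
  · have hm' : m = √(parabolicDist p q) := max_eq_left h1
    have hpq : p ≠ q := by
      rintro rfl
      rw [hm'] at hm0
      simp [parabolicDist] at hm0
    have hD := parabolicDist_pos hpq
    refine (hpair hu p hp q hq hpq z hz w hw ε hε hε1 (c * m⁻¹ ^ d) ?_).trans
      (ENNReal.ofReal_le_ofReal ?_)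
    · intro z' hz' w' hw'
      refine (hA2 p hp q hq hpq z' (mem_cube_of_mem_ball hz hε1 hz') w'
        (mem_cube_of_mem_ball hw hε1 hw')).trans ?_
      rw [rpow_natCast_div_two hD.le, hm', inv_pow, ← div_eq_mul_inv]
      refine mul_le_of_le_one_right (by positivity) (Real.exp_le_one_iff.2 ?_)
      have : 0 ≤ ‖z' - w'‖ ^ 2 / (c * parabolicDist p q) := by positivity
      linarith
    · rw [← mul_assoc]
      refine hbound _ ?_
      have : 0 ≤ C₁ * c * B + C₂ * 4 ^ d := by positivity
      linarith
  have hm' : m = ‖z - w‖ := max_eq_right h1.le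
  rcases le_or_gt (4 * ε) ‖z - w‖ with h2 | h2
  · have hfar : ∀ z' ∈ Metric.ball z ε, ∀ w' ∈ Metric.ball w ε, m / 2 ≤ ‖z' - w'‖ := by
      intro z' hz' w' hw'
      rw [mem_ball_iff_norm] at hz' hw'
      have e : z - w = (z - z') + (z' - w') + (w' - w) := by abel
      have h3 : ‖z - w‖ ≤ ‖z - z'‖ + ‖z' - w'‖ + ‖w' - w‖ := by
        rw [e]; exact norm_add₃_le
      rw [norm_sub_rev z z'] at h3
      rw [hm']
      linarith
    by_cases hpq : p = q
    · subst hpq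
      refine le_trans (le_of_eq ?_) zero_le
      rw [show {ω | u p ω ∈ Metric.ball z ε ∧ u p ω ∈ Metric.ball w ε} = ∅ from ?_, measure_empty]
      refine Set.eq_empty_iff_forall_notMem.2 fun ω hω => ?_
      have := hfar _ hω.1 _ hω.2
      rw [sub_self, norm_zero] at this
      linarith
    have hD := parabolicDist_pos hpq
    refine (hpair hu p hp q hq hpq z hz w hw ε hε hε1 (c * B * m⁻¹ ^ d) ?_).trans
      (ENNReal.ofReal_le_ofReal ?_)
    · intro z' hz' w' hw'
      refine (hA2 p hp q hq hpq z' (mem_cube_of_mem_ball hz hε1 hz') w'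
        (mem_cube_of_mem_ball hw hε1 hw')).trans ?_
      have h3 := hfar z' hz' w' hw'
      have hsD := Real.sqrt_pos.2 hD
      have h4 := hexp (m / √(parabolicDist p q)) (by positivity)
      rw [rpow_natCast_div_two hD.le]
      have h5 : Real.exp (-(‖z' - w'‖ ^ 2 / (c * parabolicDist p q))) ≤
          Real.exp (-((m / √(parabolicDist p q)) ^ 2 / (4 * c))) := by
        rw [Real.exp_le_exp, neg_le_neg_iff, div_pow, Real.sq_sqrt hD.le]
        calc m ^ 2 / parabolicDist p q / (4 * c) = (m / 2) ^ 2 / (c * parabolicDist p q) := by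
              field_simp; ring
          _ ≤ _ := by gcongr
      calc _ ≤ c / √(parabolicDist p q) ^ d *
            Real.exp (-((m / √(parabolicDist p q)) ^ 2 / (4 * c))) := by gcongr
        _ = c * m⁻¹ ^ d * ((m / √(parabolicDist p q)) ^ d *
            Real.exp (-((m / √(parabolicDist p q)) ^ 2 / (4 * c)))) := by
            rw [div_pow m (√(parabolicDist p q)) d, inv_pow]
            field_simp
        _ ≤ c * m⁻¹ ^ d * B := by gcongr
        _ = _ := by ring
    · rw [show C₁ * (c * B * m⁻¹ ^ d) = (C₁ * c * B) * m⁻¹ ^ d by ring]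
      refine hbound _ ?_
      have : 0 ≤ C₁ * c + C₂ * 4 ^ d := by positivity
      linarith
  · calc P {ω | u p ω ∈ Metric.ball z ε ∧ u q ω ∈ Metric.ball w ε}
        ≤ P {ω | u p ω ∈ Metric.closedBall z ε} :=
          measure_mono fun ω hω => Metric.ball_subset_closedBall hω.1
      _ ≤ ENNReal.ofReal (C₂ * ε ^ d) := hball hu p hp z ε hε
      _ ≤ _ := by
          refine ENNReal.ofReal_le_ofReal ?_
          have h3 : 1 ≤ 4 ^ d * (m⁻¹ ^ d * ε ^ d) := by
            rw [← mul_pow, ← mul_pow]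
            refine one_le_pow₀ ?_
            rw [inv_mul_eq_div, ← mul_div_assoc, one_le_div hm0, hm']
            exact h2.le
          calc C₂ * ε ^ d = C₂ * ε ^ d * 1 := by ring
            _ ≤ C₂ * ε ^ d * (4 ^ d * (m⁻¹ ^ d * ε ^ d)) := by gcongr
            _ = (C₂ * 4 ^ d) * m⁻¹ ^ d * (ε ^ d) ^ 2 := by ring
            _ ≤ _ := hbound _ (by
                have : 0 ≤ C₁ * c + C₁ * c * B := by positivity
                linarith)

/-- The retraction of the plane on the parameter rectangle. -/
noncomputable def rectProj (t₀ T : ℝ) (p : ℝ × ℝ) : ℝ × ℝ :=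
  (max t₀ (min T p.1), max 0 (min 1 p.2))

lemma continuous_rectProj (t₀ T : ℝ) : Continuous (rectProj t₀ T) := by
  unfold rectProj; fun_prop

lemma rectProj_mem {T : ℝ} (hT : t₀ ≤ T) (p : ℝ × ℝ) :
    rectProj t₀ T p ∈ Set.Icc t₀ T ×ˢ Set.Icc (0 : ℝ) 1 :=
  ⟨⟨le_max_left _ _, max_le hT (min_le_left _ _)⟩, le_max_left _ _,
    max_le zero_le_one (min_le_left _ _)⟩

lemma rectProj_eq {T : ℝ} {p : ℝ × ℝ} (hp : p ∈ Set.Icc t₀ T ×ˢ Set.Icc (0 : ℝ) 1) :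
    rectProj t₀ T p = p := by
  obtain ⟨⟨h1, h2⟩, h3, h4⟩ := hp
  simp only [rectProj, min_eq_right h2, max_eq_right h1, min_eq_right h4, max_eq_right h3]

/-- The second moment argument integrates over ω and the parameters jointly, whereas `u` is only
a.e. measurable at each parameter and a.s. continuous. Setting the field to zero on a measurable
null set and retracting the parameters gives a Carathéodory function. -/
lemma IsHeatField.exists_modification {T : ℝ} (hT : t₀ ≤ T) {Ω : Type*} [MeasurableSpace Ω]
    {P : Measure Ω} {S : E d ≃L[ℝ] E d} {u : ℝ × ℝ → Ω → E d} (hu : IsHeatField P t₀ T S u) :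
    ∃ v : ℝ × ℝ → Ω → E d, (∀ ω, Continuous fun p => v p ω) ∧ (∀ p, Measurable (v p)) ∧
      ∀ᵐ ω ∂P, ∀ p ∈ Set.Icc t₀ T ×ˢ Set.Icc (0 : ℝ) 1, v p ω = u p ω := by
  classical
  set x : ℕ → ℝ × ℝ := TopologicalSpace.denseSeq (ℝ × ℝ)
  have hmem := rectProj_mem (t₀ := t₀) hT
  have hae : ∀ᵐ ω ∂P, ContinuousOn (fun p => u p ω) (Set.Icc t₀ T ×ˢ Set.Icc (0 : ℝ) 1) ∧
      ∀ n, u (rectProj t₀ T (x n)) ω = (hu.aemeasurable _ (hmem (x n))).mk _ ω :=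
    hu.continuous.and (ae_all_iff.2 fun n => (hu.aemeasurable _ (hmem (x n))).ae_eq_mk)
  -- Off this null set, measurability along a countable dense set of parameters passes to all
  -- parameters by continuity.
  obtain ⟨N, hN, hNm, hN0⟩ := exists_measurable_superset_of_null (ae_iff.1 hae)
  have hgood : ∀ ω ∉ N, ContinuousOn (fun p => u p ω) (Set.Icc t₀ T ×ˢ Set.Icc (0 : ℝ) 1) ∧
      ∀ n, u (rectProj t₀ T (x n)) ω = (hu.aemeasurable _ (hmem (x n))).mk _ ω := by
    intro ω hω
    by_contra h
    exact hω (hN h)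
  have hcont : ∀ ω, Continuous fun p => Nᶜ.indicator (u (rectProj t₀ T p)) ω := by
    intro ω
    by_cases hω : ω ∈ N
    · have : (fun p => Nᶜ.indicator (u (rectProj t₀ T p)) ω) = fun _ => 0 := by
        funext p; simp [hω]
      rw [this]; exact continuous_const
    · have : (fun p => Nᶜ.indicator (u (rectProj t₀ T p)) ω) = fun p => u (rectProj t₀ T p) ω := by
        funext p; simp [hω]
      rw [this]
      exact (hgood ω hω).1.comp_continuous (continuous_rectProj t₀ T) hmem
  refine ⟨fun p => Nᶜ.indicator (u (rectProj t₀ T p)), hcont, fun p => ?_, ?_⟩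
  · have hx : ∀ n, Measurable (Nᶜ.indicator (u (rectProj t₀ T (x n)))) := by
      intro n
      have e : Nᶜ.indicator (u (rectProj t₀ T (x n))) =
          Nᶜ.indicator ((hu.aemeasurable _ (hmem (x n))).mk _) :=
        Set.indicator_congr fun ω hω => (hgood ω hω).2 n
      rw [e]
      exact (hu.aemeasurable _ (hmem (x n))).measurable_mk.indicator hNm.compl
    have hp : p ∈ closure (Set.range x) := TopologicalSpace.denseRange_denseSeq (ℝ × ℝ) p
    obtain ⟨y, hy, hylim⟩ := mem_closure_iff_seq_limit.1 hp
    choose k hk using hy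
    refine measurable_of_tendsto_metrizable (f := fun n => Nᶜ.indicator (u (rectProj t₀ T (y n))))
      (fun n => ?_) (tendsto_pi_nhds.2 fun ω => ?_)
    · rw [← hk n]; exact hx (k n)
    · exact ((hcont ω).tendsto p).comp hylim
  · have h1 : ∀ᵐ ω ∂P, ω ∉ N := by rw [ae_iff]; simpa using hN0
    filter_upwards [h1] with ω hω p hp
    simp [hω, rectProj_eq hp]

/-- Cauchy–Schwarz for f and the indicator of its support. -/
lemma sq_lintegral_le {Ω : Type*} [MeasurableSpace Ω] {P : Measure Ω} {f : Ω → ℝ≥0∞}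
    (hf : Measurable f) : (∫⁻ ω, f ω ∂P) ^ 2 ≤ P {ω | f ω ≠ 0} * ∫⁻ ω, f ω ^ 2 ∂P := by
  have hset : MeasurableSet {ω | f ω ≠ 0} := (hf (measurableSet_singleton 0)).compl
  have h := ENNReal.lintegral_mul_le_Lp_mul_Lq P Real.HolderConjugate.two_two
    (f := {ω | f ω ≠ 0}.indicator 1) (g := f) ((measurable_const.indicator hset).aemeasurable)
    hf.aemeasurable
  have e1 : ∫⁻ ω, (({ω | f ω ≠ 0}.indicator (1 : Ω → ℝ≥0∞)) * f) ω ∂P = ∫⁻ ω, f ω ∂P := by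
    refine lintegral_congr fun ω => ?_
    by_cases hω : f ω = 0 <;> simp [hω]
  have e2 : ∫⁻ ω, ({ω | f ω ≠ 0}.indicator (1 : Ω → ℝ≥0∞) ω) ^ (2 : ℝ) ∂P = P {ω | f ω ≠ 0} := by
    rw [← lintegral_indicator_one hset]
    refine lintegral_congr fun ω => ?_
    by_cases hω : f ω = 0 <;> simp [hω]
  rw [e1, e2] at h
  calc (∫⁻ ω, f ω ∂P) ^ 2 ≤ (P {ω | f ω ≠ 0} ^ (1 / 2 : ℝ) * (∫⁻ ω, f ω ^ (2 : ℝ) ∂P) ^ (1 / 2 : ℝ)) ^ 2 := by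
        gcongr
    _ = _ := by
        rw [mul_pow, ← ENNReal.rpow_natCast, ← ENNReal.rpow_natCast, ← ENNReal.rpow_mul,
          ← ENNReal.rpow_mul]
        norm_num

/-- A probability measure `l` of finite energy on pairs (parameter, level) bounds below the
probability that the graph of the field meets its support. -/
lemma exists_le_prob_graph (hd : 0 < d) (S : E d ≃L[ℝ] E d) (ht₀ : 0 < t₀) {T : ℝ} (hT : t₀ < T)
    {M : ℝ} (hM : 0 < M) :
    ∃ a > 0, ∀ {Ω : Type u} [MeasurableSpace Ω] {P : Measure Ω} [IsProbabilityMeasure P]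
      {u : ℝ × ℝ → Ω → E d}, IsHeatField P t₀ T S u →
      ∀ (l : Measure ((ℝ × ℝ) × E d)) [IsProbabilityMeasure l] (Q : Set ((ℝ × ℝ) × E d)),
      IsCompact Q → Q ⊆ (Set.Icc t₀ T ×ˢ Set.Icc (0 : ℝ) 1) ×ˢ cube d M → l Qᶜ = 0 →
      ENNReal.ofReal a * (∫⁻ ζ, ∫⁻ ξ, jointKernel ζ ξ ∂l ∂l)⁻¹ ≤
        P {ω | ∃ ζ ∈ Q, u ζ.1 ω = ζ.2} := by
  obtain ⟨c, hc, hlow⟩ := exists_le_prob_ball.{u} S ht₀ T hM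
  obtain ⟨C, hC, hpair⟩ := exists_prob_pair_le.{u} hd S ht₀ T hM
  refine ⟨c ^ 2 / C, by positivity, fun {Ω} _ P _ u hu l _ Q hQ hQsub hlQ => ?_⟩
  obtain ⟨v, hvc, hvm, hvu⟩ := hu.exists_modification hT.le
  have hvmeas : Measurable fun x : (ℝ × ℝ) × Ω => v x.1 x.2 :=
    measurable_uncurry_of_continuous_of_measurable hvc hvm
  set 𝓔 := ∫⁻ ζ, ∫⁻ ξ, jointKernel ζ ξ ∂l ∂l with h𝓔
  have : IsFiniteMeasure l := IsZeroOrProbabilityMeasure.toIsFiniteMeasure l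
  have : SFinite l := @instSFiniteOfSigmaFinite _ _ l (IsFiniteMeasure.toSigmaFinite l)
  have hlae : ∀ᵐ ζ ∂l, ζ ∈ Q := by rw [ae_iff]; exact hlQ
  -- the sets of near hits
  set B : ℝ → Set (Ω × ((ℝ × ℝ) × E d)) := fun ε => {x | ‖v x.2.1 x.1 - x.2.2‖ < ε} with hB
  have hBm : ∀ ε, MeasurableSet (B ε) := by
    intro ε
    have h1 : Measurable fun x : Ω × ((ℝ × ℝ) × E d) => v x.2.1 x.1 :=
      hvmeas.comp (by fun_prop : Measurable fun x : Ω × ((ℝ × ℝ) × E d) => (x.2.1, x.1))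
    exact measurableSet_lt (by fun_prop) measurable_const
  set J : ℝ → Ω → ℝ≥0∞ := fun ε ω => l (Prod.mk ω ⁻¹' B ε) with hJ
  have hJm : ∀ ε, Measurable (J ε) := fun ε => measurable_measure_prodMk_left (hBm ε)
  have hJ1 : ∀ ε, 0 < ε → ε ≤ 1 → ENNReal.ofReal (c * ε ^ d) ≤ ∫⁻ ω, J ε ω ∂P := by
    intro ε hε hε1
    have e : ∫⁻ ω, J ε ω ∂P = ∫⁻ ζ, P ((fun ω => (ω, ζ)) ⁻¹' B ε) ∂l := by
      rw [← Measure.prod_apply (hBm ε), Measure.prod_apply_symm (hBm ε)]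
    rw [e]
    calc ENNReal.ofReal (c * ε ^ d) = ∫⁻ _ζ, ENNReal.ofReal (c * ε ^ d) ∂l := by simp
      _ ≤ _ := by
        refine lintegral_mono_ae ?_
        filter_upwards [hlae] with ζ hζ
        refine (hlow hu ζ.1 (hQsub hζ).1 ζ.2 (hQsub hζ).2 ε hε hε1).trans (measure_mono_ae ?_)
        filter_upwards [hvu] with ω hω h1
        change ‖v ζ.1 ω - ζ.2‖ < ε
        rw [hω ζ.1 (hQsub hζ).1]
        exact mem_ball_iff_norm.1 h1
  have hJ2 : ∀ ε, 0 < ε → ε ≤ 1 →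
      ∫⁻ ω, J ε ω ^ 2 ∂P ≤ ENNReal.ofReal (C * (ε ^ d) ^ 2) * 𝓔 := by
    intro ε hε hε1
    set B₂ : Set (Ω × (((ℝ × ℝ) × E d) × ((ℝ × ℝ) × E d))) :=
      {x | (x.1, x.2.1) ∈ B ε ∧ (x.1, x.2.2) ∈ B ε} with hB₂
    have hB₂m : MeasurableSet B₂ :=
      ((by fun_prop : Measurable fun x : Ω × (((ℝ × ℝ) × E d) × ((ℝ × ℝ) × E d)) => (x.1, x.2.1))
        (hBm ε)).inter
      ((by fun_prop : Measurable fun x : Ω × (((ℝ × ℝ) × E d) × ((ℝ × ℝ) × E d)) => (x.1, x.2.2))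
        (hBm ε))
    have e : ∫⁻ ω, J ε ω ^ 2 ∂P = ∫⁻ x, P ((fun ω => (ω, x)) ⁻¹' B₂) ∂(l.prod l) := by
      rw [← Measure.prod_apply_symm hB₂m, Measure.prod_apply hB₂m]
      refine lintegral_congr fun ω => ?_
      rw [show Prod.mk ω ⁻¹' B₂ = (Prod.mk ω ⁻¹' B ε) ×ˢ (Prod.mk ω ⁻¹' B ε) from rfl,
        Measure.prod_prod, sq]
    have hae : ∀ᵐ x ∂(l.prod l), x.1 ∈ Q ∧ x.2 ∈ Q :=
      (Measure.quasiMeasurePreserving_fst.ae hlae).and (Measure.quasiMeasurePreserving_snd.ae hlae)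
    calc ∫⁻ ω, J ε ω ^ 2 ∂P = ∫⁻ x, P ((fun ω => (ω, x)) ⁻¹' B₂) ∂(l.prod l) := e
      _ ≤ ∫⁻ x, ENNReal.ofReal (C * (ε ^ d) ^ 2) * jointKernel x.1 x.2 ∂(l.prod l) := by
          refine lintegral_mono_ae ?_
          filter_upwards [hae] with x hx
          refine le_trans (measure_mono_ae ?_) (hpair hu x.1 (hQsub hx.1) x.2 (hQsub hx.2) ε hε hε1)
          filter_upwards [hvu] with ω hω h1
          obtain ⟨h1, h2⟩ : ‖v x.1.1 ω - x.1.2‖ < ε ∧ ‖v x.2.1 ω - x.2.2‖ < ε := h1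
          rw [hω _ (hQsub hx.1).1] at h1
          rw [hω _ (hQsub hx.2).1] at h2
          exact ⟨mem_ball_iff_norm.2 h1, mem_ball_iff_norm.2 h2⟩
      _ = _ := by
          rw [lintegral_const_mul _ measurable_jointKernel,
            lintegral_prod _ measurable_jointKernel.aemeasurable]
  -- The square of the first moment and the second moment are both of order ε^{2d}, so ε cancels.
  have hA : ∀ ε, 0 < ε → ε ≤ 1 → ENNReal.ofReal (c ^ 2 / C) * 𝓔⁻¹ ≤ P {ω | J ε ω ≠ 0} := by
    intro ε hε hε1
    have h1 := sq_lintegral_le (P := P) (hJm ε)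
    have h2 : ENNReal.ofReal (c * ε ^ d) ^ 2 ≤
        P {ω | J ε ω ≠ 0} * (ENNReal.ofReal (C * (ε ^ d) ^ 2) * 𝓔) := by
      calc _ ≤ (∫⁻ ω, J ε ω ∂P) ^ 2 := by gcongr; exact hJ1 ε hε hε1
        _ ≤ _ := h1.trans (by gcongr; exact hJ2 ε hε hε1)
    rw [← div_eq_mul_inv]
    refine ENNReal.div_le_of_le_mul ?_
    have hpos : 0 < C * (ε ^ d) ^ 2 := by positivity
    have e : ENNReal.ofReal (c ^ 2 / C) =
        ENNReal.ofReal (c * ε ^ d) ^ 2 / ENNReal.ofReal (C * (ε ^ d) ^ 2) := by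
      rw [← ENNReal.ofReal_pow (by positivity), ← ENNReal.ofReal_div_of_pos hpos]
      congr 1
      field_simp
    rw [e]
    refine ENNReal.div_le_of_le_mul (h2.trans (le_of_eq ?_))
    ring
  -- letting the near hits become hits
  set ε : ℕ → ℝ := fun n => 1 / ((n : ℝ) + 1) with hε
  have hε0 : ∀ n, 0 < ε n := fun n => by simp only [hε]; positivity
  have hε1 : ∀ n, ε n ≤ 1 := fun n => by
    simp only [hε]; rw [div_le_one (by positivity)]; linarith [(Nat.cast_nonneg n : (0 : ℝ) ≤ n)]
  have hanti : Antitone fun n => {ω | J (ε n) ω ≠ 0} := by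
    intro n m hnm ω hω h0
    refine hω (measure_mono_null (fun ζ hζ => ?_) h0)
    have h1 : ‖v ζ.1 ω - ζ.2‖ < ε m := hζ
    have h2 : ε m ≤ ε n := by simp only [hε]; gcongr
    exact h1.trans_le h2
  have hlim := tendsto_measure_iInter_atTop (μ := P)
    (fun n => ((hJm (ε n)) (measurableSet_singleton 0)).compl.nullMeasurableSet)
    hanti ⟨0, measure_ne_top _ _⟩
  have hle : ENNReal.ofReal (c ^ 2 / C) * 𝓔⁻¹ ≤ P (⋂ n, {ω | J (ε n) ω ≠ 0}) :=
    ge_of_tendsto' hlim fun n => hA (ε n) (hε0 n) (hε1 n)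
  refine hle.trans (measure_mono_ae ?_)
  filter_upwards [hvu] with ω hω h1
  have h2 : ∀ n, ∃ ζ ∈ Q, ‖v ζ.1 ω - ζ.2‖ < ε n := by
    intro n
    by_contra! hcon
    refine Set.mem_iInter.1 h1 n (measure_mono_null (t := Qᶜ) (fun ζ hζ hζQ => ?_) hlQ)
    exact absurd hζ (not_lt.2 (hcon ζ hζQ))
  have hQne : Q.Nonempty := let ⟨ζ, hζ, _⟩ := h2 0; ⟨ζ, hζ⟩
  have hcont : Continuous fun ζ : (ℝ × ℝ) × E d => ‖v ζ.1 ω - ζ.2‖ :=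
    (((hvc ω).comp continuous_fst).sub continuous_snd).norm
  -- The continuous distance to the graph attains its minimum on the compact Q, and this minimum is
  -- smaller than every `ε n`.
  obtain ⟨ζ, hζ, hmin⟩ := hQ.exists_isMinOn hQne hcont.continuousOn
  refine ⟨ζ, hζ, ?_⟩
  have h3 : ‖v ζ.1 ω - ζ.2‖ ≤ 0 := by
    refine ge_of_tendsto' (tendsto_one_div_add_atTop_nhds_zero_nat (𝕜 := ℝ)) fun n => ?_
    obtain ⟨ξ, hξ, h4⟩ := h2 n
    exact (hmin hξ).trans h4.le
  rw [← hω ζ.1 (hQsub hζ).1]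
  exact sub_eq_zero.1 (norm_le_zero_iff.1 h3)

end

/-! ### Kernel estimates -/

/-- Dyadic layers: if 2^{-n-1} < x ≤ 2^{-n}, the single term of index n dominates x^{-d}; the
summand 1 serves x > 1. At x = 0 both sides may be infinite, except when d = 0. -/
lemma inv_ofReal_pow_le (d : ℕ) {x : ℝ} (hx : 0 ≤ x) :
    (ENNReal.ofReal x)⁻¹ ^ d ≤
      1 + ∑' n : ℕ, if x ≤ (1 / 2 : ℝ) ^ n then ENNReal.ofReal (2 ^ (d * (n + 1))) else 0 := by
  rcases hx.eq_or_lt with rfl | hx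
  · have h : ∑' n : ℕ, (if (0 : ℝ) ≤ (1 / 2 : ℝ) ^ n then
        ENNReal.ofReal (2 ^ (d * (n + 1))) else 0) = ⊤ := by
      refine top_unique ?_
      calc (⊤ : ℝ≥0∞) = ∑' _n : ℕ, 1 := (ENNReal.tsum_const_eq_top_of_ne_zero one_ne_zero).symm
        _ ≤ _ := by
          refine ENNReal.tsum_le_tsum fun n => ?_
          rw [if_pos (by positivity), ← ENNReal.ofReal_one]
          exact ENNReal.ofReal_le_ofReal (one_le_pow₀ (by norm_num))
    rw [h]
    simp
  rw [inv_ofReal_pow hx]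
  rcases le_or_gt x 1 with h1 | h1
  · obtain ⟨n, hn1, hn2⟩ := exists_nat_pow_near_of_lt_one hx h1
      (by norm_num : (0 : ℝ) < 1 / 2) (by norm_num)
    refine le_add_left ?_
    refine le_trans ?_ (ENNReal.le_tsum n)
    rw [if_pos hn2]
    refine ENNReal.ofReal_le_ofReal ?_
    rw [mul_comm, pow_mul]
    gcongr
    rw [inv_le_comm₀ hx (by positivity), ← inv_pow, ← one_div]
    exact hn1.le
  · refine le_add_right ?_
    rw [← ENNReal.ofReal_one]
    refine ENNReal.ofReal_le_ofReal (pow_le_one₀ (by positivity) ?_)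
    exact inv_le_one_of_one_le₀ h1.le

/-- Integrating the layers: the layer at scale 2^{-n} has height 2^{d(n+1)} and mass at most C
2^{-bn}, and it is present only while r ≤ 2^{-n}. The result is a dyadic sum of exponent d - b
truncated at scale r. -/
lemma lintegral_inv_max_pow_le {Z : Type*} [MeasurableSpace Z] {m : Measure Z}
    [IsProbabilityMeasure m] {ρ : Z → ℝ} (hρ : Measurable ρ) (hρ0 : ∀ s, 0 ≤ ρ s) {C : ℝ}
    {b : ℕ} (hm : ∀ s, 0 < s → m {x | ρ x ≤ s} ≤ ENNReal.ofReal (C * s ^ b))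
    (d : ℕ) {r : ℝ} :
    ∫⁻ x, (ENNReal.ofReal (max (ρ x) r))⁻¹ ^ d ∂m ≤
      1 + ∑' n : ℕ, if r ≤ (1 / 2 : ℝ) ^ n then
        ENNReal.ofReal (C * 2 ^ d * (2 ^ (d * n) / 2 ^ (b * n))) else 0 := by
  have hset : ∀ n : ℕ, MeasurableSet {x | ρ x ≤ (1 / 2 : ℝ) ^ n} := fun n =>
    measurableSet_le hρ measurable_const
  have hset' : ∀ n : ℕ, MeasurableSet {x | max (ρ x) r ≤ (1 / 2 : ℝ) ^ n} := fun n =>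
    measurableSet_le (hρ.max measurable_const) measurable_const
  have hmeas : ∀ n : ℕ, Measurable fun x => if max (ρ x) r ≤ (1 / 2 : ℝ) ^ n then
      ENNReal.ofReal (2 ^ (d * (n + 1))) else 0 := fun n =>
    Measurable.ite (hset' n) measurable_const measurable_const
  calc _ ≤ ∫⁻ x, (1 + ∑' n : ℕ, if max (ρ x) r ≤ (1 / 2 : ℝ) ^ n then
        ENNReal.ofReal (2 ^ (d * (n + 1))) else 0) ∂m :=
        lintegral_mono fun x => inv_ofReal_pow_le d (le_max_of_le_left (hρ0 x))
    _ = 1 + ∑' n : ℕ, ∫⁻ x, (if max (ρ x) r ≤ (1 / 2 : ℝ) ^ n then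
        ENNReal.ofReal (2 ^ (d * (n + 1))) else 0) ∂m := by
        rw [lintegral_add_left measurable_const, lintegral_tsum fun n => (hmeas n).aemeasurable]
        simp
    _ ≤ _ := by
        gcongr with n
        split_ifs with h
        · calc _ ≤ ∫⁻ x, {x | ρ x ≤ (1 / 2 : ℝ) ^ n}.indicator
                (fun _ => ENNReal.ofReal (2 ^ (d * (n + 1)))) x ∂m := by
                refine lintegral_mono fun x => ?_
                simp only [max_le_iff, h, and_true, Set.indicator_apply, Set.mem_ofPred_eq]
                exact le_rfl
            _ = ENNReal.ofReal (2 ^ (d * (n + 1))) * m {x | ρ x ≤ (1 / 2 : ℝ) ^ n} :=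
                lintegral_indicator_const (hset n) _
            _ ≤ ENNReal.ofReal (2 ^ (d * (n + 1))) * ENNReal.ofReal (C * ((1 / 2) ^ n) ^ b) := by
                gcongr; exact hm _ (by positivity)
            _ = _ := by
                rw [← ENNReal.ofReal_mul (by positivity)]
                congr 1
                rw [mul_add, mul_one, pow_add, ← pow_mul, mul_comm n b, one_div, inv_pow]
                ring
        · refine le_of_eq ?_
          rw [lintegral_eq_zero_iff (hmeas n)]
          exact Eventually.of_forall fun x =>
            if_neg fun h' => h ((le_max_right (ρ x) r).trans h')

lemma exists_tsum_ite_le {r : ℝ} (hr : 0 < r) (hr1 : r ≤ 1) : ∃ N : ℕ, (2 : ℝ) ^ N ≤ r⁻¹ ∧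
    ∀ c : ℕ → ℝ≥0∞, ∑' n : ℕ, (if r ≤ (1 / 2 : ℝ) ^ n then c n else 0) ≤
      ∑ n ∈ Finset.range (N + 1), c n := by
  obtain ⟨N, hN1, hN2⟩ := exists_nat_pow_near_of_lt_one hr hr1
    (by norm_num : (0 : ℝ) < 1 / 2) (by norm_num)
  refine ⟨N, ?_, fun c => ?_⟩
  · rw [le_inv_comm₀ (by positivity) hr, ← inv_pow, ← one_div]
    exact hN2
  · rw [tsum_eq_sum (s := Finset.range (N + 1))]
    · refine Finset.sum_le_sum fun n _ => ?_
      split_ifs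
      · exact le_rfl
      · exact zero_le
    · intro n hn
      rw [if_neg]
      rw [not_le]
      refine lt_of_le_of_lt ?_ hN1
      refine pow_le_pow_of_le_one (by norm_num) (by norm_num) ?_
      simpa using hn

lemma tsum_ite_eq_zero {r : ℝ} (hr : 1 < r) (c : ℕ → ℝ≥0∞) :
    ∑' n : ℕ, (if r ≤ (1 / 2 : ℝ) ^ n then c n else 0) = 0 := by
  rw [ENNReal.tsum_eq_zero]
  intro n
  rw [if_neg]
  rw [not_le]
  exact lt_of_le_of_lt (pow_le_one₀ (by norm_num) (by norm_num)) hr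

lemma sum_range_pow_le {x : ℝ} (hx : 2 ≤ x) (N : ℕ) :
    ∑ n ∈ Finset.range (N + 1), x ^ n ≤ 2 * x ^ N := by
  induction N with
  | zero => simp
  | succ N ih =>
    rw [Finset.sum_range_succ]
    have : 2 * x ^ N ≤ x ^ (N + 1) := by
      rw [pow_succ, mul_comm]; gcongr
    linarith

/-- The dyadic sums are dominated by the kernels `K_β`. -/
lemma exists_dyadic_sum_le (d b j : ℕ) (hj : 0 < j) {C N₀ R β : ℝ} (hC : 0 ≤ C) (hR : 0 < R)
    (hN : 1 < N₀) (hRN : d = b → R < N₀) (hβ : β = ((d : ℝ) - b) / j) :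
    ∃ B > 0, ∀ r τ : ℝ, 0 ≤ r → r ^ j = τ → τ ≤ R →
      1 + ∑' n : ℕ, (if r ≤ (1 / 2 : ℝ) ^ n then
        ENNReal.ofReal (C * (2 ^ (d * n) / 2 ^ (b * n))) else 0) ≤
        ENNReal.ofReal B * rieszKernel N₀ β τ := by
  have hj' : (0 : ℝ) < j := by exact_mod_cast hj
  rcases lt_trichotomy d b with hdb | hdb | hdb
  -- For d < b the series is dominated by a convergent geometric series, and the kernel is 1.
  · have hβ0 : β < 0 := by
      rw [hβ]
      exact div_neg_of_neg_of_pos (sub_neg.2 (by exact_mod_cast hdb)) hj'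
    refine ⟨1 + C * 2, by positivity, fun r τ hr hrτ hτ => ?_⟩
    have hsum : ENNReal.ofReal (C * 2) = ∑' n : ℕ, ENNReal.ofReal (C * (1 / 2) ^ n) := by
      rw [← ENNReal.ofReal_tsum_of_nonneg (fun n => by positivity)
        (summable_geometric_two.mul_left _), tsum_mul_left, tsum_geometric_two]
    rw [rieszKernel, if_neg hβ0.not_gt, if_neg hβ0.ne, mul_one, ENNReal.ofReal_add zero_le_one
      (by positivity), ENNReal.ofReal_one, hsum]
    gcongr with n
    split_ifs
    · refine ENNReal.ofReal_le_ofReal ?_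
      gcongr
      rw [one_div, inv_pow, ← one_div, div_le_div_iff₀ (by positivity) (by positivity), one_mul,
        ← pow_add]
      refine pow_le_pow_right₀ (by norm_num) ?_
      nlinarith
    · exact zero_le
  · have hRN := hRN hdb
    subst hdb
    have hβ0 : β = 0 := by rw [hβ]; simp
    set ℓ := Real.log (N₀ / R) with hℓ
    have hℓ0 : 0 < ℓ := Real.log_pos (by rwa [one_lt_div hR])
    -- For d = b all terms equal C and their number is of order log(1/r). Since τ ≤ R < N₀, the
    -- kernel is at least ℓ > 0, so it also absorbs the additive constant.
    refine ⟨(1 + C) / ℓ + 2 * C, by positivity, fun r τ hr hrτ hτ => ?_⟩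
    rw [rieszKernel, if_neg (by rw [hβ0]; exact lt_irrefl _), if_pos hβ0]
    split_ifs with hτ0
    · rw [ENNReal.mul_top (by simp; positivity)]
      exact le_top
    have hr0 : 0 < r := by
      refine lt_of_le_of_ne hr fun h => hτ0 ?_
      rw [← hrτ, ← h, zero_pow hj.ne']
    have hτp : 0 < τ := by rw [← hrτ]; positivity
    set Λ := Real.log (N₀ / τ) with hΛ
    have hΛℓ : ℓ ≤ Λ := Real.log_le_log (by positivity) (by gcongr)
    have h1 : 1 ≤ Λ / ℓ := by rwa [one_le_div hℓ0]
    have hΛ0 : 0 < Λ := hℓ0.trans_le hΛℓ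
    rw [← ENNReal.ofReal_mul (by positivity)]
    rcases le_or_gt r 1 with hr1 | hr1
    · obtain ⟨N, hN1, hN2⟩ := exists_tsum_ite_le hr0 hr1
      calc _ ≤ 1 + ∑ n ∈ Finset.range (N + 1), ENNReal.ofReal (C * (2 ^ (d * n) / 2 ^ (d * n))) := by
            gcongr; exact hN2 _
        _ = ENNReal.ofReal (1 + (N + 1) * C) := by
            rw [ENNReal.ofReal_add zero_le_one (by positivity), ENNReal.ofReal_one]
            congr 1
            rw [Finset.sum_congr rfl fun n _ => by
              rw [div_self (by positivity : (2 : ℝ) ^ (d * n) ≠ 0), mul_one], Finset.sum_const,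
              Finset.card_range, nsmul_eq_mul, ENNReal.ofReal_mul (by positivity)]
            norm_cast
        _ ≤ _ := by
            refine ENNReal.ofReal_le_ofReal ?_
            have h2 : (N : ℝ) * Real.log 2 ≤ -Real.log r := by
              rw [← Real.log_pow, ← Real.log_inv]
              exact Real.log_le_log (by positivity) hN1
            have h3 : -Real.log r ≤ Λ := by
              have h4 : Real.log τ = j * Real.log r := by rw [← hrτ, Real.log_pow]
              have h5 : Real.log r ≤ 0 := Real.log_nonpos hr hr1
              have h6 : (1 : ℝ) ≤ j := by exact_mod_cast hj
              rw [hΛ, Real.log_div (by positivity) hτp.ne', h4]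
              have := Real.log_pos hN
              nlinarith
            have h7 : (N : ℝ) ≤ 2 * Λ := by
              have := Real.log_two_gt_d9
              have h8 : (0 : ℝ) ≤ N := Nat.cast_nonneg N
              nlinarith
            calc (1 : ℝ) + (N + 1) * C = (1 + C) * 1 + C * N := by ring
              _ ≤ (1 + C) * (Λ / ℓ) + C * (2 * Λ) := by gcongr
              _ = _ := by ring
    · rw [tsum_ite_eq_zero hr1, add_zero, ← ENNReal.ofReal_one]
      refine ENNReal.ofReal_le_ofReal ?_
      calc (1 : ℝ) ≤ 1 * (Λ / ℓ) := by linarith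
        _ ≤ (1 + C) * (Λ / ℓ) + 2 * C * Λ := by
            have : 0 ≤ C * (Λ / ℓ) + 2 * C * Λ := by positivity
            linarith
        _ = _ := by ring
  · obtain ⟨e, rfl⟩ : ∃ e, d = b + e := ⟨d - b, by omega⟩
    have he : 0 < e := by omega
    have hβe : β = (e : ℝ) / j := by rw [hβ]; push_cast; ring
    have hβ0 : 0 < β := by rw [hβe]; positivity
    -- For d > b the last term dominates the sum and is of order r^{-(d-b)} = τ^{-β}. The part (1 +
    -- R)^e covers the additive 1, since r ≤ 1 + R.
    refine ⟨(1 + R) ^ e + 2 * C, by positivity, fun r τ hr hrτ hτ => ?_⟩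
    rw [rieszKernel, if_pos hβ0]
    rcases hr.eq_or_lt with h0 | hr0
    · rw [← hrτ, ← h0, zero_pow hj.ne', ENNReal.ofReal_zero, ENNReal.zero_rpow_of_neg (by linarith),
        ENNReal.mul_top (by simp; positivity)]
      exact le_top
    have hτp : 0 < τ := by rw [← hrτ]; positivity
    have hker : ENNReal.ofReal τ ^ (-β) = ENNReal.ofReal (r⁻¹ ^ e) := by
      rw [ENNReal.ofReal_rpow_of_pos hτp, ← hrτ, ← Real.rpow_natCast r j, ← Real.rpow_mul hr, hβe,
        inv_pow, ← Real.rpow_natCast, ← Real.rpow_neg hr]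
      congr 2
      field_simp
    have hrR : r ≤ 1 + R := by
      rcases le_or_gt r 1 with hr1 | hr1
      · linarith
      · have : r ≤ r ^ j := le_self_pow₀ hr1.le hj.ne'
        linarith
    have h1 : 1 ≤ (1 + R) ^ e * r⁻¹ ^ e := by
      rw [← mul_pow]
      refine one_le_pow₀ ?_
      rw [← div_eq_mul_inv, one_le_div hr0]
      exact hrR
    rw [hker, ← ENNReal.ofReal_mul (by positivity)]
    rcases le_or_gt r 1 with hr1 | hr1
    · obtain ⟨N, hN1, hN2⟩ := exists_tsum_ite_le hr0 hr1
      have hq : ∀ n : ℕ, (2 : ℝ) ^ ((b + e) * n) / 2 ^ (b * n) = (2 ^ e) ^ n := fun n => by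
        rw [add_mul, pow_add, ← pow_mul, mul_div_cancel_left₀ _ (by positivity)]
      simp only [hq]
      calc _ ≤ 1 + ∑ n ∈ Finset.range (N + 1), ENNReal.ofReal (C * (2 ^ e) ^ n) := by
            gcongr; exact hN2 _
        _ = ENNReal.ofReal (1 + C * ∑ n ∈ Finset.range (N + 1), (2 ^ e) ^ n) := by
            rw [ENNReal.ofReal_add zero_le_one (by positivity), ENNReal.ofReal_one, Finset.mul_sum,
              ENNReal.ofReal_sum_of_nonneg fun n _ => by positivity]
        _ ≤ _ := by
            refine ENNReal.ofReal_le_ofReal ?_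
            have h2 := sum_range_pow_le (x := 2 ^ e) (le_self_pow₀ (by norm_num) he.ne') N
            have h3 : ((2 : ℝ) ^ e) ^ N ≤ r⁻¹ ^ e := by
              rw [← pow_mul, mul_comm, pow_mul]; gcongr
            calc (1 : ℝ) + C * ∑ n ∈ Finset.range (N + 1), (2 ^ e) ^ n
                ≤ (1 + R) ^ e * r⁻¹ ^ e + C * (2 * r⁻¹ ^ e) := by
                  gcongr; exact h2.trans (by gcongr)
              _ = _ := by ring
    · rw [tsum_ite_eq_zero hr1, add_zero, ← ENNReal.ofReal_one]
      refine ENNReal.ofReal_le_ofReal (h1.trans ?_)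
      gcongr
      linarith

lemma measurable_rieszKernel (N₀ β : ℝ) : Measurable (rieszKernel N₀ β) := by
  unfold rieszKernel
  split_ifs
  · exact (ENNReal.measurable_ofReal).pow_const _
  · exact Measurable.ite (measurableSet_singleton 0) measurable_const
      ((Real.measurable_log.comp (measurable_const.div measurable_id)).ennreal_ofReal)
  · exact measurable_const

/-! ### Lower bounds by capacities -/

/-- Inversion exchanges the infimum of the energies with the supremum of their inverses, so no
minimising measure is needed. -/
lemma mul_cap_le {X : Type*} [TopologicalSpace X] [MeasurableSpace X] {ρ : X → X → ℝ} {N₀ β : ℝ}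
    {F : Set X} {a : ℝ} (ha : 0 < a) {x : ℝ≥0∞}
    (h : ∀ μ ∈ probsOn F, ENNReal.ofReal a * (energy ρ N₀ β μ)⁻¹ ≤ x) :
    ENNReal.ofReal a * cap ρ N₀ β F ≤ x := by
  have ha0 : ENNReal.ofReal a ≠ 0 := by simpa using ha
  rw [mul_comm, ← ENNReal.le_div_iff_mul_le (Or.inl ha0) (Or.inl ENNReal.ofReal_ne_top), cap,
    ENNReal.inv_le_iff_inv_le]
  refine le_iInf₂ fun μ hμ => ?_
  rw [ENNReal.inv_le_iff_inv_le, ENNReal.le_div_iff_mul_le (Or.inl ha0)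
    (Or.inl ENNReal.ofReal_ne_top), mul_comm]
  exact h μ hμ

/-- Integrating out one copy of the auxiliary variable s' already gives the bound, uniformly in the
other copy s. -/
lemma lintegral_lintegral_map_le {X Y Z : Type*} [MeasurableSpace X] [MeasurableSpace Y]
    [MeasurableSpace Z] {k : Y → Y → ℝ≥0∞} (hk : Measurable fun y : Y × Y => k y.1 y.2)
    {f : Z × X → Y} (hf : Measurable f) {m : Measure Z} {μ : Measure X} [IsProbabilityMeasure m]
    [IsProbabilityMeasure μ] {κ : X → X → ℝ≥0∞} (hκ : Measurable fun x : X × X => κ x.1 x.2)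
    {c : ℝ≥0∞} {Z' : Set Z} {K : Set X} (hZ' : ∀ᵐ s ∂m, s ∈ Z') (hK : ∀ᵐ x ∂μ, x ∈ K)
    (h : ∀ s ∈ Z', ∀ x ∈ K, ∀ y ∈ K, ∫⁻ s', k (f (s, x)) (f (s', y)) ∂m ≤ c * κ x y) :
    ∫⁻ ζ, ∫⁻ ξ, k ζ ξ ∂((m.prod μ).map f) ∂((m.prod μ).map f) ≤ c * ∫⁻ x, ∫⁻ y, κ x y ∂μ ∂μ := by
  have : IsProbabilityMeasure ((m.prod μ).map f) := Measure.isProbabilityMeasure_map hf.aemeasurable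
  have hae : ∀ᵐ x ∂(m.prod μ), x.1 ∈ Z' ∧ x.2 ∈ K :=
    (Measure.quasiMeasurePreserving_fst.ae hZ').and (Measure.quasiMeasurePreserving_snd.ae hK)
  have hinner : ∀ a : Z × X, a.1 ∈ Z' ∧ a.2 ∈ K → ∫⁻ ξ, k (f a) ξ ∂((m.prod μ).map f) ≤
      c * ∫⁻ y, κ a.2 y ∂μ := by
    rintro ⟨s, x⟩ ⟨hs, hx⟩
    have hk1 : Measurable fun ξ => k (f (s, x)) ξ :=
      hk.comp (measurable_const.prodMk measurable_id)
    have hk2 : Measurable fun y => κ x y := hκ.comp measurable_prodMk_left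
    have hk5 : Measurable fun a => k (f (s, x)) (f a) := hk1.comp hf
    rw [lintegral_map hk1 hf, lintegral_prod_symm _ hk5.aemeasurable, ← lintegral_const_mul _ hk2]
    refine lintegral_mono_ae ?_
    filter_upwards [hK] with y hy
    exact h s hs x hx y hy
  have hk3 : Measurable fun ζ => ∫⁻ ξ, k ζ ξ ∂((m.prod μ).map f) := hk.lintegral_prod_right'
  have hk4 : Measurable fun a : Z × X => ∫⁻ y, κ a.2 y ∂μ :=
    hκ.lintegral_prod_right'.comp measurable_snd
  rw [lintegral_map hk3 hf]
  calc _ ≤ ∫⁻ a, c * ∫⁻ y, κ a.2 y ∂μ ∂(m.prod μ) := by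
        refine lintegral_mono_ae ?_
        filter_upwards [hae] with a ha
        exact hinner a ha
    _ = _ := by
        rw [lintegral_const_mul _ hk4, lintegral_prod _ hk4.aemeasurable]
        simp

section

variable {d : ℕ} {t₀ : ℝ}

/-- The general lower bound: the points `x ∈ F` are tested by the field at the parameters and
levels `f (s, x)`, where `s` is distributed according to an auxiliary measure `m` of dimension
`b` with respect to `θ`. -/
lemma exists_mul_cap_le (hd : 0 < d) (S : E d ≃L[ℝ] E d) (ht₀ : 0 < t₀) {T : ℝ} (hT : t₀ < T)
    {M : ℝ} (hM : 0 < M) (b j : ℕ) (hj : 0 < j) {C N₀ R β : ℝ} (hC : 0 ≤ C) (hR : 0 < R)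
    (hN : 1 < N₀) (hRN : d = b → R < N₀) (hβ : β = ((d : ℝ) - b) / j) :
    ∃ a > 0, ∀ {Ω : Type u} [MeasurableSpace Ω] {P : Measure Ω} [IsProbabilityMeasure P]
      {u : ℝ × ℝ → Ω → E d}, IsHeatField P t₀ T S u →
      ∀ {X Z : Type} [TopologicalSpace X] [MeasurableSpace X] [TopologicalSpace Z]
        [MeasurableSpace Z] {ρ r : X → X → ℝ} {θ : Z → Z → ℝ} {m : Measure Z} {Z' : Set Z}
        {F : Set X} {f : Z × X → (ℝ × ℝ) × E d} {V : Set Ω}, IsProbabilityMeasure m →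
      IsCompact Z' → m Z'ᶜ = 0 → Measurable f → Continuous f →
      Measurable (Function.uncurry ρ) → (∀ s, Measurable (θ s)) → (∀ s s', 0 ≤ θ s s') →
      (∀ s ∈ Z', ∀ ε, 0 < ε → m {s' | θ s s' ≤ ε} ≤ ENNReal.ofReal (C * ε ^ b)) →
      (∀ x ∈ F, ∀ y ∈ F, 0 ≤ r x y ∧ r x y ^ j = ρ x y ∧ ρ x y ≤ R) →
      (∀ s s' x y, max (θ s s') (r x y) ≤ max (√(parabolicDist (f (s, x)).1 (f (s', y)).1))
        ‖(f (s, x)).2 - (f (s', y)).2‖) →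
      (∀ s ∈ Z', ∀ x ∈ F, f (s, x) ∈ (Set.Icc t₀ T ×ˢ Set.Icc (0 : ℝ) 1) ×ˢ cube d M) →
      (∀ ω, (∃ s ∈ Z', ∃ x ∈ F, u (f (s, x)).1 ω = (f (s, x)).2) → ω ∈ V) →
      ∀ a' ≤ a, 0 < a' → ENNReal.ofReal a' * cap ρ N₀ β F ≤ P V := by
  obtain ⟨a, ha, hgraph⟩ := exists_le_prob_graph.{u} hd S ht₀ hT hM
  obtain ⟨B, hB, hker⟩ := exists_dyadic_sum_le d b j hj (C := C * 2 ^ d) (by positivity) hR hN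
    hRN hβ
  refine ⟨a / B, by positivity, ?_⟩
  intro Ω _ P _ u hu X Z _ _ _ _ ρ r θ m Z' F f V _ hZ' hmZ hfm hfc hρ hθm hθ0 hmass hr hmax hmem
    hV a' ha' ha'0
  have hsub : ENNReal.ofReal a' * cap ρ N₀ β F ≤ ENNReal.ofReal (a / B) * cap ρ N₀ β F := by
    gcongr
  refine hsub.trans (mul_cap_le (by positivity) fun μ hμ => ?_)
  obtain ⟨_, K, hK, hKF, hμK⟩ := hμ
  have hmae : ∀ᵐ s ∂m, s ∈ Z' := by rw [ae_iff]; exact hmZ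
  have hμae : ∀ᵐ x ∂μ, x ∈ K := by rw [ae_iff]; exact hμK
  have hae : ∀ᵐ x ∂(m.prod μ), x.1 ∈ Z' ∧ x.2 ∈ K :=
    (Measure.quasiMeasurePreserving_fst.ae hmae).and (Measure.quasiMeasurePreserving_snd.ae hμae)
  set l := (m.prod μ).map f with hl
  have : IsProbabilityMeasure l := Measure.isProbabilityMeasure_map hfm.aemeasurable
  set Q := f '' (Z' ×ˢ K) with hQ
  have hQc : IsCompact Q := (hZ'.prod hK).image hfc
  have hlQ : l Qᶜ = 0 := by
    rw [hl, Measure.map_apply hfm hQc.isClosed.measurableSet.compl]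
    refine measure_mono_null ?_ (ae_iff.1 hae)
    intro x hx h
    exact hx ⟨x, ⟨h.1, h.2⟩, rfl⟩
  have hρk : Measurable fun x : X × X => rieszKernel N₀ β (ρ x.1 x.2) :=
    (measurable_rieszKernel N₀ β).comp hρ
  have henergy : ∫⁻ ζ, ∫⁻ ξ, jointKernel ζ ξ ∂l ∂l ≤ ENNReal.ofReal B * energy ρ N₀ β μ := by
    refine lintegral_lintegral_map_le measurable_jointKernel hfm hρk hmae hμae ?_
    intro s hs x hx y hy
    obtain ⟨h1, h2, h3⟩ := hr x (hKF hx) y (hKF hy)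
    refine le_trans ?_ (hker (r x y) (ρ x y) h1 h2 h3)
    refine le_trans (lintegral_mono fun s' => ?_)
      (lintegral_inv_max_pow_le (hθm s) (hθ0 s) (hmass s hs) d)
    unfold jointKernel
    -- The distance between image pairs dominates both θ, which m integrates, and r, the scale at
    -- which ρ separates x from y.
    exact pow_le_pow_left' (ENNReal.inv_le_inv.2 (ENNReal.ofReal_le_ofReal (hmax s s' x y))) d
  have hmain := hgraph hu l Q hQc ?_ hlQ
  · refine le_trans ?_ (hmain.trans (measure_mono ?_))
    · calc ENNReal.ofReal (a / B) * (energy ρ N₀ β μ)⁻¹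
          = ENNReal.ofReal a * (ENNReal.ofReal B * energy ρ N₀ β μ)⁻¹ := by
            rw [ENNReal.mul_inv (Or.inl (by simpa using hB)) (Or.inl ENNReal.ofReal_ne_top),
              ENNReal.ofReal_div_of_pos hB, div_eq_mul_inv, mul_assoc]
        _ ≤ _ := by gcongr
    · rintro ω ⟨_, ⟨⟨s, x⟩, ⟨hs, hx⟩, rfl⟩, h1⟩
      exact hV ω ⟨s, hs, x, hKF hx, h1⟩
  · rintro _ ⟨⟨s, x⟩, ⟨hs, hx⟩, rfl⟩
    exact hmem s hs x (hKF hx)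

end

/-! ### Lower bounds for hitting probabilities and level sets -/

/-- The uniform distribution on `[a, b]`. -/
noncomputable def unifMeasure (a b : ℝ) : Measure ℝ :=
  (ENNReal.ofReal (b - a))⁻¹ • volume.restrict (Set.Icc a b)

lemma isProbabilityMeasure_unifMeasure {a b : ℝ} (hab : a < b) :
    IsProbabilityMeasure (unifMeasure a b) := by
  refine ⟨?_⟩
  rw [unifMeasure, Measure.smul_apply, Measure.restrict_apply_univ, Real.volume_Icc, smul_eq_mul]
  exact ENNReal.inv_mul_cancel (by simpa using hab) ENNReal.ofReal_ne_top

lemma unifMeasure_compl (a b : ℝ) : unifMeasure a b (Set.Icc a b)ᶜ = 0 := by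
  rw [unifMeasure, Measure.smul_apply, Measure.restrict_apply measurableSet_Icc.compl,
    Set.compl_inter_self, measure_empty, smul_zero]

lemma unifMeasure_abs_sub_le {a b : ℝ} (hab : a < b) (x r : ℝ) :
    unifMeasure a b {y | |x - y| ≤ r} ≤ ENNReal.ofReal (2 / (b - a) * r) := by
  have hb : 0 < b - a := sub_pos.2 hab
  have hsub : {y | |x - y| ≤ r} ⊆ Set.Icc (x - r) (x + r) := by
    intro y hy
    have := abs_le.1 (show |x - y| ≤ r from hy)
    constructor <;> linarith
  calc unifMeasure a b {y | |x - y| ≤ r}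
      ≤ (ENNReal.ofReal (b - a))⁻¹ * volume (Set.Icc (x - r) (x + r)) := by
        rw [unifMeasure, Measure.smul_apply, smul_eq_mul]
        exact mul_le_mul_right ((Measure.restrict_apply_le _ _).trans (measure_mono hsub)) _
    _ = _ := by
        rw [Real.volume_Icc, ← ENNReal.ofReal_inv_of_pos hb, ← ENNReal.ofReal_mul (by positivity)]
        congr 1
        ring

lemma abs_le_sq_of_sqrt_le {x ε : ℝ} (h : √|x| ≤ ε) : |x| ≤ ε ^ 2 :=
  (Real.sqrt_le_left ((Real.sqrt_nonneg _).trans h)).1 h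

lemma abs_le_pow_of_sqrt_sqrt_le {x ε : ℝ} (h : √(√|x|) ≤ ε) : |x| ≤ ε ^ 4 := by
  have h1 : √|x| ≤ ε ^ 2 := (Real.sqrt_le_left ((Real.sqrt_nonneg _).trans h)).1 h
  have h2 := abs_le_sq_of_sqrt_le h1
  rwa [← pow_mul] at h2

lemma unifMeasure_sqrt_le {a b : ℝ} (hab : a < b) (x ε : ℝ) :
    unifMeasure a b {y | √|x - y| ≤ ε} ≤ ENNReal.ofReal (2 / (b - a) * ε ^ 2) :=
  (measure_mono fun _ hy => abs_le_sq_of_sqrt_le hy).trans (unifMeasure_abs_sub_le hab x _)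

lemma unifMeasure_sqrt_sqrt_le {a b : ℝ} (hab : a < b) (x ε : ℝ) :
    unifMeasure a b {y | √(√|x - y|) ≤ ε} ≤ ENNReal.ofReal (2 / (b - a) * ε ^ 4) :=
  (measure_mono fun _ hy => abs_le_pow_of_sqrt_sqrt_le hy).trans (unifMeasure_abs_sub_le hab x _)

lemma sqrt_sqrt_le_sqrt_parabolicDist (p q : ℝ × ℝ) :
    √(√|p.1 - q.1|) ≤ √(parabolicDist p q) :=
  Real.sqrt_le_sqrt (le_add_of_nonneg_right (abs_nonneg _))

lemma sqrt_le_sqrt_parabolicDist (p q : ℝ × ℝ) : √|p.2 - q.2| ≤ √(parabolicDist p q) :=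
  Real.sqrt_le_sqrt (le_add_of_nonneg_left (Real.sqrt_nonneg _))

lemma sqrt_sqrt_pow_four {x : ℝ} (hx : 0 ≤ x) : √(√x) ^ 4 = x := by
  rw [show 4 = 2 * 2 from rfl, pow_mul, Real.sq_sqrt (Real.sqrt_nonneg _), Real.sq_sqrt hx]

lemma dist_le_of_mem_cube {d : ℕ} {M : ℝ} (hM : 0 ≤ M) {z w : E d} (hz : z ∈ cube d M)
    (hw : w ∈ cube d M) : dist z w ≤ 2 * M * √d := by
  rw [dist_eq_norm]
  linarith [norm_sub_le z w, norm_le_of_mem_cube hM hz, norm_le_of_mem_cube hM hw]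

lemma mem_cube_of_mem_ball_zero {d : ℕ} {M : ℝ} {z : E d} (hz : z ∈ Metric.ball 0 M) :
    z ∈ cube d M := by
  intro i
  rw [mem_ball_zero_iff] at hz
  have h := PiLp.norm_apply_le z i
  rw [Real.norm_eq_abs] at h
  exact abs_le.1 (h.trans hz.le)

section

variable {d : ℕ} {t₀ : ℝ}

/-- Here μ charges levels, and m is uniform on the parameters. In the scale |t - s|^{1/4}, |x -
y|^{1/2} of the field, time has dimension 4 and space dimension 2, so b is 6, 2 or 4. -/
lemma exists_hitLowerBounds (hd : 0 < d) (S : E d ≃L[ℝ] E d) (ht₀ : 0 < t₀) {T : ℝ} (hT : t₀ < T)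
    {M : ℝ} (hM : 0 < M) {N₀ : ℝ} (hN : 2 * M * √d < N₀) (hN1 : 1 < N₀) : ∃ a > 0,
    ∀ {Ω : Type u} [MeasurableSpace Ω] {P : Measure Ω} [IsProbabilityMeasure P]
      {u : ℝ × ℝ → Ω → E d}, IsHeatField P t₀ T S u →
      ∀ a' ≤ a, 0 < a' → HitLowerBounds P u (Set.Icc t₀ T) (Set.Icc 0 1) N₀ d M a' := by
  have hL0 : 0 < T - t₀ := sub_pos.2 hT
  have hd' : (0 : ℝ) < d := by exact_mod_cast hd
  have hR : 0 < 2 * M * √d := by positivity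
  have hmI := isProbabilityMeasure_unifMeasure hT
  have hmJ := isProbabilityMeasure_unifMeasure (zero_lt_one (α := ℝ))
  obtain ⟨a₁, ha₁, h₁⟩ := exists_mul_cap_le.{u} hd S ht₀ hT hM 6 1 one_pos
    (C := 2 / (T - t₀) * 2) (N₀ := N₀) (R := 2 * M * √d) (β := (d : ℝ) - 6) (by positivity) hR hN1
    (fun _ => hN) (by simp)
  obtain ⟨a₂, ha₂, h₂⟩ := exists_mul_cap_le.{u} hd S ht₀ hT hM 2 1 one_pos
    (C := 2 / (1 - 0)) (N₀ := N₀) (R := 2 * M * √d) (β := (d : ℝ) - 2) (by norm_num) hR hN1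
    (fun _ => hN) (by simp)
  obtain ⟨a₃, ha₃, h₃⟩ := exists_mul_cap_le.{u} hd S ht₀ hT hM 4 1 one_pos
    (C := 2 / (T - t₀)) (N₀ := N₀) (R := 2 * M * √d) (β := (d : ℝ) - 4) (by positivity) hR hN1
    (fun _ => hN) (by simp)
  have hr : ∀ K ⊆ cube d M, ∀ z ∈ K, ∀ w ∈ K,
      0 ≤ dist z w ∧ dist z w ^ 1 = dist z w ∧ dist z w ≤ 2 * M * √d := fun K hK z hz w hw =>
    ⟨dist_nonneg, pow_one _, dist_le_of_mem_cube hM.le (hK hz) (hK hw)⟩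
  have hρ : Measurable (Function.uncurry (dist : E d → E d → ℝ)) := continuous_dist.measurable
  refine ⟨min a₁ (min a₂ a₃), by positivity, fun {Ω} _ P _ u hu a' ha' ha'0 => ⟨?_, ?_, ?_⟩⟩
  · intro K hK _
    refine h₁ hu (Z := ℝ × ℝ) (Z' := Set.Icc t₀ T ×ˢ Set.Icc (0 : ℝ) 1)
      (m := (unifMeasure t₀ T).prod (unifMeasure 0 1)) (r := dist)
      (θ := fun p q => max (√(√|p.1 - q.1|)) (√|p.2 - q.2|)) (f := fun x => x) inferInstance
      (isCompact_Icc.prod isCompact_Icc) ?_ measurable_id continuous_id hρ (fun s => by fun_prop)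
      (fun p q => le_max_of_le_left (Real.sqrt_nonneg _)) ?_ (hr K hK) ?_
      (fun s hs z hz => ⟨hs, hK hz⟩) ?_ a' (ha'.trans (min_le_left _ _)) ha'0
    · have h1 : ∀ᵐ t ∂(unifMeasure t₀ T), t ∈ Set.Icc t₀ T := by
        rw [ae_iff]; exact unifMeasure_compl t₀ T
      have h2 : ∀ᵐ x ∂(unifMeasure 0 1), x ∈ Set.Icc (0 : ℝ) 1 := by
        rw [ae_iff]; exact unifMeasure_compl 0 1
      exact ae_iff.1 ((Measure.quasiMeasurePreserving_fst.ae h1).and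
        (Measure.quasiMeasurePreserving_snd.ae h2))
    · intro p _ ε hε
      have hsub : {q : ℝ × ℝ | max (√(√|p.1 - q.1|)) (√|p.2 - q.2|) ≤ ε} ⊆
          {t | √(√|p.1 - t|) ≤ ε} ×ˢ {x | √|p.2 - x| ≤ ε} := fun q hq => by
        have hq' : max (√(√|p.1 - q.1|)) (√|p.2 - q.2|) ≤ ε := hq
        obtain ⟨h1, h2⟩ := max_le_iff.1 hq'
        exact ⟨h1, h2⟩
      refine (measure_mono hsub).trans ?_
      rw [Measure.prod_prod]
      refine (mul_le_mul' (unifMeasure_sqrt_sqrt_le hT p.1 ε)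
        (unifMeasure_sqrt_le zero_lt_one p.2 ε)).trans (le_of_eq ?_)
      rw [← ENNReal.ofReal_mul (by positivity)]
      congr 1
      ring
    · intro p q z w
      exact max_le_max (max_le (sqrt_sqrt_le_sqrt_parabolicDist p q)
        (sqrt_le_sqrt_parabolicDist p q)) (dist_eq_norm z w).le
    · rintro ω ⟨p, hp, z, hz, h⟩
      exact ⟨z, ⟨p, hp, h⟩, hz⟩
  · intro t ht K hK _
    refine h₂ hu (Z := ℝ) (Z' := Set.Icc (0 : ℝ) 1) (m := unifMeasure 0 1) (r := dist)
      (θ := fun x y => √|x - y|) (f := fun x => ((t, x.1), x.2)) hmJ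
      isCompact_Icc (unifMeasure_compl 0 1) (by fun_prop) (by fun_prop) hρ (fun s => by fun_prop)
      (fun p q => Real.sqrt_nonneg _) (fun x _ ε _ => unifMeasure_sqrt_le zero_lt_one x ε) (hr K hK)
      ?_ (fun s hs z hz => ⟨⟨ht, hs⟩, hK hz⟩) ?_ a'
      (ha'.trans ((min_le_right _ _).trans (min_le_left _ _))) ha'0
    · intro x y z w
      exact max_le_max (sqrt_le_sqrt_parabolicDist (t, x) (t, y)) (dist_eq_norm z w).le
    · rintro ω ⟨x, hx, z, hz, h⟩
      exact ⟨z, ⟨(t, x), ⟨rfl, hx⟩, h⟩, hz⟩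
  · intro x hx K hK _
    refine h₃ hu (Z := ℝ) (Z' := Set.Icc t₀ T) (m := unifMeasure t₀ T) (r := dist)
      (θ := fun t s => √(√|t - s|)) (f := fun y => ((y.1, x), y.2)) hmI
      isCompact_Icc (unifMeasure_compl t₀ T) (by fun_prop) (by fun_prop) hρ (fun s => by fun_prop)
      (fun p q => Real.sqrt_nonneg _) (fun t _ ε _ => unifMeasure_sqrt_sqrt_le hT t ε) (hr K hK)
      ?_ (fun s hs z hz => ⟨⟨hs, hx⟩, hK hz⟩) ?_ a'
      (ha'.trans ((min_le_right _ _).trans (min_le_right _ _))) ha'0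
    · intro t s z w
      exact max_le_max (sqrt_sqrt_le_sqrt_parabolicDist (t, x) (s, x)) (dist_eq_norm z w).le
    · rintro ω ⟨t, ht, z, hz, h⟩
      exact ⟨z, ⟨(t, x), ⟨ht, rfl⟩, h⟩, hz⟩

/-- Here the level is fixed, μ charges parameters, and m is uniform on the coordinate that is
projected away. For the level set and its sections nothing is projected: m is a point mass and b =
0. The power j converts r into the metric, 4 for time and 2 for space and for Δ. -/
lemma exists_levelLowerBounds (hd : 0 < d) (S : E d ≃L[ℝ] E d) (ht₀ : 0 < t₀) {T : ℝ}
    (hT : t₀ < T) {M : ℝ} (hM : 0 < M) {N₀ : ℝ} (hN : T - t₀ < N₀) (hN1 : 1 < N₀) : ∃ a > 0,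
    ∀ {Ω : Type u} [MeasurableSpace Ω] {P : Measure Ω} [IsProbabilityMeasure P]
      {u : ℝ × ℝ → Ω → E d}, IsHeatField P t₀ T S u →
      ∀ a' ≤ a, 0 < a' → LevelLowerBounds P u (Set.Icc t₀ T) (Set.Icc 0 1) N₀ d M a' := by
  have hL0 : 0 < T - t₀ := sub_pos.2 hT
  have hmI := isProbabilityMeasure_unifMeasure hT
  have hmJ := isProbabilityMeasure_unifMeasure (zero_lt_one (α := ℝ))
  obtain ⟨a₁, ha₁, h₁⟩ := exists_mul_cap_le.{u} hd S ht₀ hT hM 0 2 two_pos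
    (C := 1) (N₀ := N₀) (R := √(T - t₀) + 1) (β := (d : ℝ) / 2) zero_le_one (by positivity) hN1
    -- The logarithmic case would require d = b = 0, so no comparison of R with N₀ is needed.
    (fun h => absurd h hd.ne') (by simp)
  obtain ⟨a₂, ha₂, h₂⟩ := exists_mul_cap_le.{u} hd S ht₀ hT hM 2 4 (by norm_num)
    (C := 2 / (1 - 0)) (N₀ := N₀) (R := T - t₀) (β := ((d : ℝ) - 2) / 4) (by norm_num) hL0 hN1
    (fun _ => hN) (by simp)
  obtain ⟨a₃, ha₃, h₃⟩ := exists_mul_cap_le.{u} hd S ht₀ hT hM 4 2 two_pos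
    (C := 2 / (T - t₀)) (N₀ := N₀) (R := 1) (β := ((d : ℝ) - 4) / 2) (by positivity) one_pos hN1
    (fun _ => hN1) (by simp)
  obtain ⟨a₄, ha₄, h₄⟩ := exists_mul_cap_le.{u} hd S ht₀ hT hM 0 4 (by norm_num)
    (C := 1) (N₀ := N₀) (R := T - t₀) (β := (d : ℝ) / 4) zero_le_one hL0 hN1
    (fun h => absurd h hd.ne') (by simp)
  obtain ⟨a₅, ha₅, h₅⟩ := exists_mul_cap_le.{u} hd S ht₀ hT hM 0 2 two_pos
    (C := 1) (N₀ := N₀) (R := 1) (β := (d : ℝ) / 2) zero_le_one one_pos hN1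
    (fun h => absurd h hd.ne') (by simp)
  have hrT : ∀ F ⊆ Set.Icc t₀ T, ∀ t ∈ F, ∀ s ∈ F,
      0 ≤ √(√|t - s|) ∧ √(√|t - s|) ^ 4 = dist t s ∧ dist t s ≤ T - t₀ := fun F hF t ht s hs =>
    ⟨Real.sqrt_nonneg _, sqrt_sqrt_pow_four (abs_nonneg _),
      Real.dist_le_of_mem_Icc (hF ht) (hF hs)⟩
  have hrX : ∀ G ⊆ Set.Icc (0 : ℝ) 1, ∀ x ∈ G, ∀ y ∈ G,
      0 ≤ √|x - y| ∧ √|x - y| ^ 2 = dist x y ∧ dist x y ≤ 1 := fun G hG x hx y hy =>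
    ⟨Real.sqrt_nonneg _, Real.sq_sqrt (abs_nonneg _), Real.dist_le_of_mem_Icc_01 (hG hx) (hG hy)⟩
  have hρ : Measurable (Function.uncurry (dist : ℝ → ℝ → ℝ)) := continuous_dist.measurable
  have hunit : ∀ s ∈ (Set.univ : Set Unit), ∀ ε : ℝ, 0 < ε →
      (Measure.dirac () : Measure Unit) {s' | (fun _ _ => 0 : Unit → Unit → ℝ) s s' ≤ ε} ≤
        ENNReal.ofReal (1 * ε ^ 0) := fun s _ ε hε => by
    rw [pow_zero, one_mul, ENNReal.ofReal_one]
    exact prob_le_one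
  refine ⟨min a₁ (min a₂ (min a₃ (min a₄ a₅))), by positivity,
    fun {Ω} _ P _ u hu a' ha' ha'0 => ?_⟩
  simp only [le_min_iff] at ha'
  obtain ⟨ha'₁, ha'₂, ha'₃, ha'₄, ha'₅⟩ := ha'
  refine ⟨?_, ?_, ?_, ?_, ?_⟩
  · intro z hz H hH _
    refine h₁ hu (Z := Unit) (Z' := Set.univ) (m := Measure.dirac ()) (ρ := parabolicDist)
      (r := fun p q => √(parabolicDist p q)) (θ := fun _ _ => 0) (f := fun x => (x.2, z))
      inferInstance isCompact_univ (by simp) (by fun_prop) (by fun_prop)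
      continuous_parabolicDist.measurable (fun s => measurable_const) (fun _ _ => le_rfl) hunit
      ?_ ?_ (fun s _ p hp => ⟨hH hp, mem_cube_of_mem_ball_zero hz⟩) ?_ a' ha'₁ ha'0
    · intro p hp q hq
      refine ⟨Real.sqrt_nonneg _, Real.sq_sqrt (parabolicDist_nonneg p q), ?_⟩
      refine add_le_add (Real.sqrt_le_sqrt ?_) ?_
      · exact Real.dist_le_of_mem_Icc (hH hp).1 (hH hq).1
      · exact Real.dist_le_of_mem_Icc_01 (hH hp).2 (hH hq).2
    · intro s s' p q
      exact max_le (le_max_of_le_left (Real.sqrt_nonneg _)) (le_max_left _ _)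
    · rintro ω ⟨s, _, p, hp, h⟩
      exact ⟨p, ⟨hH hp, h⟩, hp⟩
  · intro z hz F hF _
    refine h₂ hu (Z := ℝ) (Z' := Set.Icc (0 : ℝ) 1) (m := unifMeasure 0 1)
      (r := fun t s => √(√|t - s|)) (θ := fun x y => √|x - y|) (f := fun x => ((x.2, x.1), z)) hmJ
      isCompact_Icc (unifMeasure_compl 0 1) (by fun_prop) (by fun_prop) hρ (fun s => by fun_prop)
      (fun p q => Real.sqrt_nonneg _) (fun x _ ε _ => unifMeasure_sqrt_le zero_lt_one x ε)
      (hrT F hF) ?_ (fun x hx t ht => ⟨⟨hF ht, hx⟩, mem_cube_of_mem_ball_zero hz⟩) ?_ a' ha'₂ ha'0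
    · intro x y t s
      exact le_max_of_le_left (max_le (sqrt_le_sqrt_parabolicDist (t, x) (s, y))
        (sqrt_sqrt_le_sqrt_parabolicDist (t, x) (s, y)))
    · rintro ω ⟨x, hx, t, ht, h⟩
      exact ⟨t, ⟨hF ht, x, hx, h⟩, ht⟩
  · intro z hz G hG _
    refine h₃ hu (Z := ℝ) (Z' := Set.Icc t₀ T) (m := unifMeasure t₀ T)
      (r := fun x y => √|x - y|) (θ := fun t s => √(√|t - s|)) (f := fun x => ((x.1, x.2), z)) hmI
      isCompact_Icc (unifMeasure_compl t₀ T) (by fun_prop) (by fun_prop) hρ (fun s => by fun_prop)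
      (fun p q => Real.sqrt_nonneg _) (fun t _ ε _ => unifMeasure_sqrt_sqrt_le hT t ε)
      (hrX G hG) ?_ (fun t ht x hx => ⟨⟨ht, hG hx⟩, mem_cube_of_mem_ball_zero hz⟩) ?_ a' ha'₃ ha'0
    · intro t s x y
      exact le_max_of_le_left (max_le (sqrt_sqrt_le_sqrt_parabolicDist (t, x) (s, y))
        (sqrt_le_sqrt_parabolicDist (t, x) (s, y)))
    · rintro ω ⟨t, ht, x, hx, h⟩
      exact ⟨x, ⟨hG hx, t, ht, h⟩, hx⟩
  · intro z hz F hF _ x hx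
    refine h₄ hu (Z := Unit) (Z' := Set.univ) (m := Measure.dirac ())
      (r := fun t s => √(√|t - s|)) (θ := fun _ _ => 0) (f := fun y => ((y.2, x), z))
      inferInstance isCompact_univ (by simp) (by fun_prop) (by fun_prop)
      hρ (fun s => measurable_const) (fun _ _ => le_rfl) hunit
      (hrT F hF) ?_ (fun s _ t ht => ⟨⟨hF ht, hx⟩, mem_cube_of_mem_ball_zero hz⟩) ?_ a' ha'₄ ha'0
    · intro s s' t t'
      exact le_max_of_le_left (max_le (Real.sqrt_nonneg _)
        (sqrt_sqrt_le_sqrt_parabolicDist (t, x) (t', x)))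
    · rintro ω ⟨s, _, t, ht, h⟩
      exact ⟨t, ⟨hF ht, h⟩, ht⟩
  · intro z hz G hG _ t ht
    refine h₅ hu (Z := Unit) (Z' := Set.univ) (m := Measure.dirac ())
      (r := fun x y => √|x - y|) (θ := fun _ _ => 0) (f := fun y => ((t, y.2), z))
      inferInstance isCompact_univ (by simp) (by fun_prop) (by fun_prop)
      hρ (fun s => measurable_const) (fun _ _ => le_rfl) hunit
      (hrX G hG) ?_ (fun s _ x hx => ⟨⟨ht, hG hx⟩, mem_cube_of_mem_ball_zero hz⟩) ?_ a' ha'₅ ha'0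
    · intro s s' x y
      exact le_max_of_le_left (max_le (Real.sqrt_nonneg _)
        (sqrt_le_sqrt_parabolicDist (t, x) (t, y)))
    · rintro ω ⟨s, _, x, hx, h⟩
      exact ⟨x, ⟨hG hx, h⟩, hx⟩

end

end HeatHitting

open HeatHitting in
/-- All constants depend only on `d`, `T`, `t₀`, `σ`, `M` and `N₀`, not on the probability space,
the noise or the version of the solution. -/
theorem theorem4p6 (d : ℕ) (hd : 0 < d) (T t₀ : ℝ) (ht₀ : 0 < t₀) (hT : t₀ < T)
    (σ : Matrix (Fin d) (Fin d) ℝ) (hσ : IsUnit σ.det) :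
    (∃ (p₁ : ℝ × ℝ → E d → ℝ) (p₂ : ℝ × ℝ → ℝ × ℝ → E d × E d → ℝ),
      (∀ (Ω : Type u) [MeasurableSpace Ω] (P : Measure Ω) [IsProbabilityMeasure P]
        (W : Fin d → ℝ≥0 × unitInterval → Ω → ℝ) (u : ℝ × ℝ → Ω → E d),
        IsLinearSolution P T σ W u →
        (∀ p ∈ Set.Icc t₀ T ×ˢ Set.Icc 0 1, HasContinuousDensity P (u p) (p₁ p)) ∧
        (∀ p ∈ Set.Icc t₀ T ×ˢ Set.Icc 0 1, ∀ q ∈ Set.Icc t₀ T ×ˢ Set.Icc 0 1, p ≠ q →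
          HasContinuousDensity P (fun ω => (u p ω, u q ω)) (p₂ p q))) ∧
      HypA1 (Set.Icc t₀ T) (Set.Icc 0 1) p₁ ∧
      HypA2 (Set.Icc t₀ T) (Set.Icc 0 1) d p₂) ∧
    (∀ M > 0, ∃ c > 0,
      ∀ (Ω : Type u) [MeasurableSpace Ω] (P : Measure Ω) [IsProbabilityMeasure P]
        (W : Fin d → ℝ≥0 × unitInterval → Ω → ℝ) (u : ℝ × ℝ → Ω → E d),
        IsLinearSolution P T σ W u →
        SmallBall P u (Set.Icc t₀ T) (Set.Icc 0 1) d M c ∧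
        HitUpperBounds P u (Set.Icc t₀ T) (Set.Icc 0 1) d M c ∧
        LevelUpperBounds P u (Set.Icc t₀ T) (Set.Icc 0 1) d M c) ∧
    (∀ M > 0, ∀ N₀ : ℝ, 2 * M * Real.sqrt d < N₀ → T - t₀ < N₀ → 1 < N₀ → ∃ a > 0,
      ∀ (Ω : Type u) [MeasurableSpace Ω] (P : Measure Ω) [IsProbabilityMeasure P]
        (W : Fin d → ℝ≥0 × unitInterval → Ω → ℝ) (u : ℝ × ℝ → Ω → E d),
        IsLinearSolution P T σ W u →
        HitLowerBounds P u (Set.Icc t₀ T) (Set.Icc 0 1) N₀ d M a ∧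
        LevelLowerBounds P u (Set.Icc t₀ T) (Set.Icc 0 1) N₀ d M a) := by
  set S := matrixEquiv σ hσ
  refine ⟨⟨dens₁ S, dens₂ S, ?_, hypA1_dens₁ S ht₀, hypA2_dens₂ S ht₀⟩, ?_, ?_⟩
  · intro Ω _ P _ W u hu
    have hf := hu.isHeatField ht₀ hσ hd
    exact ⟨fun p hp => hf.hasContinuousDensity ht₀ hp, fun p hp q hq hpq =>
      hf.hasContinuousDensity_pair ht₀ hp hq (condVar_pos ht₀ hp hq hpq)⟩
  · intro M hM
    obtain ⟨c₁, hc₁, h₁⟩ := exists_smallBall.{u} S ht₀ T hM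
    obtain ⟨c₂, hc₂, h₂⟩ := exists_hitUpperBounds.{u} S ht₀ hT hM
    obtain ⟨c₃, hc₃, h₃⟩ := exists_levelUpperBounds.{u} S ht₀ hT hM
    refine ⟨max c₁ (max c₂ c₃), by positivity, fun Ω _ P _ W u hu => ?_⟩
    have hf := hu.isHeatField ht₀ hσ hd
    exact ⟨h₁ hf _ (le_max_left _ _), h₂ hf _ ((le_max_left _ _).trans (le_max_right _ _)),
      h₃ hf _ ((le_max_right _ _).trans (le_max_right _ _))⟩
  · intro M hM N₀ hN hNT hN1
    obtain ⟨a₁, ha₁, h₁⟩ := exists_hitLowerBounds.{u} hd S ht₀ hT hM hN hN1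
    obtain ⟨a₂, ha₂, h₂⟩ := exists_levelLowerBounds.{u} hd S ht₀ hT hM hNT hN1
    refine ⟨min a₁ a₂, by positivity, fun Ω _ P _ W u hu => ?_⟩
    have hf := hu.isHeatField ht₀ hσ hd
    exact ⟨h₁ hf _ (min_le_left _ _) (by positivity), h₂ hf _ (min_le_right _ _) (by positivity)⟩
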